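/- Let $\mathcal D$ be a unitary multifusion category: a $\mathbb C$-linear rigid monoidal category with finite direct sums and finite-dimensional Hom spaces, with finitely many isomorphism classes of simple objects ($\operatorname{End}(X)=\mathbb C\,\mathrm{id}_X\neq 0$), in which every object is a finite direct sum of simple ones, and with an antilinear involutive contravariant identity-on-objects functor $\dagger$ such that $(f\otimes g)^\dagger=f^\dagger\otimes g^\dagger$, the associator and the unitors are unitary, and $f^\dagger f=0$ implies $f=0$. The unit object need not be simple. Let $\operatorname{Irr}(\mathcal D)$ be a set of representatives of the simple objects. For $x\in\operatorname{Irr}(\mathcal D)$ with dual $\bar x$, the duality maps $\mathrm{ev}_x:\bar x\otimes x\to\mathbf 1$, $\mathrm{coev}_x:\mathbf 1\to x\otimes\bar x$ have loop values $\ell_x,r_x$ defined by $\mathrm{id}_x\otimes(\mathrm{ev}_x\mathrm{ev}_x^\dagger)=\ell_x\,\mathrm{id}_x$ and $(\mathrm{coev}_x^\dagger\mathrm{coev}_x)\otimes\mathrm{id}_x=r_x\,\mathrm{id}_x$; the quantum dimension is $d_x=\sqrt{\ell_xr_x}$, and $\widetilde{\mathrm{coev}}_x=\tfrac{d_x}{\ell_x}\mathrm{ev}_x^\dagger:\mathbf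 1\to\bar x\otimes x$, $\widetilde{\mathrm{ev}}_x=\tfrac{d_x}{r_x}\mathrm{coev}_x^\dagger:x\otimes\bar x\to\mathbf 1$ are the duality maps on the other side (so that all $x$-loops have the value $d_x$). Associators and unitors are suppressed below. Let $$\mathbf{Tube}=\bigoplus_{a,b,c,e,f,h\in\operatorname{Irr}(\mathcal D)}\operatorname{Hom}(c,a\otimes e\otimes b)\otimes\operatorname{Hom}(a\otimes f\otimes b,h),$$ and write $[p,q]$ for $p\otimes q$ in the summand $(a,b,c,e,f,h)$: the double-arc diagram with left arc $a$, right arc $b$, lower half $p$ and upper half $q$. For arbitrary objects $A,B$ and $p:c\to A\otimes e\otimes B$, $q:A\otimes f\otimes B\to h$ put $[p,q]=\sum_{r,s}[(\pi_r\otimes\mathrm{id}\otimes\pi'_s)p,\;q(\iota_r\otimes\mathrm{id}\otimes\iota'_s)]$, where $\mathrm{id}_A=\sum_r\iota_r\pi_r$, $\mathrm{id}_B=\sum_s\iota'_s\pi'_s$ are decompositions into simple objects of $\operatorname{Irr}(\mathcal D)$. Define linear maps as follows. * Multiplication (stacking, the second diagram inside the first): $[p,q]\cdot[p',q']=\delta_{f,h'}\delta_{e,c'}\,[(\mathrm{id}_a\otimes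 p'\otimes\mathrm{id}_b)p,\;q(\mathrm{id}_a\otimes q'\otimes\mathrm{id}_b)]$, with arcs $a\otimes a'$ and $b'\otimes b$. * Unit: $1=\sum_{x,y}E^x_y$, where $E^x_y=[\mathrm{id}_y,\mathrm{id}_x]$ has both arcs equal to $\mathbf 1$, with $c=e=y$ and $f=h=x$. * Counit: $\varepsilon([p,q])=\delta_{e,f}\delta_{c,h}\lambda$, where $qp=\lambda\,\mathrm{id}_c$ (the closed diagram divided by $d_h$). * Comultiplication: $\Delta([p,q])=\sum_{i\in\operatorname{Irr}(\mathcal D)}\sum_r[\iota_r,q]\otimes[p,\pi_r]$, where $\mathrm{id}_{a\otimes i\otimes b}=\sum_r\iota_r\pi_r$ is a decomposition into simple objects $k_r\in\operatorname{Irr}(\mathcal D)$. * Antipode (the reflected diagram): $S([p,q])=\frac{d_f}{d_h}\,[\hat q,\hat p]$ with arcs $\bar a,\bar b$, where $\hat q=(\mathrm{id}_{\bar a}\otimes q\otimes\mathrm{id}_{\bar b})(\widetilde{\mathrm{coev}}_a\otimes\mathrm{id}_f\otimes\mathrm{coev}_b):f\to\bar a\otimes h\otimes\bar b$ and $\hat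 p=(\mathrm{ev}_a\otimes\mathrm{id}_e\otimes\widetilde{\mathrm{ev}}_b)(\mathrm{id}_{\bar a}\otimes p\otimes\mathrm{id}_{\bar b}):\bar a\otimes c\otimes\bar b\to e$. Then the following hold. 1. $\mathbf{Tube}$ is finite-dimensional, and with these maps it is a weak Hopf algebra: an associative unital algebra and a coassociative counital coalgebra with $\Delta(xy)=\Delta(x)\Delta(y)$; $(\Delta\otimes\mathrm{id})\Delta(1)=(\Delta(1)\otimes1)(1\otimes\Delta(1))=(1\otimes\Delta(1))(\Delta(1)\otimes1)$; $\varepsilon(xyz)=\varepsilon(xy^{(1)})\varepsilon(y^{(2)}z)=\varepsilon(xy^{(2)})\varepsilon(y^{(1)}z)$; $x^{(1)}S(x^{(2)})=\varepsilon(1^{(1)}x)1^{(2)}$; $S(x^{(1)})x^{(2)}=1^{(1)}\varepsilon(x1^{(2)})$; $S(x^{(1)})x^{(2)}S(x^{(3)})=S(x)$. 2. $\xi=\sum_{x,y}\frac{d_y}{d_x}E^x_y$ is grouplike, i.e. it is invertible with inverse $\xi^{-1}=\sum_{x,y}\frac{d_x}{d_y}E^x_y$ and $\Delta(\xi)=(\xi\otimes\xi)\Delta(1)=\Delta(1)(\xi\otimes\xi)$;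 and $S^2(X)=\xi X\xi^{-1}$ for all $X$. On the summand $(a,b,c,e,f,h)$ the map $S^2$ is multiplication by $\frac{d_fd_c}{d_hd_e}$. 3. All $d_x$ are positive, and $\sum_zN_{xy}^zd_z=d_xd_y$ whenever $x\otimes y\neq0$, where $N_{xy}^z=\dim\operatorname{Hom}(z,x\otimes y)$. 4. Let bases of splitting vertices $\alpha\in\operatorname{Hom}(c,a\otimes b)$ and fusion vertices $\bar\alpha\in\operatorname{Hom}(a\otimes b,c)$, indexed by $1,\dots,N_{ab}^c$, be given with $\bar\beta\alpha=\delta_{c,c'}\delta_{\alpha,\beta}Y_c^{ab}\,\mathrm{id}_c$ and $\mathrm{id}_{a\otimes b}=\sum_{c,\alpha}(Y_c^{ab})^{-1}\alpha\bar\alpha$, $Y_c^{ab}=\sqrt{d_ad_b/d_c}$. Let $[a;b]^{f,g,h;\zeta,\gamma}_{c,d,e;\mu,\nu}=[(\nu\otimes\mathrm{id}_b)\mu,\ \bar\gamma(\bar\zeta\otimes\mathrm{id}_b)]$ for vertices $\mu:c\to d\otimes b$, $\nu:d\to a\otimes e$, $\bar\zeta:a\otimes f\to g$, $\bar\gamma:g\otimes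 b\to h$. These diagrams form a basis of $\mathbf{Tube}$, and $$\varepsilon\big([a;b]^{f,g,h;\zeta,\gamma}_{c,d,e;\mu,\nu}\big)=\delta_{e,f}\delta_{c,h}\delta_{d,g}\delta_{\nu,\zeta}\delta_{\mu,\gamma}\sqrt{\tfrac{d_ad_fd_b}{d_h}},$$ $$\Delta\big([a;b]^{f,g,h;\zeta,\gamma}_{c,d,e;\mu,\nu}\big)=\sum_{i,j,k,\rho,\sigma}\sqrt{\tfrac{d_j}{d_ad_i}}\sqrt{\tfrac{d_k}{d_jd_b}}\;[a;b]^{f,g,h;\zeta,\gamma}_{k,j,i;\rho,\sigma}\otimes[a;b]^{i,j,k;\sigma,\rho}_{c,d,e;\mu,\nu}.$$ Let $F^{ijk}_l$, $(F^{ijk}_l)^{-1}$ (on splitting trees) and $F_{ijk}^l$, $(F_{ijk}^l)^{-1}$ (on fusion trees) be the F-symbols of these bases: $F$ holds the coefficients that expand a tree of type $(ij)k$ in trees of type $i(jk)$, and $F^{-1}$ those of the converse expansion, the vertex indices of each tree being listed with the inner vertex first and the outer vertex second. Then the product of basis diagrams vanishes unless $f=h'$, $e=c'$, and in that case $$[a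;b]^{f,g,h;\zeta,\gamma}_{c,d,e;\mu,\nu}\cdot[a';b']^{f',g',h';\zeta',\gamma'}_{c',d',e';\mu',\nu'}=\sum\,[(F^g_{ag'b'})^{-1}]^{i\rho\sigma}_{f\gamma'\zeta}[(F_d^{ad'b'})^{-1}]^{j\omega\tau}_{e\mu'\nu}[(F^i_{aa'f'})^{-1}]^{k\alpha\beta}_{g'\zeta'\rho}[(F_j^{aa'e'})^{-1}]^{k\alpha\beta'}_{d'\nu'\omega}[F^h_{ib'b}]^{s\kappa\lambda}_{g\sigma\gamma}[F_c^{jb'b}]^{s\kappa\lambda'}_{d\tau\mu}\sqrt{\tfrac{d_ad_{a'}}{d_k}}\sqrt{\tfrac{d_bd_{b'}}{d_s}}\;[k;s]^{f',i,h;\beta,\lambda}_{c,j,e';\lambda',\beta'},$$ summed over all upper indices. -/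

import Mathlib

open CategoryTheory MonoidalCategory Limits
open scoped TensorProduct

universe v u

namespace TubeAlg

noncomputable section

/-! ### Weak Hopf algebras over `ℂ` -/

section WeakHopf

variable {W : Type*} [AddCommMonoid W] [Module ℂ W]

/-- `(x ⊗ y) ⊗ (z ⊗ w) ↦ (x ⊗ m y z) ⊗ w`. -/
def middle (m : W →ₗ[ℂ] W →ₗ[ℂ] W) :
    (W ⊗[ℂ] W) ⊗[ℂ] (W ⊗[ℂ] W) →ₗ[ℂ] (W ⊗[ℂ] W) ⊗[ℂ] W :=
  TensorProduct.map
      (TensorProduct.map LinearMap.id (TensorProduct.lift m) ∘ₗ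
        (TensorProduct.assoc ℂ W W W).toLinearMap) LinearMap.id ∘ₗ
    (TensorProduct.assoc ℂ (W ⊗[ℂ] W) W W).symm.toLinearMap

/-- The componentwise multiplication of `W ⊗ W`: `(x ⊗ y)(z ⊗ w) = xz ⊗ yw`. -/
def tensorMul (m : W →ₗ[ℂ] W →ₗ[ℂ] W) :
    W ⊗[ℂ] W →ₗ[ℂ] W ⊗[ℂ] W →ₗ[ℂ] W ⊗[ℂ] W :=
  TensorProduct.map₂ m m

/-- The functional `y ⊗ z ↦ φ y * ψ z`. -/
def tensorEval (φ ψ : W →ₗ[ℂ] ℂ) : W ⊗[ℂ] W →ₗ[ℂ] ℂ :=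
  LinearMap.mul' ℂ ℂ ∘ₗ TensorProduct.map φ ψ

/-- The left counital map `x ↦ ∑ ε(1₍₁₎ x) 1₍₂₎`. -/
def counitalL (m : W →ₗ[ℂ] W →ₗ[ℂ] W) (one : W) (Δ : W →ₗ[ℂ] W ⊗[ℂ] W) (ε : W →ₗ[ℂ] ℂ)
    (x : W) : W :=
  TensorProduct.lid ℂ W (TensorProduct.map (ε ∘ₗ m.flip x) LinearMap.id (Δ one))

/-- The right counital map `x ↦ ∑ 1₍₁₎ ε(x 1₍₂₎)`. -/
def counitalR (m : W →ₗ[ℂ] W →ₗ[ℂ] W) (one : W) (Δ : W →ₗ[ℂ] W ⊗[ℂ] W) (ε : W →ₗ[ℂ] ℂ)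
    (x : W) : W :=
  TensorProduct.rid ℂ W (TensorProduct.map LinearMap.id (ε ∘ₗ m x) (Δ one))

/-- Weak bialgebra axioms for multiplication `m`, unit `one`, comultiplication `Δ`, counit `ε`. -/
structure IsWeakBialgebra (m : W →ₗ[ℂ] W →ₗ[ℂ] W) (one : W)
    (Δ : W →ₗ[ℂ] W ⊗[ℂ] W) (ε : W →ₗ[ℂ] ℂ) : Prop where
  mul_assoc : ∀ x y z, m (m x y) z = m x (m y z)
  one_mul : ∀ x, m one x = x
  mul_one : ∀ x, m x one = x
  coassoc : (TensorProduct.assoc ℂ W W W).toLinearMap ∘ₗ TensorProduct.map Δ LinearMap.id ∘ₗ Δ =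
    TensorProduct.map LinearMap.id Δ ∘ₗ Δ
  counit_comul : ∀ x, TensorProduct.lid ℂ W (TensorProduct.map ε LinearMap.id (Δ x)) = x
  comul_counit : ∀ x, TensorProduct.rid ℂ W (TensorProduct.map LinearMap.id ε (Δ x)) = x
  comul_mul : ∀ x y, Δ (m x y) = tensorMul m (Δ x) (Δ y)
  comul_one : TensorProduct.map Δ LinearMap.id (Δ one) = middle m (Δ one ⊗ₜ[ℂ] Δ one)
  comul_one_op : TensorProduct.map Δ LinearMap.id (Δ one) = middle m.flip (Δ one ⊗ₜ[ℂ] Δ one)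
  counit_mul : ∀ x y z, ε (m (m x y) z) = tensorEval (ε ∘ₗ m x) (ε ∘ₗ m.flip z) (Δ y)
  counit_mul_op : ∀ x y z, ε (m (m x y) z) =
    tensorEval (ε ∘ₗ m x) (ε ∘ₗ m.flip z) (TensorProduct.comm ℂ W W (Δ y))

/-- Weak Hopf algebra axioms: a weak bialgebra with an antipode `S`. -/
structure IsWeakHopfAlgebra (m : W →ₗ[ℂ] W →ₗ[ℂ] W) (one : W)
    (Δ : W →ₗ[ℂ] W ⊗[ℂ] W) (ε : W →ₗ[ℂ] ℂ) (S : W →ₗ[ℂ] W) : Prop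
    extends IsWeakBialgebra m one Δ ε where
  mul_antipode : ∀ x,
    TensorProduct.lift m (TensorProduct.map LinearMap.id S (Δ x)) = counitalL m one Δ ε x
  antipode_mul : ∀ x,
    TensorProduct.lift m (TensorProduct.map S LinearMap.id (Δ x)) = counitalR m one Δ ε x
  antipode_mul_antipode : ∀ x,
    TensorProduct.lift m (TensorProduct.map (TensorProduct.lift m) LinearMap.id
      (TensorProduct.map (TensorProduct.map S LinearMap.id) S
        (TensorProduct.map Δ LinearMap.id (Δ x)))) = S x

/-- `ξ` is grouplike with inverse `ξ'` (in the sense of weak Hopf algebras). -/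
structure IsGrouplike (m : W →ₗ[ℂ] W →ₗ[ℂ] W) (one : W)
    (Δ : W →ₗ[ℂ] W ⊗[ℂ] W) (ξ ξ' : W) : Prop where
  mul_inv : m ξ ξ' = one
  inv_mul : m ξ' ξ = one
  comul_left : Δ ξ = tensorMul m (ξ ⊗ₜ[ℂ] ξ) (Δ one)
  comul_right : Δ ξ = tensorMul m (Δ one) (ξ ⊗ₜ[ℂ] ξ)

end WeakHopf

/-! ### Unitary multifusion categories -/

/-- `End X = ℂ · id_X`. -/
def IsSimpleObj {D : Type u} [Category.{v} D] [Preadditive D] [Linear ℂ D] (X : D) : Prop :=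
  𝟙 X ≠ 0 ∧ ∀ f : X ⟶ X, ∃ z : ℂ, f = z • 𝟙 X

/-- Isomorphism as an equivalence relation on the simple objects. -/
def simpleSetoid (D : Type u) [Category.{v} D] [Preadditive D] [Linear ℂ D] :
    Setoid {X : D // IsSimpleObj X} :=
  (isIsomorphicSetoid D).comap Subtype.val

/-- The set of isomorphism classes of simple objects. -/
def Irr (D : Type u) [Category.{v} D] [Preadditive D] [Linear ℂ D] : Type u :=
  Quotient (simpleSetoid D)

/-- A unitary multifusion category: a finite semisimple `ℂ`-linear rigid monoidal category with a
compatible dagger such that `f† ∘ f = 0` implies `f = 0`. Rigidity is the separate class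
`RigidCategory D`. -/
class UMFC (D : Type u) [Category.{v} D] [Preadditive D] [Linear ℂ D] [HasFiniteBiproducts D]
    [MonoidalCategory D] [MonoidalPreadditive D] [MonoidalLinear ℂ D] [RigidCategory D] where
  finiteDimensional_hom : ∀ X Y : D, FiniteDimensional ℂ (X ⟶ Y)
  finite_irr : Finite (Irr D)
  semisimple : ∀ X : D, ∃ (n : ℕ) (S : Fin n → D),
    (∀ r, IsSimpleObj (S r)) ∧ Nonempty (X ≅ biproduct S)
  dag : ∀ {X Y : D}, (X ⟶ Y) → (Y ⟶ X)
  dag_dag : ∀ {X Y : D} (f : X ⟶ Y), dag (dag f) = f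
  dag_add : ∀ {X Y : D} (f g : X ⟶ Y), dag (f + g) = dag f + dag g
  dag_smul : ∀ {X Y : D} (z : ℂ) (f : X ⟶ Y), dag (z • f) = (starRingEnd ℂ) z • dag f
  dag_id : ∀ X : D, dag (𝟙 X) = 𝟙 X
  dag_comp : ∀ {X Y Z : D} (f : X ⟶ Y) (g : Y ⟶ Z), dag (f ≫ g) = dag g ≫ dag f
  eq_zero_of_comp_dag : ∀ {X Y : D} (f : X ⟶ Y), f ≫ dag f = 0 → f = 0
  dag_tensor : ∀ {X Y Z T : D} (f : X ⟶ Y) (g : Z ⟶ T), dag (f ⊗ₘ g) = dag f ⊗ₘ dag g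
  dag_associator : ∀ X Y Z : D, dag (α_ X Y Z).hom = (α_ X Y Z).inv
  dag_leftUnitor : ∀ X : D, dag (λ_ X).hom = (λ_ X).inv
  dag_rightUnitor : ∀ X : D, dag (ρ_ X).hom = (ρ_ X).inv

section Category

variable {D : Type u} [Category.{v} D] [Preadditive D] [Linear ℂ D]

/-- The chosen simple object representing a label. -/
def obj (x : Irr D) : D := (Quotient.out x).val

theorem obj_simple (x : Irr D) : IsSimpleObj (obj x) := (Quotient.out x).property

open Classical in
/-- The Kronecker delta as a morphism: the identity if the labels agree, otherwise `0`. -/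
def delta (x y : Irr D) : obj x ⟶ obj y :=
  if h : x = y then eqToHom (congrArg obj h) else 0

/-- The number `z` with `f = z • id`, for an endomorphism `f` of a simple object. -/
def scal (x : Irr D) : (obj x ⟶ obj x) →ₗ[ℂ] ℂ where
  toFun f := Classical.choose ((obj_simple x).2 f)
  map_add' f g := by
    have hf := Classical.choose_spec ((obj_simple x).2 f)
    have hg := Classical.choose_spec ((obj_simple x).2 g)
    have hfg := Classical.choose_spec ((obj_simple x).2 (f + g))
    refine smul_left_injective ℂ (obj_simple x).1 ?_
    simp only [add_smul]
    rw [← hf, ← hg, ← hfg]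
  map_smul' z f := by
    have hf := Classical.choose_spec ((obj_simple x).2 f)
    have hzf := Classical.choose_spec ((obj_simple x).2 (z • f))
    refine smul_left_injective ℂ (obj_simple x).1 ?_
    simp only [smul_eq_mul, RingHom.id_apply, mul_smul]
    rw [← hf, ← hzf]

theorem scal_spec (x : Irr D) (f : obj x ⟶ obj x) : f = scal x f • 𝟙 (obj x) :=
  Classical.choose_spec ((obj_simple x).2 f)

/-- A direct sum decomposition of `X` into the chosen simple objects. -/
structure Decomp (X : D) where
  n : ℕ
  label : Fin n → Irr D
  inj : ∀ r, obj (label r) ⟶ X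
  proj : ∀ r, X ⟶ obj (label r)
  inj_proj_self : ∀ r, inj r ≫ proj r = 𝟙 _
  inj_proj_ne : ∀ r s, r ≠ s → inj r ≫ proj s = 0
  total : ∑ r, proj r ≫ inj r = 𝟙 X

theorem nonempty_decomp [HasFiniteBiproducts D] {X : D} {n : ℕ} {S : Fin n → D}
    (hS : ∀ r, IsSimpleObj (S r)) (e : X ≅ biproduct S) : Nonempty (Decomp X) := by
  have key : ∀ r, Nonempty (obj (Quotient.mk (simpleSetoid D) ⟨S r, hS r⟩) ≅ S r) := fun r =>
    Quotient.mk_out (s := simpleSetoid D) ⟨S r, hS r⟩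
  let i := fun r => (key r).some
  refine ⟨⟨n, fun r => Quotient.mk (simpleSetoid D) ⟨S r, hS r⟩,
    fun r => (i r).hom ≫ biproduct.ι S r ≫ e.inv,
    fun r => e.hom ≫ biproduct.π S r ≫ (i r).inv, ?_, ?_, ?_⟩⟩
  · intro r
    simp
  · intro r s h
    simp [biproduct.ι_π_ne_assoc S h]
  · have h : ∀ r, (e.hom ≫ biproduct.π S r ≫ (i r).inv) ≫ (i r).hom ≫ biproduct.ι S r ≫ e.inv =
        e.hom ≫ (biproduct.π S r ≫ biproduct.ι S r) ≫ e.inv := by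
      intro r
      simp
    simp only [h]
    rw [← Preadditive.comp_sum, ← Preadditive.sum_comp, biproduct.total]
    simp

variable [HasFiniteBiproducts D] [MonoidalCategory D] [MonoidalPreadditive D]
  [MonoidalLinear ℂ D] [RigidCategory D] [UMFC D]

instance : Fintype (Irr D) :=
  haveI : Finite (Irr D) := UMFC.finite_irr
  Fintype.ofFinite _

/-- A fixed decomposition of every object. -/
def decomp (X : D) : Decomp X :=
  Classical.choice <| by
    obtain ⟨n, S, hS, ⟨e⟩⟩ := UMFC.semisimple X
    exact nonempty_decomp hS e

/-! ### Arcs and quantum dimensions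

`ev X : Xᘁ ⊗ X ⟶ 𝟙` and `coev X : 𝟙 ⟶ X ⊗ Xᘁ` are the duality maps. Their daggers, rescaled so
that every closed loop labelled by a simple object takes the same value on both sides, are the
duality maps on the other side. -/

/-- The coevaluation `𝟙 ⟶ X ⊗ Xᘁ`. -/
def coev (X : D) : 𝟙_ D ⟶ X ⊗ Xᘁ := η_ X Xᘁ

/-- The evaluation `Xᘁ ⊗ X ⟶ 𝟙`. -/
def ev (X : D) : Xᘁ ⊗ X ⟶ 𝟙_ D := ε_ X Xᘁ

/-- The value of the loop `ev ∘ ev†`, read off from its action on `x` from the right. -/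
def loopL (x : Irr D) : ℂ :=
  scal x ((ρ_ (obj x)).inv ≫ (obj x ◁ (UMFC.dag (ev (obj x)) ≫ ev (obj x))) ≫ (ρ_ (obj x)).hom)

/-- The value of the loop `coev† ∘ coev`, read off from its action on `x` from the left. -/
def loopR (x : Irr D) : ℂ :=
  scal x ((λ_ (obj x)).inv ≫ ((coev (obj x) ≫ UMFC.dag (coev (obj x))) ▷ obj x) ≫ (λ_ (obj x)).hom)

/-- The quantum dimension: the common value of the two loops after the rescaling of the duality
maps that makes them equal. -/
def qdim (x : Irr D) : ℝ := Real.sqrt (loopL x * loopR x).re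

/-- The cup `𝟙 ⟶ xᘁ ⊗ x`: the multiple of `ev†` for which `ev ∘ cup` is the loop of value `d_x`. -/
def cup (x : Irr D) : 𝟙_ D ⟶ (obj x)ᘁ ⊗ obj x :=
  ((qdim x : ℂ) / loopL x) • UMFC.dag (ev (obj x))

/-- The cap `x ⊗ xᘁ ⟶ 𝟙`: the multiple of `coev†` for which `cap ∘ coev` is the loop of value
`d_x`. -/
def cap (x : Irr D) : obj x ⊗ (obj x)ᘁ ⟶ 𝟙_ D :=
  ((qdim x : ℂ) / loopR x) • UMFC.dag (coev (obj x))

/-! ### The tube algebra -/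

/-- The outer labels of a double-arc diagram: left arc `a`, right arc `b`, lower leg running from
`c` (outside) to `e` (inside), upper leg running from `f` (inside) to `h` (outside). -/
structure TubeLabel (D : Type u) [Category.{v} D] [Preadditive D] [Linear ℂ D] where
  (a b c e f h : Irr D)

/-- Lower half of a diagram with arcs `A`, `B`. -/
abbrev Lower (A B : D) (c e : Irr D) := obj c ⟶ (A ⊗ obj e) ⊗ B

/-- Upper half of a diagram with arcs `A`, `B`. -/
abbrev Upper (A B : D) (f h : Irr D) := (A ⊗ obj f) ⊗ B ⟶ obj h

/-- Diagrams with fixed outer labels. -/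
abbrev TubeComp (L : TubeLabel D) : Type v :=
  Lower (obj L.a) (obj L.b) L.c L.e ⊗[ℂ] Upper (obj L.a) (obj L.b) L.f L.h

/-- The bulk tube algebra as a vector space. -/
abbrev Tube (D : Type u) [Category.{v} D] [Preadditive D] [Linear ℂ D] [HasFiniteBiproducts D]
    [MonoidalCategory D] [MonoidalPreadditive D] [MonoidalLinear ℂ D] [RigidCategory D] [UMFC D] :
    Type (max u v) :=
  DirectSum (TubeLabel D) fun L => TubeComp L

open Classical in
/-- The inclusion of the diagrams with fixed outer labels. -/
def inc (L : TubeLabel D) : TubeComp L →ₗ[ℂ] Tube D :=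
  DirectSum.lof ℂ (TubeLabel D) (fun L => TubeComp L) L

/-- The diagram with simple arcs `a`, `b`, lower half `p` and upper half `q`. -/
def dbl (a b c e f h : Irr D) (p : Lower (obj a) (obj b) c e) (q : Upper (obj a) (obj b) f h) :
    Tube D :=
  inc ⟨a, b, c, e, f, h⟩ (p ⊗ₜ[ℂ] q)

open Classical in
/-- Extension of a family of linear maps to the tube algebra. -/
def extend {N : Type*} [AddCommMonoid N] [Module ℂ N] (φ : ∀ L : TubeLabel D, TubeComp L →ₗ[ℂ] N) :
    Tube D →ₗ[ℂ] N :=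
  DirectSum.toModule ℂ (TubeLabel D) N φ

@[simp]
theorem extend_inc {N : Type*} [AddCommMonoid N] [Module ℂ N]
    (φ : ∀ L : TubeLabel D, TubeComp L →ₗ[ℂ] N) (L : TubeLabel D) (t : TubeComp L) :
    extend φ (inc L t) = φ L t := by
  classical
  simp only [extend, inc]
  convert DirectSum.toModule_lof ℂ L t

/-- A diagram whose arcs are arbitrary objects `A`, `B`, rewritten through diagrams with simple
arcs by inserting the decompositions of `id_A` and `id_B` into the arcs and sliding their halves
into the lower and the upper part. -/
def resolve (A B : D) (c e f h : Irr D) : Lower A B c e →ₗ[ℂ] Upper A B f h →ₗ[ℂ] Tube D :=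
  LinearMap.mk₂ ℂ
    (fun p q => ∑ r, ∑ s,
      dbl ((decomp A).label r) ((decomp B).label s) c e f h
        (p ≫ (((decomp A).proj r ▷ obj e) ⊗ₘ (decomp B).proj s))
        ((((decomp A).inj r ▷ obj f) ⊗ₘ (decomp B).inj s) ≫ q))
    (fun p p' q => by
      simp only [dbl, Preadditive.add_comp, TensorProduct.add_tmul, map_add,
        Finset.sum_add_distrib])
    (fun z p q => by
      simp only [dbl, Linear.smul_comp, ← TensorProduct.smul_tmul', map_smul, Finset.smul_sum])
    (fun p q q' => by
      simp only [dbl, Preadditive.comp_add, TensorProduct.tmul_add, map_add,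
        Finset.sum_add_distrib])
    (fun z p q => by
      simp only [dbl, Linear.comp_smul, TensorProduct.tmul_smul, map_smul, Finset.smul_sum])

/-- The rebracketing of two nested pairs of arcs. -/
def nest (A A' E B' B : D) :
    (A ⊗ ((A' ⊗ E) ⊗ B')) ⊗ B ≅ ((A ⊗ A') ⊗ E) ⊗ (B' ⊗ B) :=
  whiskerRightIso ((α_ A (A' ⊗ E) B').symm ≪≫ whiskerRightIso (α_ A A' E).symm B') B ≪≫
    α_ ((A ⊗ A') ⊗ E) B' B

/-- Stacking of lower halves: the outer half `p`, followed inside by `p'`. -/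
def stackLower (A B A' B' : D) (c e c' e' : Irr D) :
    Lower A B c e →ₗ[ℂ] Lower A' B' c' e' →ₗ[ℂ] Lower (A ⊗ A') (B' ⊗ B) c e' :=
  LinearMap.mk₂ ℂ
    (fun p p' => p ≫ ((A ◁ (delta e c' ≫ p')) ▷ B) ≫ (nest A A' (obj e') B' B).hom)
    (by intros; simp) (by intros; simp) (by intros; simp) (by intros; simp)

/-- Stacking of upper halves: the inner half `q'`, followed outside by `q`. -/
def stackUpper (A B A' B' : D) (f h f' h' : Irr D) :
    Upper A B f h →ₗ[ℂ] Upper A' B' f' h' →ₗ[ℂ] Upper (A ⊗ A') (B' ⊗ B) f' h :=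
  LinearMap.mk₂ ℂ
    (fun q q' => (nest A A' (obj f') B' B).inv ≫ ((A ◁ (q' ≫ delta h' f)) ▷ B) ≫ q)
    (by intros; simp) (by intros; simp) (by intros; simp) (by intros; simp)

/-- Multiplication on components: put the second diagram inside the first one (zero unless the
legs match), then rewrite the pairs of parallel arcs through simple arcs. -/
def mulComp (L L' : TubeLabel D) : TubeComp L →ₗ[ℂ] TubeComp L' →ₗ[ℂ] Tube D :=
  (TensorProduct.map₂
      (stackLower (obj L.a) (obj L.b) (obj L'.a) (obj L'.b) L.c L.e L'.c L'.e)
      (stackUpper (obj L.a) (obj L.b) (obj L'.a) (obj L'.b) L.f L.h L'.f L'.h)).compr₂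
    (TensorProduct.lift
      (resolve (obj L.a ⊗ obj L'.a) (obj L'.b ⊗ obj L.b) L.c L'.e L'.f L.h))

/-- The multiplication of the tube algebra. -/
def mul : Tube D →ₗ[ℂ] Tube D →ₗ[ℂ] Tube D :=
  extend fun L => (extend fun L' => (mulComp L L').flip).flip

theorem mul_dbl (a b c e f h a' b' c' e' f' h' : Irr D)
    (p : Lower (obj a) (obj b) c e) (q : Upper (obj a) (obj b) f h)
    (p' : Lower (obj a') (obj b') c' e') (q' : Upper (obj a') (obj b') f' h') :
    mul (dbl a b c e f h p q) (dbl a' b' c' e' f' h' p' q') =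
      resolve (obj a ⊗ obj a') (obj b' ⊗ obj b) c e' f' h
        (p ≫ ((obj a ◁ (delta e c' ≫ p')) ▷ obj b) ≫
          (nest (obj a) (obj a') (obj e') (obj b') (obj b)).hom)
        ((nest (obj a) (obj a') (obj f') (obj b') (obj b)).inv ≫
          ((obj a ◁ (q' ≫ delta h' f)) ▷ obj b) ≫ q) := by
  simp only [mul, dbl, extend_inc, LinearMap.flip_apply]
  rfl

/-- The diagram consisting of two vertical lines, `x` on top and `y` at the bottom, with trivial
arcs (zero unless `x` and `y` lie in the same component of the category). -/
def lines (x y : Irr D) : Tube D :=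
  resolve (𝟙_ D) (𝟙_ D) y y x x
    ((λ_ (obj y)).inv ≫ (ρ_ (𝟙_ D ⊗ obj y)).inv)
    ((ρ_ (𝟙_ D ⊗ obj x)).hom ≫ (λ_ (obj x)).hom)

/-- The unit of the tube algebra. -/
def one : Tube D := ∑ x, ∑ y, lines x y

/-- The counit on components: join `e` with `f` (zero unless `e = f` and `c = h`) and evaluate the
resulting multiple of `id_c`, which is the closed diagram divided by `d_h`. -/
def counitComp (L : TubeLabel D) : TubeComp L →ₗ[ℂ] ℂ :=
  TensorProduct.lift <| LinearMap.mk₂ ℂ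
    (fun p q => scal L.c
      (p ≫ ((obj L.a ◁ delta L.e L.f) ▷ obj L.b) ≫ q ≫ delta L.h L.c))
    (by intros; simp) (by intros; simp) (by intros; simp) (by intros; simp)

/-- The counit of the tube algebra. -/
def counit : Tube D →ₗ[ℂ] ℂ := extend counitComp

/-- The comultiplication on components: insert a wall `i` between `e` and `f`, and decompose the
identity of `(a ⊗ i) ⊗ b`. -/
def comulComp (L : TubeLabel D) : TubeComp L →ₗ[ℂ] Tube D ⊗[ℂ] Tube D :=
  TensorProduct.lift <| LinearMap.mk₂ ℂ
    (fun p q => ∑ i : Irr D, ∑ r,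
      dbl L.a L.b ((decomp ((obj L.a ⊗ obj i) ⊗ obj L.b)).label r) i L.f L.h
          ((decomp ((obj L.a ⊗ obj i) ⊗ obj L.b)).inj r) q ⊗ₜ[ℂ]
        dbl L.a L.b L.c L.e i ((decomp ((obj L.a ⊗ obj i) ⊗ obj L.b)).label r)
          p ((decomp ((obj L.a ⊗ obj i) ⊗ obj L.b)).proj r))
    (fun p p' q => by
      simp only [dbl, TensorProduct.add_tmul, TensorProduct.tmul_add, map_add,
        Finset.sum_add_distrib])
    (fun z p q => by
      simp only [dbl, ← TensorProduct.smul_tmul', map_smul, TensorProduct.tmul_smul,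
        Finset.smul_sum])
    (fun p q q' => by
      simp only [dbl, TensorProduct.add_tmul, TensorProduct.tmul_add, map_add,
        Finset.sum_add_distrib])
    (fun z p q => by
      simp only [dbl, ← TensorProduct.smul_tmul', map_smul, TensorProduct.tmul_smul,
        Finset.smul_sum])

/-- The comultiplication of the tube algebra. -/
def comul : Tube D →ₗ[ℂ] Tube D ⊗[ℂ] Tube D := extend comulComp

/-- The upper half `q : (a ⊗ f) ⊗ b ⟶ h` bent into a lower half `f ⟶ (aᘁ ⊗ h) ⊗ bᘁ`. -/
def bendUpper (a b f h : Irr D) :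
    Upper (obj a) (obj b) f h →ₗ[ℂ] Lower (obj a)ᘁ (obj b)ᘁ f h where
  toFun q := (λ_ (obj f)).inv ≫ (ρ_ (𝟙_ D ⊗ obj f)).inv ≫
    ((cup a ▷ obj f) ⊗ₘ coev (obj b)) ≫
    (nest (obj a)ᘁ (obj a) (obj f) (obj b) (obj b)ᘁ).inv ≫ (((obj a)ᘁ ◁ q) ▷ (obj b)ᘁ)
  map_add' := by intros; simp
  map_smul' := by intros; simp

/-- The lower half `p : c ⟶ (a ⊗ e) ⊗ b` bent into an upper half `(aᘁ ⊗ c) ⊗ bᘁ ⟶ e`. -/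
def bendLower (a b c e : Irr D) :
    Lower (obj a) (obj b) c e →ₗ[ℂ] Upper (obj a)ᘁ (obj b)ᘁ c e where
  toFun p := (((obj a)ᘁ ◁ p) ▷ (obj b)ᘁ) ≫
    (nest (obj a)ᘁ (obj a) (obj e) (obj b) (obj b)ᘁ).hom ≫
    ((ev (obj a) ▷ obj e) ⊗ₘ cap b) ≫ (ρ_ (𝟙_ D ⊗ obj e)).hom ≫ (λ_ (obj e)).hom
  map_add' := by intros; simp
  map_smul' := by intros; simp

/-- The antipode on components: the reflected diagram with arcs `ā`, `b̄`, times `d_f / d_h`. -/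
def antipodeComp (L : TubeLabel D) : TubeComp L →ₗ[ℂ] Tube D :=
  ((qdim L.f : ℂ) / (qdim L.h : ℂ)) •
    TensorProduct.lift (((resolve (obj L.a)ᘁ (obj L.b)ᘁ L.f L.h L.c L.e).flip.compl₁₂
      (bendLower L.a L.b L.c L.e) (bendUpper L.a L.b L.f L.h)))

/-- The antipode of the tube algebra. -/
def antipode : Tube D →ₗ[ℂ] Tube D := extend antipodeComp

theorem antipode_dbl (a b c e f h : Irr D)
    (p : Lower (obj a) (obj b) c e) (q : Upper (obj a) (obj b) f h) :
    antipode (dbl a b c e f h p q) =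
      ((qdim f : ℂ) / (qdim h : ℂ)) •
        resolve (obj a)ᘁ (obj b)ᘁ f h c e (bendUpper a b f h q) (bendLower a b c e p) := by
  simp only [antipode, dbl, extend_inc]
  rfl

/-- `ξ = ∑ (d_y / d_x) · (x over y)`. -/
def xi : Tube D := ∑ x, ∑ y, ((qdim y : ℂ) / (qdim x : ℂ)) • lines x y

/-- `ξ⁻¹ = ∑ (d_x / d_y) · (x over y)`. -/
def xiInv : Tube D := ∑ x, ∑ y, ((qdim x : ℂ) / (qdim y : ℂ)) • lines x y

/-! ### Bases of vertices, F-symbols, basis diagrams -/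

/-- The fusion multiplicity `N_{ab}^c`. -/
def mult (a b c : Irr D) : ℕ := Module.finrank ℂ (obj c ⟶ obj a ⊗ obj b)

/-- The normalization `Y_c^{ab} = √(d_a d_b / d_c)`. -/
def vnorm (a b c : Irr D) : ℂ := (Real.sqrt (qdim a * qdim b / qdim c) : ℝ)

/-- Bases of splitting and fusion vertices obeying the loop move and the parallel move. -/
structure VertexBasis (D : Type u) [Category.{v} D] [Preadditive D] [Linear ℂ D]
    [HasFiniteBiproducts D] [MonoidalCategory D] [MonoidalPreadditive D] [MonoidalLinear ℂ D]
    [RigidCategory D] [UMFC D] where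
  split : ∀ {a b c : Irr D}, Fin (mult a b c) → (obj c ⟶ obj a ⊗ obj b)
  fuse : ∀ {a b c : Irr D}, Fin (mult a b c) → (obj a ⊗ obj b ⟶ obj c)
  loop : ∀ {a b c c' : Irr D} (μ : Fin (mult a b c)) (ν : Fin (mult a b c')),
    split μ ≫ fuse ν = if μ.val = ν.val then vnorm a b c • delta c c' else 0
  parallel : ∀ a b : Irr D,
    ∑ c, ∑ μ : Fin (mult a b c), (vnorm a b c)⁻¹ • (fuse μ ≫ split μ) = 𝟙 (obj a ⊗ obj b)

/-- The type of F-symbols, with arguments the inner and outer vertex of the left-bracketed tree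
(`i j → m`, `m k → l`) and the inner and outer vertex of the right-bracketed tree
(`j k → n`, `i n → l`). -/
abbrev FArray (D : Type u) [Category.{v} D] [Preadditive D] [Linear ℂ D]
    [HasFiniteBiproducts D] [MonoidalCategory D] [MonoidalPreadditive D] [MonoidalLinear ℂ D]
    [RigidCategory D] [UMFC D] :=
  ∀ (i j k l m n : Irr D), Fin (mult i j m) → Fin (mult m k l) →
    Fin (mult j k n) → Fin (mult i n l) → ℂ

/-- The four arrays of F-symbols of a basis of vertices: the coefficients of the F-moves on
splitting trees (`split`, `splitInv`) and on fusion trees (`fuse`, `fuseInv`). -/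
structure FSymbols (V : VertexBasis D) where
  split : FArray D
  splitInv : FArray D
  fuse : FArray D
  fuseInv : FArray D
  split_move : ∀ (i j k l m : Irr D) (β : Fin (mult i j m)) (α : Fin (mult m k l)),
    V.split α ≫ (V.split β ▷ obj k) ≫ (α_ (obj i) (obj j) (obj k)).hom =
      ∑ n, ∑ ν : Fin (mult j k n), ∑ μ : Fin (mult i n l),
        split i j k l m n β α ν μ • (V.split μ ≫ (obj i ◁ V.split ν))
  splitInv_move : ∀ (i j k l n : Irr D) (ν : Fin (mult j k n)) (μ : Fin (mult i n l)),
    V.split μ ≫ (obj i ◁ V.split ν) ≫ (α_ (obj i) (obj j) (obj k)).inv =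
      ∑ m, ∑ β : Fin (mult i j m), ∑ α : Fin (mult m k l),
        splitInv i j k l m n β α ν μ • (V.split α ≫ (V.split β ▷ obj k))
  fuse_move : ∀ (i j k l m : Irr D) (β : Fin (mult i j m)) (α : Fin (mult m k l)),
    (α_ (obj i) (obj j) (obj k)).inv ≫ (V.fuse β ▷ obj k) ≫ V.fuse α =
      ∑ n, ∑ ν : Fin (mult j k n), ∑ μ : Fin (mult i n l),
        fuse i j k l m n β α ν μ • ((obj i ◁ V.fuse ν) ≫ V.fuse μ)
  fuseInv_move : ∀ (i j k l n : Irr D) (ν : Fin (mult j k n)) (μ : Fin (mult i n l)),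
    (α_ (obj i) (obj j) (obj k)).hom ≫ (obj i ◁ V.fuse ν) ≫ V.fuse μ =
      ∑ m, ∑ β : Fin (mult i j m), ∑ α : Fin (mult m k l),
        fuseInv i j k l m n β α ν μ • ((V.fuse β ▷ obj k) ≫ V.fuse α)

/-- The basis diagram `[a;b]^{f,g,h;ζ,γ}_{c,d,e;μ,ν}`: below, `c` splits into `d`, `b` and `d` into
`a`, `e`; above, `a`, `f` fuse to `g` and `g`, `b` to `h`. -/
def diagram (V : VertexBasis D) {a b c d e f g h : Irr D} (μ : Fin (mult d b c))
    (ν : Fin (mult a e d)) (ζ : Fin (mult a f g)) (γ : Fin (mult g b h)) : Tube D :=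
  dbl a b c e f h (V.split μ ≫ (V.split ν ▷ obj b)) ((V.fuse ζ ▷ obj b) ≫ V.fuse γ)

/-- The indices of the basis diagrams. -/
structure DiagramIndex (D : Type u) [Category.{v} D] [Preadditive D] [Linear ℂ D]
    [HasFiniteBiproducts D] [MonoidalCategory D] [MonoidalPreadditive D] [MonoidalLinear ℂ D]
    [RigidCategory D] [UMFC D] where
  (a b c d e f g h : Irr D)
  μ : Fin (mult d b c)
  ν : Fin (mult a e d)
  ζ : Fin (mult a f g)
  γ : Fin (mult g b h)

end Category

end

end TubeAlg

open TubeAlg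

/-!
A diagram whose arcs are arbitrary objects is resolved into diagrams with simple arcs. The result
does not depend on the chosen decompositions: `∑ r, inj r ⊗ proj r` is the canonical (Casimir)
element of the pairing given by composition, and morphisms slide across it, so any pair of dual
families computes the same sum. Hence stacking and inserting arcs can be computed before resolving,
and associativity and the multiplicativity of `Δ` become identities between planar diagrams with
arbitrary arcs.

For `S`, one bends arcs around with the duality maps. Normalized on both sides to have the same loop
value, these define left and right partial traces, and the traces coincide: an automorphism of the
unit object is a scalar on each simple strand, and the normalization of the cups turns the
self-pairing of vertices into one that only involves `†`. Bending then carries dual bases to dual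
bases up to the factor `d_f / d_h`, which gives the two counit-like antipode identities. Bending
twice is conjugation by the isomorphism from `x` to its bidual, which is a scalar on a simple
object and cancels between the two halves of a diagram, so only the quotients of dimensions are left
in `S²`.

Positivity of `d_x` comes from `†`: `ℓ_x` and `r_x` are values of `f ≫ f†` with `f ≠ 0`, seen
through a simple summand of the unit object. On basis diagrams the product is computed by F-moves:
two inverse moves and one direct move on each of the two trees bring the left arcs together and the
right arcs together, where the fused vertices are resolved by their loop value.
-/

namespace TubeAlg

open scoped ComplexConjugate

noncomputable section

/-! ### Double arcs as an action -/

section Arcs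

variable {D : Type u} [Category.{v} D] [MonoidalCategory D]

/-- Two arcs around a morphism. -/
def wrap (A B : D) {X Y : D} (f : X ⟶ Y) : (A ⊗ X) ⊗ B ⟶ (A ⊗ Y) ⊗ B := (A ◁ f) ▷ B

/-- Morphisms acting on the two arcs around an object. -/
def arc {A A' B B' : D} (s : A ⟶ A') (t : B ⟶ B') (X : D) : (A ⊗ X) ⊗ B ⟶ (A' ⊗ X) ⊗ B' :=
  (s ▷ X) ⊗ₘ t

/-- Removal of trivial arcs. -/
def trivialArcs (X : D) : (𝟙_ D ⊗ X) ⊗ 𝟙_ D ≅ X := ρ_ (𝟙_ D ⊗ X) ≪≫ λ_ X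

theorem nest_hom (A A' E B' B : D) : (nest A A' E B' B).hom =
    ((α_ A (A' ⊗ E) B').inv ≫ (α_ A A' E).inv ▷ B') ▷ B ≫ (α_ ((A ⊗ A') ⊗ E) B' B).hom :=
  rfl

theorem nest_inv (A A' E B' B : D) : (nest A A' E B' B).inv =
    (α_ ((A ⊗ A') ⊗ E) B' B).inv ≫ ((α_ A A' E).hom ▷ B' ≫ (α_ A (A' ⊗ E) B').hom) ▷ B :=
  rfl

@[simp]
theorem wrap_id (A B X : D) : wrap A B (𝟙 X) = 𝟙 _ := by simp [wrap]

theorem wrap_comp (A B : D) {X Y Z : D} (f : X ⟶ Y) (g : Y ⟶ Z) :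
    wrap A B (f ≫ g) = wrap A B f ≫ wrap A B g := by simp [wrap]

@[simp]
theorem arc_id (A B X : D) : arc (𝟙 A) (𝟙 B) X = 𝟙 _ := by simp [arc]

theorem arc_comp {A A' A'' B B' B'' : D} (s : A ⟶ A') (s' : A' ⟶ A'') (t : B ⟶ B') (t' : B' ⟶ B'')
    (X : D) : arc (s ≫ s') (t ≫ t') X = arc s t X ≫ arc s' t' X := by
  simp [arc]

theorem arc_comp_assoc {A A' A'' B B' B'' : D} (s : A ⟶ A') (s' : A' ⟶ A'') (t : B ⟶ B')
    (t' : B' ⟶ B'') (X : D) {Z : D} (f : (A'' ⊗ X) ⊗ B'' ⟶ Z) :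
    arc (s ≫ s') (t ≫ t') X ≫ f = arc s t X ≫ arc s' t' X ≫ f := by
  rw [arc_comp, Category.assoc]

theorem arc_wrap {A A' B B' X Y : D} (s : A ⟶ A') (t : B ⟶ B') (f : X ⟶ Y) :
    arc s t X ≫ wrap A' B' f = wrap A B f ≫ arc s t Y := by
  simp only [arc, wrap, ← tensorHom_id, ← id_tensorHom, tensorHom_comp_tensorHom,
    Category.comp_id, Category.id_comp]

theorem arc_wrap_assoc {A A' B B' X Y : D} (s : A ⟶ A') (t : B ⟶ B') (f : X ⟶ Y) {Z : D}
    (g : (A' ⊗ Y) ⊗ B' ⟶ Z) : arc s t X ≫ wrap A' B' f ≫ g = wrap A B f ≫ arc s t Y ≫ g := by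
  rw [← Category.assoc, arc_wrap, Category.assoc]

theorem trivialArcs_natural {X Y : D} (f : X ⟶ Y) :
    wrap (𝟙_ D) (𝟙_ D) f ≫ (trivialArcs Y).hom = (trivialArcs X).hom ≫ f := by
  simp [trivialArcs, wrap]

theorem trivialArcs_inv_natural {X Y : D} (f : X ⟶ Y) :
    (trivialArcs X).inv ≫ wrap (𝟙_ D) (𝟙_ D) f = f ≫ (trivialArcs Y).inv := by
  simp [trivialArcs, wrap]

theorem wrap_wrap_nest (A A' B' B : D) {X Y : D} (f : X ⟶ Y) :
    wrap A B (wrap A' B' f) ≫ (nest A A' Y B' B).hom =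
      (nest A A' X B' B).hom ≫ wrap (A ⊗ A') (B' ⊗ B) f := by
  simp only [wrap, nest_hom]
  monoidal

theorem nest_inv_wrap_wrap (A A' B' B : D) {X Y : D} (f : X ⟶ Y) :
    (nest A A' X B' B).inv ≫ wrap A B (wrap A' B' f) =
      wrap (A ⊗ A') (B' ⊗ B) f ≫ (nest A A' Y B' B).inv := by
  rw [Iso.inv_comp_eq, ← Category.assoc, Iso.eq_comp_inv, wrap_wrap_nest]

theorem wrap_arc_nest (A B : D) {A₁ A₂ B₁ B₂ : D} (s : A₁ ⟶ A₂) (t : B₁ ⟶ B₂) (X : D) :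
    wrap A B (arc s t X) ≫ (nest A A₂ X B₂ B).hom =
      (nest A A₁ X B₁ B).hom ≫ arc (A ◁ s) (t ▷ B) X := by
  simp only [wrap, arc, nest_hom]
  monoidal

theorem nest_inv_wrap_arc (A B : D) {A₁ A₂ B₁ B₂ : D} (s : A₁ ⟶ A₂) (t : B₁ ⟶ B₂) (X : D) :
    (nest A A₁ X B₁ B).inv ≫ wrap A B (arc s t X) =
      arc (A ◁ s) (t ▷ B) X ≫ (nest A A₂ X B₂ B).inv := by
  rw [Iso.inv_comp_eq, ← Category.assoc, Iso.eq_comp_inv, wrap_arc_nest]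

theorem arc_nest {A A₁ B B₁ : D} (s : A ⟶ A₁) (t : B ⟶ B₁) (A' B' X : D) :
    arc s t ((A' ⊗ X) ⊗ B') ≫ (nest A₁ A' X B' B₁).hom =
      (nest A A' X B' B).hom ≫ arc (s ▷ A') (B' ◁ t) X := by
  simp only [arc, nest_hom]
  rw [MonoidalCategory.tensorHom_def', MonoidalCategory.tensorHom_def']
  monoidal

theorem nest_inv_arc {A A₁ B B₁ : D} (s : A ⟶ A₁) (t : B ⟶ B₁) (A' B' X : D) :
    (nest A A' X B' B).inv ≫ arc s t ((A' ⊗ X) ⊗ B') =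
      arc (s ▷ A') (B' ◁ t) X ≫ (nest A₁ A' X B' B₁).inv := by
  rw [Iso.inv_comp_eq, ← Category.assoc, Iso.eq_comp_inv, arc_nest]

theorem wrap_nest_nest (A A' A'' X B'' B' B : D) :
    wrap A B (nest A' A'' X B'' B').hom ≫ (nest A (A' ⊗ A'') X (B'' ⊗ B') B).hom =
      (nest A A' ((A'' ⊗ X) ⊗ B'') B' B).hom ≫ (nest (A ⊗ A') A'' X B'' (B' ⊗ B)).hom ≫
        arc (α_ A A' A'').hom (α_ B'' B' B).inv X := by
  simp only [wrap, arc, nest_hom]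
  monoidal

theorem nest_inv_wrap_nest (A A' A'' X B'' B' B : D) :
    (nest A A' ((A'' ⊗ X) ⊗ B'') B' B).inv ≫ wrap A B (nest A' A'' X B'' B').hom =
      (nest (A ⊗ A') A'' X B'' (B' ⊗ B)).hom ≫ arc (α_ A A' A'').hom (α_ B'' B' B).inv X ≫
        (nest A (A' ⊗ A'') X (B'' ⊗ B') B).inv := by
  rw [Iso.inv_comp_eq]
  simp only [← Category.assoc]
  rw [Iso.eq_comp_inv]
  simp only [Category.assoc]
  exact wrap_nest_nest ..

theorem nest_inv_wrap_nest_inv (A A' A'' X B'' B' B : D) :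
    (nest A (A' ⊗ A'') X (B'' ⊗ B') B).inv ≫ wrap A B (nest A' A'' X B'' B').inv =
      arc (α_ A A' A'').inv (α_ B'' B' B).hom X ≫ (nest (A ⊗ A') A'' X B'' (B' ⊗ B)).inv ≫
        (nest A A' ((A'' ⊗ X) ⊗ B'') B' B).inv := by
  simp only [wrap, arc, nest_inv]
  monoidal

theorem trivialArcs_inv_nest (A X B : D) :
    (trivialArcs ((A ⊗ X) ⊗ B)).inv ≫ (nest (𝟙_ D) A X B (𝟙_ D)).hom =
      arc (λ_ A).inv (ρ_ B).inv X := by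
  simp only [arc, nest_hom, trivialArcs, Iso.trans_inv]
  monoidal

theorem nest_inv_trivialArcs (A X B : D) :
    (nest (𝟙_ D) A X B (𝟙_ D)).inv ≫ (trivialArcs ((A ⊗ X) ⊗ B)).hom =
      arc (λ_ A).hom (ρ_ B).hom X := by
  simp only [arc, nest_inv, trivialArcs, Iso.trans_hom]
  monoidal

theorem wrap_trivialArcs (A X B : D) :
    (nest A (𝟙_ D) X (𝟙_ D) B).hom ≫ arc (ρ_ A).hom (λ_ B).hom X =
      wrap A B (trivialArcs X).hom := by
  simp only [arc, nest_hom, trivialArcs, wrap, Iso.trans_hom]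
  monoidal

theorem nest_inv_wrap_trivialArcs (A X B : D) :
    (nest A (𝟙_ D) X (𝟙_ D) B).inv ≫ wrap A B (trivialArcs X).hom =
      arc (ρ_ A).hom (λ_ B).hom X := by
  rw [← wrap_trivialArcs, Iso.inv_hom_id_assoc]

theorem wrap_trivialArcs_inv_nest (A X B : D) :
    wrap A B (trivialArcs X).inv ≫ (nest A (𝟙_ D) X (𝟙_ D) B).hom =
      arc (ρ_ A).inv (λ_ B).inv X := by
  simp only [arc, nest_hom, trivialArcs, wrap, Iso.trans_inv]
  monoidal

theorem wrap_nest_inv_nest (A A' X B' B : D) :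
    wrap A' B' (nest A A' X B' B).inv ≫ (nest A' A ((A' ⊗ X) ⊗ B') B B').hom =
      (nest A' (A ⊗ A') X (B' ⊗ B) B').hom ≫ arc (α_ A' A A').inv (α_ B' B B').hom X ≫
        (nest (A' ⊗ A) A' X B' (B ⊗ B')).inv := by
  simp only [wrap, arc, nest_hom, nest_inv]
  monoidal

/-- Creation, around a strand `X`, of a pair of arcs `A`, `B` inside a pair of arcs `A'`, `B'`. -/
def arcUnit {A A' B B' : D} (s : 𝟙_ D ⟶ A' ⊗ A) (t : 𝟙_ D ⟶ B ⊗ B') (X : D) :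
    X ⟶ (A' ⊗ ((A ⊗ X) ⊗ B)) ⊗ B' :=
  (trivialArcs X).inv ≫ arc s t X ≫ (nest A' A X B B').inv

theorem arcUnit_natural {A A' B B' : D} (s : 𝟙_ D ⟶ A' ⊗ A) (t : 𝟙_ D ⟶ B ⊗ B') {X Y : D}
    (f : X ⟶ Y) : arcUnit s t X ≫ wrap A' B' (wrap A B f) = f ≫ arcUnit s t Y := by
  simp only [arcUnit, Category.assoc, nest_inv_wrap_wrap, arc_wrap_assoc,
    reassoc_of% @trivialArcs_inv_natural]

/-- Annihilation, around a strand `X`, of a pair of arcs `A`, `B` with a pair of arcs `A'`, `B'`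
outside it. -/
def arcCounit {A A' B B' : D} (s : A' ⊗ A ⟶ 𝟙_ D) (t : B ⊗ B' ⟶ 𝟙_ D) (X : D) :
    (A' ⊗ ((A ⊗ X) ⊗ B)) ⊗ B' ⟶ X :=
  (nest A' A X B B').hom ≫ arc s t X ≫ (trivialArcs X).hom

theorem arcCounit_natural {A A' B B' : D} (s : A' ⊗ A ⟶ 𝟙_ D) (t : B ⊗ B' ⟶ 𝟙_ D) {X Y : D}
    (f : X ⟶ Y) : wrap A' B' (wrap A B f) ≫ arcCounit s t Y = arcCounit s t X ≫ f := by
  simp only [arcCounit, Category.assoc, reassoc_of% @wrap_wrap_nest, ← arc_wrap_assoc,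
    trivialArcs_natural]

theorem arcUnit_wrap_arcCounit {A A' B B' : D} (s : 𝟙_ D ⟶ A ⊗ A') (t : 𝟙_ D ⟶ B' ⊗ B)
    (s' : A' ⊗ A ⟶ 𝟙_ D) (t' : B ⊗ B' ⟶ 𝟙_ D)
    (hs : s ▷ A ≫ (α_ _ _ _).hom ≫ A ◁ s' = (λ_ A).hom ≫ (ρ_ A).inv)
    (ht : B ◁ t ≫ (α_ _ _ _).inv ≫ t' ▷ B = (ρ_ B).hom ≫ (λ_ B).inv) (X : D) :
    arcUnit s t ((A ⊗ X) ⊗ B) ≫ wrap A B (arcCounit s' t' X) = 𝟙 _ := by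
  simp only [arcUnit, arcCounit, wrap_comp, Category.assoc]
  rw [reassoc_of% @nest_inv_wrap_nest, reassoc_of% @nest_inv_wrap_arc,
    nest_inv_wrap_trivialArcs, reassoc_of% @arc_nest,
    reassoc_of% @trivialArcs_inv_nest]
  simp only [← arc_comp]
  rw [reassoc_of% hs, reassoc_of% ht]
  simp

theorem wrap_arcUnit_arcCounit {A A' B B' : D} (s : 𝟙_ D ⟶ A ⊗ A') (t : 𝟙_ D ⟶ B' ⊗ B)
    (s' : A' ⊗ A ⟶ 𝟙_ D) (t' : B ⊗ B' ⟶ 𝟙_ D)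
    (hs : A' ◁ s ≫ (α_ _ _ _).inv ≫ s' ▷ A' = (ρ_ A').hom ≫ (λ_ A').inv)
    (ht : t ▷ B' ≫ (α_ _ _ _).hom ≫ B' ◁ t' = (λ_ B').hom ≫ (ρ_ B').inv) (X : D) :
    wrap A' B' (arcUnit s t X) ≫ arcCounit s' t' ((A' ⊗ X) ⊗ B') = 𝟙 _ := by
  simp only [arcUnit, arcCounit, wrap_comp, Category.assoc]
  rw [reassoc_of% @wrap_nest_inv_nest, reassoc_of% @wrap_arc_nest,
    reassoc_of% @wrap_trivialArcs_inv_nest, reassoc_of% @nest_inv_arc, nest_inv_trivialArcs]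
  simp only [← arc_comp]
  rw [reassoc_of% hs, reassoc_of% ht]
  simp

end Arcs

section LinearArcs

variable {D : Type u} [Category.{v} D] [Preadditive D] [MonoidalCategory D] [MonoidalPreadditive D]

theorem wrap_sum (A B : D) {X Y : D} {ι : Type*} (s : Finset ι) (f : ι → (X ⟶ Y)) :
    wrap A B (∑ i ∈ s, f i) = ∑ i ∈ s, wrap A B (f i) := by
  simp only [wrap, whiskerLeft_sum, sum_whiskerRight]

@[simp]
theorem wrap_zero (A B : D) {X Y : D} : wrap A B (0 : X ⟶ Y) = 0 := by simp [wrap]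

theorem wrap_add (A B : D) {X Y : D} (f g : X ⟶ Y) :
    wrap A B (f + g) = wrap A B f + wrap A B g := by simp [wrap]

theorem arc_sum_left {A A' B B' : D} {ι : Type*} (S : Finset ι) (s : ι → (A ⟶ A')) (t : B ⟶ B')
    (X : D) : arc (∑ i ∈ S, s i) t X = ∑ i ∈ S, arc (s i) t X := by
  simp only [arc, sum_whiskerRight, sum_tensor]

theorem arc_sum_right {A A' B B' : D} {ι : Type*} (S : Finset ι) (s : A ⟶ A') (t : ι → (B ⟶ B'))
    (X : D) : arc s (∑ i ∈ S, t i) X = ∑ i ∈ S, arc s (t i) X := by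
  simp only [arc, tensor_sum]

@[simp]
theorem arc_zero_left {A A' B B' : D} (t : B ⟶ B') (X : D) : arc (0 : A ⟶ A') t X = 0 := by
  simp [arc]

@[simp]
theorem arc_zero_right {A A' B B' : D} (s : A ⟶ A') (X : D) : arc s (0 : B ⟶ B') X = 0 := by
  simp [arc]

variable {R : Type*} [Ring R] [Linear R D] [MonoidalLinear R D]

theorem wrap_smul (A B : D) {X Y : D} (z : R) (f : X ⟶ Y) :
    wrap A B (z • f) = z • wrap A B f := by simp [wrap]

theorem arc_smul_left {A A' B B' : D} (z : R) (s : A ⟶ A') (t : B ⟶ B')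
    (X : D) : arc (z • s) t X = z • arc s t X := by
  simp [arc, MonoidalCategory.tensorHom_def]

theorem arc_smul_right {A A' B B' : D} (z : R) (s : A ⟶ A') (t : B ⟶ B')
    (X : D) : arc s (z • t) X = z • arc s t X := by
  simp [arc, MonoidalCategory.tensorHom_def]

end LinearArcs

section Sandwich

variable {D : Type u} [Category.{v} D] [Preadditive D] [MonoidalCategory D] [MonoidalPreadditive D]
  {R : Type*} [CommRing R] [Linear R D] [MonoidalLinear R D]

variable (R) in
/-- Insertion of a morphism between the two arcs of a pair of half diagrams, as a linear map. -/
def sandwich {A B X Y Y' Z : D} (p : X ⟶ (A ⊗ Y) ⊗ B) (q : (A ⊗ Y') ⊗ B ⟶ Z) :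
    (Y ⟶ Y') →ₗ[R] (X ⟶ Z) where
  toFun f := p ≫ wrap A B f ≫ q
  map_add' f g := by simp [wrap_add]
  map_smul' z f := by simp [wrap_smul]

@[simp]
theorem sandwich_apply {A B X Y Y' Z : D} (p : X ⟶ (A ⊗ Y) ⊗ B) (q : (A ⊗ Y') ⊗ B ⟶ Z)
    (f : Y ⟶ Y') : sandwich R p q f = p ≫ wrap A B f ≫ q :=
  rfl

end Sandwich

/-! ### Schur's lemma and the Casimir element of a decomposition -/

section Schur

variable {D : Type u} [Category.{v} D] [Preadditive D] [Linear ℂ D]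

theorem eq_of_obj_iso {x y : Irr D} (i : obj x ≅ obj y) : x = y := by
  rw [← Quotient.out_eq x, ← Quotient.out_eq y]
  exact Quotient.sound (s := simpleSetoid D) ⟨i⟩

@[simp]
theorem delta_self (x : Irr D) : delta x x = 𝟙 (obj x) := by simp [delta]

theorem delta_ne {x y : Irr D} (h : x ≠ y) : delta x y = 0 := by simp [delta, h]

@[simp]
theorem scal_id (x : Irr D) : scal x (𝟙 (obj x)) = 1 :=
  smul_left_injective ℂ (obj_simple x).1 <| by
    simpa only [one_smul] using (scal_spec x (𝟙 (obj x))).symm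

theorem scal_smul_id (x : Irr D) (z : ℂ) : scal x (z • 𝟙 (obj x)) = z := by
  rw [map_smul, scal_id, smul_eq_mul, mul_one]

theorem end_comp_eq_smul {X : D} (x : Irr D) (f : obj x ⟶ obj x) (g : obj x ⟶ X) :
    f ≫ g = scal x f • g := by
  conv_lhs => rw [scal_spec x f]
  rw [Linear.smul_comp, Category.id_comp]

theorem comp_end_eq_smul {X : D} (x : Irr D) (f : obj x ⟶ obj x) (g : X ⟶ obj x) :
    g ≫ f = scal x f • g := by
  conv_lhs => rw [scal_spec x f]
  rw [Linear.comp_smul, Category.comp_id]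

theorem scal_comp (x : Irr D) (f g : obj x ⟶ obj x) : scal x (f ≫ g) = scal x f * scal x g := by
  rw [end_comp_eq_smul, map_smul, smul_eq_mul]

theorem Decomp.sum_proj_inj_comp {X Y : D} (d : Decomp X) (f : X ⟶ Y) :
    ∑ r, d.proj r ≫ d.inj r ≫ f = f := by
  simp only [← Category.assoc]
  rw [← Preadditive.sum_comp, d.total, Category.id_comp]

theorem Decomp.sum_comp_proj_inj {X Y : D} (d : Decomp X) (f : Y ⟶ X) :
    ∑ r, (f ≫ d.proj r) ≫ d.inj r = f := by
  simp only [Category.assoc]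
  rw [← Preadditive.comp_sum, d.total, Category.comp_id]

/-- The decomposition of an object isomorphic to a simple one. -/
def Decomp.ofIso {X : D} {k : Irr D} (i : X ≅ obj k) : Decomp X where
  n := 1
  label _ := k
  inj _ := i.inv
  proj _ := i.hom
  inj_proj_self _ := i.inv_hom_id
  inj_proj_ne r s h := absurd (Subsingleton.elim r s) h
  total := by simp

variable [HasFiniteBiproducts D] [MonoidalCategory D] [MonoidalPreadditive D]
  [MonoidalLinear ℂ D] [RigidCategory D] [UMFC D]

theorem hom_eq_zero_of_ne {x y : Irr D} (h : x ≠ y) (f : obj x ⟶ obj y) : f = 0 := by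
  by_contra hf
  set z := scal x (f ≫ UMFC.dag f) with hz
  have comp_dag : f ≫ UMFC.dag f = z • 𝟙 _ := scal_spec x _
  have z_ne_zero : z ≠ 0 := fun h0 =>
    hf (UMFC.eq_zero_of_comp_dag f (by rw [comp_dag, h0, zero_smul]))
  have scal_dag_comp : scal y (UMFC.dag f ≫ f) = z :=
    smul_left_injective ℂ hf <| by
      simp only [hz, ← end_comp_eq_smul, ← comp_end_eq_smul, Category.assoc]
  have dag_comp : UMFC.dag f ≫ f = z • 𝟙 _ := scal_dag_comp ▸ scal_spec y _
  refine h (eq_of_obj_iso ⟨f, z⁻¹ • UMFC.dag f, ?_, ?_⟩)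
  · rw [Linear.comp_smul, comp_dag, smul_smul, inv_mul_cancel₀ z_ne_zero, one_smul]
  · rw [Linear.smul_comp, dag_comp, smul_smul, inv_mul_cancel₀ z_ne_zero, one_smul]

variable {M : Type*} [AddCommMonoid M] [Module ℂ M]

theorem bilin_comp_slide {X Y : D} (G : ∀ k : Irr D, (obj k ⟶ X) →ₗ[ℂ] (Y ⟶ obj k) →ₗ[ℂ] M)
    {k k' : Irr D} (θ : obj k ⟶ obj k') (f : obj k' ⟶ X) (g : Y ⟶ obj k) :
    G k (θ ≫ f) g = G k' f (g ≫ θ) := by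
  by_cases h : k = k'
  · subst h
    rw [end_comp_eq_smul, comp_end_eq_smul]
    simp
  · simp [hom_eq_zero_of_ne h θ]

/-- Dinaturality in `X` of the Casimir element `∑ r, inj r ⊗ proj r` of `⊕ Hom(k, X) ⊗ Hom(X, k)`;
for `w = 𝟙 X` this says that the Casimir element does not depend on the decomposition. -/
theorem casimir_dinatural {X Y : D} (d : Decomp X) (d' : Decomp Y)
    (G : ∀ k : Irr D, (obj k ⟶ Y) →ₗ[ℂ] (X ⟶ obj k) →ₗ[ℂ] M) (w : X ⟶ Y) :
    ∑ r, G (d.label r) (d.inj r ≫ w) (d.proj r) =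
      ∑ s, G (d'.label s) (d'.inj s) (w ≫ d'.proj s) := by
  have expand : ∀ r, G (d.label r) (d.inj r ≫ w) (d.proj r) =
      ∑ s, G (d'.label s) (d'.inj s) (d.proj r ≫ d.inj r ≫ w ≫ d'.proj s) := by
    intro r
    conv_lhs => rw [← d'.sum_comp_proj_inj (d.inj r ≫ w)]
    rw [map_sum, LinearMap.sum_apply]
    refine Finset.sum_congr rfl fun s _ => ?_
    rw [bilin_comp_slide]
    simp only [Category.assoc]
  simp only [expand]
  rw [Finset.sum_comm]
  simp only [← map_sum, d.sum_proj_inj_comp]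

theorem casimir_comp_proj {Y : D} (d : Decomp Y) {k : Irr D}
    (G : ∀ i : Irr D, (obj i ⟶ Y) →ₗ[ℂ] (obj k ⟶ obj i) →ₗ[ℂ] M) (w : obj k ⟶ Y) :
    ∑ s, G (d.label s) (d.inj s) (w ≫ d.proj s) = G k w (𝟙 _) := by
  rw [← casimir_dinatural (Decomp.ofIso (Iso.refl (obj k))) d G w]
  change ∑ _ : Fin 1, G k (𝟙 _ ≫ w) (𝟙 _) = _
  simp

theorem casimir_inj_comp {X : D} (d : Decomp X) {k : Irr D}
    (G : ∀ i : Irr D, (obj i ⟶ obj k) →ₗ[ℂ] (X ⟶ obj i) →ₗ[ℂ] M) (w : X ⟶ obj k) :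
    ∑ r, G (d.label r) (d.inj r ≫ w) (d.proj r) = G k (𝟙 _) w := by
  rw [casimir_dinatural d (Decomp.ofIso (Iso.refl (obj k))) G w]
  change ∑ _ : Fin 1, G k (𝟙 _) (w ≫ 𝟙 _) = _
  simp

theorem casimir_comp_comp_proj {X Y : D} (d : Decomp Y) {k : Irr D}
    (G : ∀ i : Irr D, (obj i ⟶ Y) →ₗ[ℂ] (X ⟶ obj i) →ₗ[ℂ] M) (w : obj k ⟶ Y) (g : X ⟶ obj k) :
    ∑ s, G (d.label s) (d.inj s) (g ≫ w ≫ d.proj s) = G k w g := by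
  simpa using casimir_comp_proj d (fun i => (G i).compl₂ (Linear.leftComp ℂ (obj i) g)) w

end Schur

section DecompArcs

variable {D : Type u} [Category.{v} D] [Preadditive D] [Linear ℂ D] [MonoidalCategory D]

/-- Projection of a pair of arcs to a pair of simple summands. -/
def arcProj {A B : D} (d : Decomp A) (d' : Decomp B) (r : Fin d.n × Fin d'.n) (X : D) :
    (A ⊗ X) ⊗ B ⟶ (obj (d.label r.1) ⊗ X) ⊗ obj (d'.label r.2) :=
  arc (d.proj r.1) (d'.proj r.2) X

/-- Inclusion of a pair of simple summands into a pair of arcs. -/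
def arcInj {A B : D} (d : Decomp A) (d' : Decomp B) (r : Fin d.n × Fin d'.n) (X : D) :
    (obj (d.label r.1) ⊗ X) ⊗ obj (d'.label r.2) ⟶ (A ⊗ X) ⊗ B :=
  arc (d.inj r.1) (d'.inj r.2) X

variable [MonoidalPreadditive D]

theorem sum_arcProj_arcInj {A B : D} (d : Decomp A) (d' : Decomp B) (X : D) :
    ∑ r, arcProj d d' r X ≫ arcInj d d' r X = 𝟙 _ := by
  simp only [arcProj, arcInj, ← arc_comp, Fintype.sum_prod_type, ← arc_sum_right, ← arc_sum_left,
    d.total, d'.total, arc_id]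

theorem sum_arcProj_arcInj_comp {A B X Y : D} (d : Decomp A) (d' : Decomp B)
    (q : (A ⊗ X) ⊗ B ⟶ Y) : ∑ r, arcProj d d' r X ≫ arcInj d d' r X ≫ q = q := by
  simp only [← Category.assoc]
  rw [← Preadditive.sum_comp, sum_arcProj_arcInj, Category.id_comp]

theorem sum_comp_arcProj_arcInj {A B X Y : D} (d : Decomp A) (d' : Decomp B)
    (p : Y ⟶ (A ⊗ X) ⊗ B) : ∑ r, (p ≫ arcProj d d' r X) ≫ arcInj d d' r X = p := by
  simp only [Category.assoc]
  rw [← Preadditive.comp_sum, sum_arcProj_arcInj, Category.comp_id]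

end DecompArcs

/-! ### Diagrams with arbitrary arcs -/

section Stack

variable {D : Type u} [Category.{v} D] [Preadditive D] [Linear ℂ D] [MonoidalCategory D]
  [MonoidalPreadditive D] [MonoidalLinear ℂ D]

theorem stackLower_apply (A B A' B' : D) (c e c' e' : Irr D) (p : Lower A B c e)
    (p' : Lower A' B' c' e') : stackLower A B A' B' c e c' e' p p' =
      p ≫ wrap A B (delta e c' ≫ p') ≫ (nest A A' (obj e') B' B).hom :=
  rfl

theorem stackUpper_apply (A B A' B' : D) (f h f' h' : Irr D) (q : Upper A B f h)
    (q' : Upper A' B' f' h') : stackUpper A B A' B' f h f' h' q q' =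
      (nest A A' (obj f') B' B).inv ≫ wrap A B (q' ≫ delta h' f) ≫ q :=
  rfl

theorem stackLower_comp_arc {A₁ A B₁ B : D} (A' B' : D) (c e c' e' : Irr D) (s : A₁ ⟶ A)
    (t : B₁ ⟶ B) (p : Lower A₁ B₁ c e) (p' : Lower A' B' c' e') :
    stackLower A B A' B' c e c' e' (p ≫ arc s t _) p' =
      stackLower A₁ B₁ A' B' c e c' e' p p' ≫ arc (s ▷ A') (B' ◁ t) _ := by
  simp only [stackLower_apply, Category.assoc, arc_wrap_assoc, arc_nest]

theorem stackUpper_arc_comp {A₁ A B₁ B : D} (A' B' : D) (f h f' h' : Irr D) (s : A₁ ⟶ A)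
    (t : B₁ ⟶ B) (q : Upper A B f h) (q' : Upper A' B' f' h') :
    stackUpper A₁ B₁ A' B' f h f' h' (arc s t _ ≫ q) q' =
      arc (s ▷ A') (B' ◁ t) _ ≫ stackUpper A B A' B' f h f' h' q q' := by
  simp only [stackUpper_apply, ← arc_wrap_assoc, reassoc_of% @nest_inv_arc]

theorem stackLower_comp_arc_inner (A B : D) {A₁ A' B₁ B' : D} (c e c' e' : Irr D) (s : A₁ ⟶ A')
    (t : B₁ ⟶ B') (p : Lower A B c e) (p' : Lower A₁ B₁ c' e') :
    stackLower A B A' B' c e c' e' p (p' ≫ arc s t _) =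
      stackLower A B A₁ B₁ c e c' e' p p' ≫ arc (A ◁ s) (t ▷ B) _ := by
  simp only [stackLower_apply, wrap_comp, Category.assoc, wrap_arc_nest]

theorem stackUpper_arc_comp_inner (A B : D) {A₁ A' B₁ B' : D} (f h f' h' : Irr D) (s : A₁ ⟶ A')
    (t : B₁ ⟶ B') (q : Upper A B f h) (q' : Upper A' B' f' h') :
    stackUpper A B A₁ B₁ f h f' h' q (arc s t _ ≫ q') =
      arc (A ◁ s) (t ▷ B) _ ≫ stackUpper A B A' B' f h f' h' q q' := by
  simp only [stackUpper_apply, wrap_comp, Category.assoc, reassoc_of% @nest_inv_wrap_arc]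

theorem stackLower_assoc (A B A' B' A'' B'' : D) (c e c' e' c'' e'' : Irr D) (p : Lower A B c e)
    (p' : Lower A' B' c' e') (p'' : Lower A'' B'' c'' e'') :
    stackLower A B _ _ c e c' e'' p (stackLower A' B' A'' B'' c' e' c'' e'' p' p'') =
      stackLower _ _ A'' B'' c e' c'' e'' (stackLower A B A' B' c e c' e' p p') p'' ≫
        arc (α_ A A' A'').hom (α_ B'' B' B).inv _ := by
  simp only [stackLower_apply, Category.assoc, wrap_comp, wrap_nest_nest,
    reassoc_of% @wrap_wrap_nest]

theorem stackUpper_assoc (A B A' B' A'' B'' : D) (f h f' h' f'' h'' : Irr D) (q : Upper A B f h)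
    (q' : Upper A' B' f' h') (q'' : Upper A'' B'' f'' h'') :
    stackUpper A B _ _ f h f'' h' q (stackUpper A' B' A'' B'' f' h' f'' h'' q' q'') =
      arc (α_ A A' A'').inv (α_ B'' B' B).hom _ ≫
        stackUpper _ _ A'' B'' f' h f'' h'' (stackUpper A B A' B' f h f' h' q q') q'' := by
  simp only [stackUpper_apply, Category.assoc, wrap_comp, reassoc_of% @nest_inv_wrap_nest_inv,
    reassoc_of% @nest_inv_wrap_wrap]

end Stack

section Resolve

variable {D : Type u} [Category.{v} D] [Preadditive D] [Linear ℂ D]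
variable [HasFiniteBiproducts D] [MonoidalCategory D] [MonoidalPreadditive D]
  [MonoidalLinear ℂ D] [RigidCategory D] [UMFC D]

theorem resolve_apply (A B : D) (c e f h : Irr D) (p : Lower A B c e) (q : Upper A B f h) :
    resolve A B c e f h p q = ∑ r : Fin (decomp A).n × Fin (decomp B).n,
      dbl ((decomp A).label r.1) ((decomp B).label r.2) c e f h
        (p ≫ arcProj (decomp A) (decomp B) r _) (arcInj (decomp A) (decomp B) r _ ≫ q) := by
  rw [Fintype.sum_prod_type]
  rfl

theorem dbl_arc_slide {a a' b b' : Irr D} (c e f h : Irr D) (s : obj a ⟶ obj a')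
    (t : obj b ⟶ obj b') (p : Lower (obj a) (obj b) c e) (q : Upper (obj a') (obj b') f h) :
    dbl a' b' c e f h (p ≫ arc s t _) q = dbl a b c e f h p (arc s t _ ≫ q) := by
  by_cases ha : a = a'
  · by_cases hb : b = b'
    · subst ha hb
      rw [scal_spec a s, scal_spec b t]
      simp only [arc_smul_left, arc_smul_right, arc_id, dbl, Linear.comp_smul, Linear.smul_comp,
        Category.comp_id, Category.id_comp, TensorProduct.smul_tmul, smul_comm (scal b t)]
    · simp [hom_eq_zero_of_ne hb t, dbl]
  · simp [hom_eq_zero_of_ne ha s, dbl]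

/-- `dbl` as a bilinear map. -/
def dblBilin (a b c e f h : Irr D) :
    Lower (obj a) (obj b) c e →ₗ[ℂ] Upper (obj a) (obj b) f h →ₗ[ℂ] Tube D :=
  (TensorProduct.mk ℂ _ _).compr₂ (inc ⟨a, b, c, e, f, h⟩)

theorem dblBilin_apply (a b c e f h : Irr D) (p : Lower (obj a) (obj b) c e)
    (q : Upper (obj a) (obj b) f h) : dblBilin a b c e f h p q = dbl a b c e f h p q :=
  rfl

theorem dbl_sum_left {ι : Type*} (S : Finset ι) (a b c e f h : Irr D)
    (p : ι → Lower (obj a) (obj b) c e) (q : Upper (obj a) (obj b) f h) :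
    dbl a b c e f h (∑ i ∈ S, p i) q = ∑ i ∈ S, dbl a b c e f h (p i) q := by
  simp only [← dblBilin_apply, map_sum, LinearMap.sum_apply]

theorem dbl_sum_right {ι : Type*} (S : Finset ι) (a b c e f h : Irr D)
    (p : Lower (obj a) (obj b) c e) (q : ι → Upper (obj a) (obj b) f h) :
    dbl a b c e f h p (∑ i ∈ S, q i) = ∑ i ∈ S, dbl a b c e f h p (q i) := by
  simp only [← dblBilin_apply, map_sum]

theorem resolve_obj (a b c e f h : Irr D) (p : Lower (obj a) (obj b) c e)
    (q : Upper (obj a) (obj b) f h) :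
    resolve (obj a) (obj b) c e f h p q = dbl a b c e f h p q := by
  rw [resolve_apply]
  simp only [arcProj, dbl_arc_slide, ← dbl_sum_right]
  exact congrArg _ (sum_arcProj_arcInj_comp _ _ q)

theorem resolve_arc_slide {A A' B B' : D} (c e f h : Irr D) (s : A ⟶ A') (t : B ⟶ B')
    (p : Lower A B c e) (q : Upper A' B' f h) :
    resolve A' B' c e f h (p ≫ arc s t _) q = resolve A B c e f h p (arc s t _ ≫ q) := by
  have expand_lower : ∀ r', (p ≫ arc s t _) ≫ arcProj (decomp A') (decomp B') r' _ =
      ∑ r, (p ≫ arcProj (decomp A) (decomp B) r _) ≫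
        arc ((decomp A).inj r.1 ≫ s ≫ (decomp A').proj r'.1)
          ((decomp B).inj r.2 ≫ t ≫ (decomp B').proj r'.2) _ := by
    intro r'
    conv_lhs => rw [← sum_comp_arcProj_arcInj (decomp A) (decomp B) p]
    simp only [Preadditive.sum_comp, Category.assoc, arcProj, arcInj, arc_comp]
  have expand_upper : ∀ r, arcInj (decomp A) (decomp B) r _ ≫ arc s t _ ≫ q =
      ∑ r', arc ((decomp A).inj r.1 ≫ s ≫ (decomp A').proj r'.1)
        ((decomp B).inj r.2 ≫ t ≫ (decomp B').proj r'.2) _ ≫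
          arcInj (decomp A') (decomp B') r' _ ≫ q := by
    intro r
    conv_lhs => rw [← sum_arcProj_arcInj_comp (decomp A') (decomp B') q]
    simp only [Preadditive.comp_sum, Category.assoc, arcProj, arcInj, arc_comp]
  simp only [resolve_apply, expand_lower, expand_upper, dbl_sum_left, dbl_sum_right, dbl_arc_slide]
  exact Finset.sum_comm

theorem mul_dbl_eq_resolve_stack (a b c e f h a' b' c' e' f' h' : Irr D)
    (p : Lower (obj a) (obj b) c e) (q : Upper (obj a) (obj b) f h)
    (p' : Lower (obj a') (obj b') c' e') (q' : Upper (obj a') (obj b') f' h') :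
    mul (dbl a b c e f h p q) (dbl a' b' c' e' f' h' p' q') =
      resolve (obj a ⊗ obj a') (obj b' ⊗ obj b) c e' f' h
        (stackLower _ _ _ _ c e c' e' p p') (stackUpper _ _ _ _ f h f' h' q q') :=
  mul_dbl ..

theorem mul_dbl_resolve (a b : Irr D) (A' B' : D) (c e f h c' e' f' h' : Irr D)
    (p : Lower (obj a) (obj b) c e) (q : Upper (obj a) (obj b) f h) (p' : Lower A' B' c' e')
    (q' : Upper A' B' f' h') :
    mul (dbl a b c e f h p q) (resolve A' B' c' e' f' h' p' q') =
      resolve (obj a ⊗ A') (B' ⊗ obj b) c e' f' h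
        (stackLower _ _ A' B' c e c' e' p p') (stackUpper _ _ A' B' f h f' h' q q') := by
  have slide : ∀ r, mul (dbl a b c e f h p q)
      (dbl _ _ c' e' f' h' (p' ≫ arcProj (decomp A') (decomp B') r _)
        (arcInj (decomp A') (decomp B') r _ ≫ q')) =
      resolve (obj a ⊗ A') (B' ⊗ obj b) c e' f' h (stackLower _ _ A' B' c e c' e' p p')
        (stackUpper _ _ A' B' f h f' h' q
          (arcProj (decomp A') (decomp B') r _ ≫ arcInj (decomp A') (decomp B') r _ ≫ q')) := by
    intro r
    unfold arcProj arcInj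
    rw [stackUpper_arc_comp_inner, ← resolve_arc_slide, ← stackLower_comp_arc_inner]
    exact mul_dbl_eq_resolve_stack ..
  simp only [resolve_apply A' B', map_sum, slide]
  rw [← map_sum, ← map_sum, sum_arcProj_arcInj_comp]

theorem mul_resolve (A B A' B' : D) (c e f h c' e' f' h' : Irr D)
    (p : Lower A B c e) (q : Upper A B f h) (p' : Lower A' B' c' e') (q' : Upper A' B' f' h') :
    mul (resolve A B c e f h p q) (resolve A' B' c' e' f' h' p' q') =
      resolve (A ⊗ A') (B' ⊗ B) c e' f' h
        (stackLower A B A' B' c e c' e' p p') (stackUpper A B A' B' f h f' h' q q') := by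
  have slide : ∀ r, mul
      (dbl _ _ c e f h (p ≫ arcProj (decomp A) (decomp B) r _)
        (arcInj (decomp A) (decomp B) r _ ≫ q)) (resolve A' B' c' e' f' h' p' q') =
      resolve (A ⊗ A') (B' ⊗ B) c e' f' h (stackLower A B A' B' c e c' e' p p')
        (stackUpper A B A' B' f h f' h'
          (arcProj (decomp A) (decomp B) r _ ≫ arcInj (decomp A) (decomp B) r _ ≫ q) q') := by
    intro r
    unfold arcProj arcInj
    rw [mul_dbl_resolve, stackLower_comp_arc, resolve_arc_slide, ← stackUpper_arc_comp]
  simp only [resolve_apply A B, map_sum, LinearMap.sum_apply, slide]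
  rw [← map_sum, ← LinearMap.sum_apply, ← map_sum, sum_arcProj_arcInj_comp]

theorem counit_dbl (a b c e f h : Irr D) (p : Lower (obj a) (obj b) c e)
    (q : Upper (obj a) (obj b) f h) : counit (dbl a b c e f h p q) =
      scal c (p ≫ wrap (obj a) (obj b) (delta e f) ≫ q ≫ delta h c) := by
  simp only [counit, dbl, extend_inc]
  rfl

theorem counit_resolve (A B : D) (c e f h : Irr D) (p : Lower A B c e) (q : Upper A B f h) :
    counit (resolve A B c e f h p q) = scal c (p ≫ wrap A B (delta e f) ≫ q ≫ delta h c) := by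
  have slide : ∀ r, (p ≫ arcProj (decomp A) (decomp B) r _) ≫ wrap _ _ (delta e f) ≫
      (arcInj (decomp A) (decomp B) r _ ≫ q) ≫ delta h c =
      (p ≫ wrap A B (delta e f)) ≫ arcProj (decomp A) (decomp B) r _ ≫
        arcInj (decomp A) (decomp B) r _ ≫ q ≫ delta h c := by
    intro r
    simp only [arcProj, Category.assoc, arc_wrap_assoc]
  simp only [resolve_apply, map_sum, counit_dbl, slide]
  rw [← map_sum, ← Preadditive.comp_sum, sum_arcProj_arcInj_comp, Category.assoc]

/-- The summand of the comultiplication of the diagram `[p, q]` at the wall `i` and a simple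
constituent `k` of `(A ⊗ i) ⊗ B`, as a bilinear function of the inclusion and the projection of
`k`. -/
def comulTerm (A B : D) (c e f h : Irr D) (p : Lower A B c e) (q : Upper A B f h) (i k : Irr D) :
    Lower A B k i →ₗ[ℂ] Upper A B i k →ₗ[ℂ] Tube D ⊗[ℂ] Tube D :=
  (TensorProduct.mk ℂ (Tube D) (Tube D)).compl₁₂ ((resolve A B k i f h).flip q)
    (resolve A B c e i k p)

theorem comulTerm_apply (A B : D) (c e f h : Irr D) (p : Lower A B c e) (q : Upper A B f h)
    (i k : Irr D) (x : Lower A B k i) (y : Upper A B i k) :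
    comulTerm A B c e f h p q i k x y =
      resolve A B k i f h x q ⊗ₜ[ℂ] resolve A B c e i k p y :=
  rfl

theorem comul_dbl (a b c e f h : Irr D) (p : Lower (obj a) (obj b) c e)
    (q : Upper (obj a) (obj b) f h) : comul (dbl a b c e f h p q) =
      ∑ i : Irr D, ∑ r, comulTerm (obj a) (obj b) c e f h p q i _
        ((decomp ((obj a ⊗ obj i) ⊗ obj b)).inj r) ((decomp ((obj a ⊗ obj i) ⊗ obj b)).proj r) := by
  simp only [comulTerm_apply, resolve_obj]
  simp only [comul, dbl, extend_inc]
  rfl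

theorem comulTerm_arc {A A' B B' : D} (c e f h : Irr D) (s : A ⟶ A') (t : B ⟶ B') (s' : A' ⟶ A)
    (t' : B' ⟶ B) (p : Lower A B c e) (q : Upper A B f h) (i k : Irr D) (x : Lower A' B' k i)
    (y : Upper A' B' i k) :
    comulTerm A' B' c e f h (p ≫ arc s t _) (arc s' t' _ ≫ q) i k x y =
      comulTerm A B c e f h p q i k (x ≫ arc s' t' _) (arc s t _ ≫ y) := by
  rw [comulTerm_apply, comulTerm_apply, resolve_arc_slide, resolve_arc_slide]

theorem comul_resolve (A B : D) (c e f h : Irr D) (p : Lower A B c e) (q : Upper A B f h)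
    (d : ∀ i : Irr D, Decomp ((A ⊗ obj i) ⊗ B)) :
    comul (resolve A B c e f h p q) =
      ∑ i : Irr D, ∑ r, comulTerm A B c e f h p q i _ ((d i).inj r) ((d i).proj r) := by
  have move_wall : ∀ (r : Fin (decomp A).n × Fin (decomp B).n) (i : Irr D)
      (d' : Decomp ((obj ((decomp A).label r.1) ⊗ obj i) ⊗ obj ((decomp B).label r.2))),
      ∑ t, comulTerm A B c e f h p q i _ (d'.inj t ≫ arcInj (decomp A) (decomp B) r _)
        (arcProj (decomp A) (decomp B) r _ ≫ d'.proj t) =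
      ∑ t, comulTerm A B c e f h p q i _ ((d i).inj t)
        (arcProj (decomp A) (decomp B) r _ ≫ arcInj (decomp A) (decomp B) r _ ≫ (d i).proj t) :=
    fun r i d' => casimir_dinatural d' (d i) (fun k => (comulTerm A B c e f h p q i k).compl₂
      (Linear.leftComp ℂ _ (arcProj (decomp A) (decomp B) r _))) _
  have comul_summand : ∀ r, comul (dbl _ _ c e f h (p ≫ arcProj (decomp A) (decomp B) r _)
      (arcInj (decomp A) (decomp B) r _ ≫ q)) = ∑ i : Irr D, ∑ t,
        comulTerm A B c e f h p q i _ ((d i).inj t) (arcProj (decomp A) (decomp B) r _ ≫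
          arcInj (decomp A) (decomp B) r _ ≫ (d i).proj t) := fun r =>
    (comul_dbl ..).trans <| Finset.sum_congr rfl fun i _ =>
      (Finset.sum_congr rfl fun _ _ => comulTerm_arc ..).trans (move_wall r i _)
  simp only [resolve_apply, map_sum, comul_summand]
  rw [Finset.sum_comm]
  refine Finset.sum_congr rfl fun i _ => ?_
  rw [Finset.sum_comm]
  simp only [← map_sum, sum_arcProj_arcInj_comp]

end Resolve

/-! ### The weak bialgebra -/

section Bialgebra

variable {D : Type u} [Category.{v} D] [Preadditive D] [Linear ℂ D]
variable [HasFiniteBiproducts D] [MonoidalCategory D] [MonoidalPreadditive D]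
  [MonoidalLinear ℂ D] [RigidCategory D] [UMFC D]

theorem tube_induction {P : Tube D → Prop} (zero : P 0) (add : ∀ x y, P x → P y → P (x + y))
    (resolve : ∀ (A B : D) (c e f h : Irr D) (p : Lower A B c e) (q : Upper A B f h),
      P (resolve A B c e f h p q)) (x : Tube D) : P x := by
  classical
  induction x using DirectSum.induction_on with
  | zero => exact zero
  | add x y hx hy => exact add x y hx hy
  | of L t =>
    induction t using TensorProduct.induction_on with
    | zero => rw [map_zero]; exact zero
    | add s t hs ht => rw [map_add]; exact add _ _ hs ht
    | tmul p q =>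
      have := resolve (obj L.a) (obj L.b) L.c L.e L.f L.h p q
      rw [resolve_obj] at this
      convert this
      simp only [dbl, inc, DirectSum.lof_eq_of]

theorem lines_eq_resolve (x y : Irr D) : lines x y = resolve (𝟙_ D) (𝟙_ D) y y x x
    (trivialArcs (obj y)).inv (trivialArcs (obj x)).hom :=
  rfl

theorem lines_mul_resolve_of_ne {x y c h : Irr D} (hne : ¬ (x = h ∧ y = c)) (A B : D)
    (e f : Irr D) (p : Lower A B c e) (q : Upper A B f h) :
    mul (lines x y) (resolve A B c e f h p q) = 0 := by
  rw [lines_eq_resolve, mul_resolve, stackLower_apply, stackUpper_apply]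
  by_cases hy : y = c
  · have hx : h ≠ x := fun hx => hne ⟨hx.symm, hy⟩
    simp [delta_ne hx]
  · simp [delta_ne hy]

theorem lines_mul_resolve (A B : D) (c e f h : Irr D) (p : Lower A B c e) (q : Upper A B f h) :
    mul (lines h c) (resolve A B c e f h p q) = resolve A B c e f h p q := by
  rw [lines_eq_resolve, mul_resolve, stackLower_apply, stackUpper_apply]
  simp only [delta_self, Category.id_comp, Category.comp_id, reassoc_of% @trivialArcs_inv_natural,
    trivialArcs_natural, trivialArcs_inv_nest, reassoc_of% @nest_inv_trivialArcs]
  rw [resolve_arc_slide, ← arc_comp_assoc]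
  simp

theorem resolve_mul_lines_of_ne {x y e f : Irr D} (hne : ¬ (x = f ∧ y = e)) (A B : D)
    (c h : Irr D) (p : Lower A B c e) (q : Upper A B f h) :
    mul (resolve A B c e f h p q) (lines x y) = 0 := by
  rw [lines_eq_resolve, mul_resolve, stackLower_apply, stackUpper_apply]
  by_cases hy : e = y
  · have hx : x ≠ f := fun hx => hne ⟨hx, hy.symm⟩
    simp [delta_ne hx]
  · simp [delta_ne hy]

theorem resolve_mul_lines (A B : D) (c e f h : Irr D) (p : Lower A B c e) (q : Upper A B f h) :
    mul (resolve A B c e f h p q) (lines f e) = resolve A B c e f h p q := by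
  rw [lines_eq_resolve, mul_resolve, stackLower_apply, stackUpper_apply]
  simp only [delta_self, Category.id_comp, Category.comp_id, wrap_trivialArcs_inv_nest,
    reassoc_of% @nest_inv_wrap_trivialArcs]
  rw [resolve_arc_slide, ← arc_comp_assoc]
  simp

/-- The linear combination of the diagrams `lines x y` with coefficients `w x y`. The unit, `ξ` and
`ξ⁻¹` are of this form, and these elements act diagonally on the diagrams `resolve …`. -/
def lineSum (w : Irr D → Irr D → ℂ) : Tube D := ∑ x, ∑ y, w x y • lines x y

theorem lineSum_mul_resolve (w : Irr D → Irr D → ℂ) (A B : D) (c e f h : Irr D)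
    (p : Lower A B c e) (q : Upper A B f h) :
    mul (lineSum w) (resolve A B c e f h p q) = w h c • resolve A B c e f h p q := by
  simp only [lineSum, map_sum, LinearMap.sum_apply, map_smul, LinearMap.smul_apply]
  rw [Fintype.sum_eq_single h, Fintype.sum_eq_single c, lines_mul_resolve]
  · intro y hy
    rw [lines_mul_resolve_of_ne (fun h => hy h.2), smul_zero]
  · intro x hx
    refine Finset.sum_eq_zero fun y _ => ?_
    rw [lines_mul_resolve_of_ne (fun h => hx h.1), smul_zero]

theorem resolve_mul_lineSum (w : Irr D → Irr D → ℂ) (A B : D) (c e f h : Irr D)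
    (p : Lower A B c e) (q : Upper A B f h) :
    mul (resolve A B c e f h p q) (lineSum w) = w f e • resolve A B c e f h p q := by
  simp only [lineSum, map_sum, map_smul]
  rw [Fintype.sum_eq_single f, Fintype.sum_eq_single e, resolve_mul_lines]
  · intro y hy
    rw [resolve_mul_lines_of_ne (fun h => hy h.2), smul_zero]
  · intro x hx
    refine Finset.sum_eq_zero fun y _ => ?_
    rw [resolve_mul_lines_of_ne (fun h => hx h.1), smul_zero]

theorem one_eq_lineSum : (one : Tube D) = lineSum fun _ _ => 1 := by
  simp only [one, lineSum, one_smul]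

protected theorem one_mul (x : Tube D) : mul one x = x := by
  induction x using tube_induction with
  | zero => simp
  | add x y hx hy => rw [map_add, hx, hy]
  | resolve A B c e f h p q =>
    rw [one_eq_lineSum, lineSum_mul_resolve, one_smul]

protected theorem mul_one (x : Tube D) : mul x one = x := by
  induction x using tube_induction with
  | zero => simp
  | add x y hx hy => rw [map_add, LinearMap.add_apply, hx, hy]
  | resolve A B c e f h p q =>
    rw [one_eq_lineSum, resolve_mul_lineSum, one_smul]

protected theorem mul_assoc (x y z : Tube D) : mul (mul x y) z = mul x (mul y z) := by
  induction x using tube_induction with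
  | zero => simp
  | add x y hx hy => simp only [map_add, LinearMap.add_apply, hx, hy]
  | resolve A B c e f h p q =>
  induction y using tube_induction with
  | zero => simp
  | add x y hx hy => simp only [map_add, LinearMap.add_apply, hx, hy]
  | resolve A' B' c' e' f' h' p' q' =>
  induction z using tube_induction with
  | zero => simp
  | add x y hx hy => simp only [map_add, hx, hy]
  | resolve A'' B'' c'' e'' f'' h'' p'' q'' =>
    simp only [mul_resolve]
    rw [stackLower_assoc, stackUpper_assoc, resolve_arc_slide, ← arc_comp_assoc]
    simp

theorem comul_lines (x y : Irr D) :
    comul (lines x y) = ∑ i : Irr D, lines x i ⊗ₜ[ℂ] lines i y := by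
  rw [lines_eq_resolve,
    comul_resolve _ _ _ _ _ _ _ _ fun i => Decomp.ofIso (trivialArcs (obj i))]
  exact Finset.sum_congr rfl fun i _ => Fin.sum_univ_one _

protected theorem coassoc : (TensorProduct.assoc ℂ (Tube D) (Tube D) (Tube D)).toLinearMap ∘ₗ
    TensorProduct.map comul LinearMap.id ∘ₗ comul =
      TensorProduct.map LinearMap.id comul ∘ₗ comul := by
  ext1 x
  induction x using tube_induction with
  | zero => simp only [map_zero]
  | add x y hx hy => simp only [map_add, hx, hy]
  | resolve A B c e f h p q =>
    simp only [LinearMap.comp_apply]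
    rw [comul_resolve A B c e f h p q fun i => decomp _]
    simp only [map_sum, comulTerm_apply, TensorProduct.map_tmul, LinearMap.id_apply]
    simp only [fun c e p f h q => comul_resolve A B c e f h p q fun _ => decomp _, comulTerm_apply,
      TensorProduct.sum_tmul, TensorProduct.tmul_sum, map_sum, LinearEquiv.coe_coe,
      TensorProduct.assoc_tmul]
    rw [Finset.sum_congr rfl fun i _ => Finset.sum_comm, Finset.sum_comm]
    refine Finset.sum_congr rfl fun i _ => ?_
    rw [Finset.sum_congr rfl fun i _ => Finset.sum_comm, Finset.sum_comm]

protected theorem counit_comul (x : Tube D) :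
    TensorProduct.lid ℂ _ (TensorProduct.map counit LinearMap.id (comul x)) = x := by
  induction x using tube_induction with
  | zero => simp only [map_zero]
  | add x y hx hy => simp only [map_add, hx, hy]
  | resolve A B c e f h p q =>
    rw [comul_resolve A B c e f h p q fun i => decomp _]
    simp only [map_sum, comulTerm_apply, TensorProduct.map_tmul, LinearMap.id_apply,
      TensorProduct.lid_tmul, counit_resolve]
    have absorb_wall : ∀ i (d : Decomp ((A ⊗ obj i) ⊗ B)),
        ∑ r, scal _ (d.inj r ≫ wrap A B (delta i f) ≫ q ≫ delta h (d.label r)) •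
          resolve A B c e i _ p (d.proj r) =
        resolve A B c e i h p (wrap A B (delta i f) ≫ q) := by
      intro i d
      simpa using casimir_inj_comp d (fun k => (LinearMap.lsmul ℂ (Tube D)).compl₁₂
        (scal k ∘ₗ Linear.rightComp ℂ (obj k) (delta h k)) (resolve A B c e i k p))
        (wrap A B (delta i f) ≫ q)
    simp only [absorb_wall]
    rw [Fintype.sum_eq_single f fun i hi => by simp [delta_ne hi]]
    simp

protected theorem comul_counit (x : Tube D) :
    TensorProduct.rid ℂ _ (TensorProduct.map LinearMap.id counit (comul x)) = x := by
  induction x using tube_induction with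
  | zero => simp only [map_zero]
  | add x y hx hy => simp only [map_add, hx, hy]
  | resolve A B c e f h p q =>
    rw [comul_resolve A B c e f h p q fun i => decomp _]
    simp only [map_sum, comulTerm_apply, TensorProduct.map_tmul, LinearMap.id_apply,
      TensorProduct.rid_tmul, counit_resolve]
    have absorb_wall : ∀ i (d : Decomp ((A ⊗ obj i) ⊗ B)),
        ∑ r, scal c (p ≫ wrap A B (delta e i) ≫ d.proj r ≫ delta (d.label r) c) •
          resolve A B _ i f h (d.inj r) q =
        resolve A B c i f h (p ≫ wrap A B (delta e i)) q := by
      intro i d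
      simpa using casimir_comp_proj d (fun k =>
        (LinearMap.lsmul ℂ (Tube D)).flip.compl₁₂ ((resolve A B k i f h).flip q)
          (scal c ∘ₗ Linear.rightComp ℂ (obj c) (delta k c))) (p ≫ wrap A B (delta e i))
    simp only [absorb_wall]
    rw [Fintype.sum_eq_single e fun i hi => by simp [delta_ne hi.symm]]
    simp

theorem tensorMul_comulTerm (A B A' B' : D) (c e f h c' e' f' h' : Irr D) (p : Lower A B c e)
    (q : Upper A B f h) (p' : Lower A' B' c' e') (q' : Upper A' B' f' h') (i j k k' : Irr D)
    (x : Lower A B k i) (y : Upper A B i k) (x' : Lower A' B' k' j) (y' : Upper A' B' j k') :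
    tensorMul mul (comulTerm A B c e f h p q i k x y)
        (comulTerm A' B' c' e' f' h' p' q' j k' x' y') =
      comulTerm (A ⊗ A') (B' ⊗ B) c e' f' h (stackLower A B A' B' c e c' e' p p')
        (stackUpper A B A' B' f h f' h' q q') j k (stackLower A B A' B' k i k' j x x')
        (stackUpper A B A' B' i k j k' y y') := by
  simp only [comulTerm_apply, tensorMul, TensorProduct.map₂_apply_tmul, TensorProduct.map_tmul,
    mul_resolve]

theorem casimir_stack {A B A' B' : D} {j k' : Irr D} (d : ∀ i : Irr D, Decomp ((A ⊗ obj i) ⊗ B))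
    (d' : Decomp (((A ⊗ A') ⊗ obj j) ⊗ (B' ⊗ B))) {M : Type*} [AddCommMonoid M] [Module ℂ M]
    (G : ∀ k : Irr D, Lower (A ⊗ A') (B' ⊗ B) k j →ₗ[ℂ] Upper (A ⊗ A') (B' ⊗ B) j k →ₗ[ℂ] M)
    (x : Lower A' B' k' j) (y : Upper A' B' j k') :
    ∑ i, ∑ r, G _ (stackLower A B A' B' _ i k' j ((d i).inj r) x)
        (stackUpper A B A' B' i _ j k' ((d i).proj r) y) =
      ∑ t, G _ (d'.inj t) ((nest A A' (obj j) B' B).inv ≫ wrap A B (y ≫ x) ≫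
        (nest A A' (obj j) B' B).hom ≫ d'.proj t) := by
  simp only [stackLower_apply, stackUpper_apply]
  rw [Fintype.sum_eq_single k' fun i hi => by simp [delta_ne hi]]
  simpa [wrap_comp] using casimir_dinatural (d k') d' (fun k => (G k).compl₂
    (Linear.leftComp ℂ (obj k) ((nest A A' (obj j) B' B).inv ≫ wrap A B y)))
    (wrap A B x ≫ (nest A A' (obj j) B' B).hom)

theorem casimir_stack_casimir {A B A' B' : D} {j : Irr D}
    (d : ∀ i : Irr D, Decomp ((A ⊗ obj i) ⊗ B)) (d' : Decomp ((A' ⊗ obj j) ⊗ B'))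
    (d'' : Decomp (((A ⊗ A') ⊗ obj j) ⊗ (B' ⊗ B))) {M : Type*} [AddCommMonoid M] [Module ℂ M]
    (G : ∀ k : Irr D, Lower (A ⊗ A') (B' ⊗ B) k j →ₗ[ℂ] Upper (A ⊗ A') (B' ⊗ B) j k →ₗ[ℂ] M) :
    ∑ s, ∑ i, ∑ r, G _ (stackLower A B A' B' _ i _ j ((d i).inj r) (d'.inj s))
        (stackUpper A B A' B' i _ j _ ((d i).proj r) (d'.proj s)) =
      ∑ t, G _ (d''.inj t) (d''.proj t) := by
  simp only [casimir_stack d d'' G]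
  rw [Finset.sum_comm]
  simp only [← map_sum, ← Preadditive.comp_sum, ← Preadditive.sum_comp, ← wrap_sum,
    Decomp.total, wrap_id, Category.id_comp, Iso.inv_hom_id_assoc]

protected theorem comul_mul (x y : Tube D) :
    comul (mul x y) = tensorMul mul (comul x) (comul y) := by
  induction x using tube_induction with
  | zero => simp
  | add x y hx hy => simp only [map_add, LinearMap.add_apply, hx, hy]
  | resolve A B c e f h p q =>
  induction y using tube_induction with
  | zero => simp
  | add x y hx hy => simp only [map_add, hx, hy]
  | resolve A' B' c' e' f' h' p' q' =>
    rw [mul_resolve, comul_resolve _ _ _ _ _ _ _ _ fun i => decomp _,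
      comul_resolve A B c e f h p q fun i => decomp _,
      comul_resolve A' B' c' e' f' h' p' q' fun i => decomp _]
    simp only [map_sum, LinearMap.sum_apply, tensorMul_comulTerm]
    exact Finset.sum_congr rfl fun j _ => (casimir_stack_casimir _ _ _ fun k => comulTerm ..).symm

theorem middle_tmul {W : Type*} [AddCommMonoid W] [Module ℂ W] (m : W →ₗ[ℂ] W →ₗ[ℂ] W)
    (x y z w : W) : middle m ((x ⊗ₜ[ℂ] y) ⊗ₜ[ℂ] (z ⊗ₜ[ℂ] w)) = (x ⊗ₜ[ℂ] m y z) ⊗ₜ[ℂ] w :=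
  rfl

theorem comul_one_eq_sum : comul (one : Tube D) =
    ∑ x, ∑ y, ∑ i, lines x i ⊗ₜ[ℂ] lines i y := by
  simp only [one, map_sum, comul_lines]

theorem lines_mul_lines_of_ne {x y x' y' : Irr D} (h : ¬ (x = x' ∧ y = y')) :
    mul (lines x y) (lines x' y') = 0 := by
  rw [lines_eq_resolve x']
  exact lines_mul_resolve_of_ne h ..

theorem lines_mul_lines_self (x y : Irr D) : mul (lines x y) (lines x y) = lines x y :=
  lines_mul_resolve ..

theorem comul_comul_one : TensorProduct.map comul LinearMap.id (comul (one : Tube D)) =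
    ∑ x, ∑ i, ∑ j, ∑ y, (lines x i ⊗ₜ[ℂ] lines i j) ⊗ₜ[ℂ] lines j y := by
  simp only [comul_one_eq_sum, map_sum, TensorProduct.map_tmul, comul_lines, LinearMap.id_apply,
    TensorProduct.sum_tmul]
  refine Finset.sum_congr rfl fun x _ => ?_
  rw [Finset.sum_congr rfl fun y _ => Finset.sum_comm, Finset.sum_comm]
  refine Finset.sum_congr rfl fun i _ => ?_
  rw [Finset.sum_comm]

theorem middle_comul_one (m : Tube D →ₗ[ℂ] Tube D →ₗ[ℂ] Tube D)
    (self : ∀ x y, m (lines x y) (lines x y) = lines x y)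
    (ne : ∀ x y x' y', ¬ (x = x' ∧ y = y') → m (lines x y) (lines x' y') = 0) :
    middle m (comul (one : Tube D) ⊗ₜ[ℂ] comul one) =
      ∑ x, ∑ i, ∑ j, ∑ y, (lines x i ⊗ₜ[ℂ] lines i j) ⊗ₜ[ℂ] lines j y := by
  have middle_lines : ∀ x y i : Irr D, middle m ((lines x i ⊗ₜ[ℂ] lines i y) ⊗ₜ[ℂ]
      ∑ x', ∑ y', ∑ i', lines x' i' ⊗ₜ[ℂ] lines i' y') =
        ∑ y', (lines x i ⊗ₜ[ℂ] lines i y) ⊗ₜ[ℂ] lines y y' := by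
    intro x y i
    simp only [TensorProduct.tmul_sum, map_sum, middle_tmul]
    rw [Fintype.sum_eq_single i]
    · refine Finset.sum_congr rfl fun y' _ => ?_
      rw [Fintype.sum_eq_single y, self]
      intro i' hi'
      simp [ne _ _ _ _ fun h => hi' h.2.symm]
    · intro x' hx'
      simp [ne _ _ _ _ fun h => hx' h.1.symm]
  simp only [comul_one_eq_sum, TensorProduct.sum_tmul, map_sum, middle_lines]
  exact Finset.sum_congr rfl fun x _ => Finset.sum_comm

theorem counit_mul_resolve (A B A' B' : D) (c e f h c' e' f' h' : Irr D)
    (p : Lower A B c e) (q : Upper A B f h) (p' : Lower A' B' c' e') (q' : Upper A' B' f' h') :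
    counit (mul (resolve A B c e f h p q) (resolve A' B' c' e' f' h' p' q')) =
      scal c (p ≫ wrap A B (delta e c' ≫ p' ≫ wrap A' B' (delta e' f') ≫ q' ≫ delta h' f) ≫
        q ≫ delta h c) := by
  rw [mul_resolve, counit_resolve, stackLower_apply, stackUpper_apply]
  simp only [Category.assoc, wrap_comp, ← reassoc_of% @wrap_wrap_nest, Iso.hom_inv_id_assoc]

theorem counit_mul_mul_resolve (A B A' B' A'' B'' : D) (c e f h c' e' f' h' c'' e'' f'' h'' : Irr D)
    (p : Lower A B c e) (q : Upper A B f h) (p' : Lower A' B' c' e') (q' : Upper A' B' f' h')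
    (p'' : Lower A'' B'' c'' e'') (q'' : Upper A'' B'' f'' h'') :
    counit (mul (mul (resolve A B c e f h p q) (resolve A' B' c' e' f' h' p' q'))
      (resolve A'' B'' c'' e'' f'' h'' p'' q'')) =
      scal c (p ≫ wrap A B (delta e c' ≫ p' ≫ wrap A' B' (delta e' c'' ≫ p'' ≫
        wrap A'' B'' (delta e'' f'') ≫ q'' ≫ delta h'' f') ≫ q' ≫ delta h' f) ≫ q ≫ delta h c) := by
  rw [TubeAlg.mul_assoc, mul_resolve A' B', counit_mul_resolve, stackLower_apply, stackUpper_apply]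
  simp only [Category.assoc, wrap_comp, ← reassoc_of% @wrap_wrap_nest, Iso.hom_inv_id_assoc]

theorem tensorEval_tmul {W : Type*} [AddCommMonoid W] [Module ℂ W] (φ ψ : W →ₗ[ℂ] ℂ) (x y : W) :
    tensorEval φ ψ (x ⊗ₜ[ℂ] y) = φ x * ψ y :=
  rfl

theorem counit_mul_mul_eq_of_resolve {Δ : Tube D →ₗ[ℂ] Tube D ⊗[ℂ] Tube D}
    (resolve : ∀ (A B A' B' A'' B'' : D) (c e f h c' e' f' h' c'' e'' f'' h'' : Irr D)
      (p : Lower A B c e) (q : Upper A B f h) (p' : Lower A' B' c' e') (q' : Upper A' B' f' h')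
      (p'' : Lower A'' B'' c'' e'') (q'' : Upper A'' B'' f'' h''),
      counit (mul (mul (resolve A B c e f h p q) (resolve A' B' c' e' f' h' p' q'))
        (resolve A'' B'' c'' e'' f'' h'' p'' q'')) =
      tensorEval (counit ∘ₗ mul (resolve A B c e f h p q))
        (counit ∘ₗ mul.flip (resolve A'' B'' c'' e'' f'' h'' p'' q''))
        (Δ (resolve A' B' c' e' f' h' p' q'))) (x y z : Tube D) :
    counit (mul (mul x y) z) = tensorEval (counit ∘ₗ mul x) (counit ∘ₗ mul.flip z) (Δ y) := by
  induction x using tube_induction with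
  | zero => simp [tensorEval, TensorProduct.map_zero_left]
  | add x y hx hy =>
    simp only [map_add, LinearMap.add_apply, hx, hy, tensorEval, TensorProduct.map_add_left,
      LinearMap.comp_add]
  | resolve A B c e f h p q =>
  induction z using tube_induction with
  | zero => simp [tensorEval, TensorProduct.map_zero_right]
  | add x y hx hy =>
    simp only [map_add, LinearMap.add_apply, hx, hy, tensorEval, TensorProduct.map_add_right,
      LinearMap.comp_add]
  | resolve A'' B'' c'' e'' f'' h'' p'' q'' =>
  induction y using tube_induction with
  | zero => simp
  | add x y hx hy => simp only [map_add, LinearMap.add_apply, hx, hy]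
  | resolve A' B' c' e' f' h' p' q' => exact resolve ..

protected theorem counit_mul (x y z : Tube D) : counit (mul (mul x y) z) =
    tensorEval (counit ∘ₗ mul x) (counit ∘ₗ mul.flip z) (comul y) := by
  refine counit_mul_mul_eq_of_resolve (fun A B A' B' A'' B'' c e f h c' e' f' h' c'' e'' f'' h''
    p q p' q' p'' q'' => ?_) x y z
  rw [counit_mul_mul_resolve, comul_resolve A' B' c' e' f' h' p' q' fun i => decomp _]
  simp only [map_sum, comulTerm_apply, tensorEval_tmul, LinearMap.comp_apply,
    LinearMap.flip_apply, counit_mul_resolve]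
  have absorb_wall : ∀ i (d : Decomp ((A' ⊗ obj i) ⊗ B')),
      ∑ r, scal c (p ≫ wrap A B (delta e (d.label r) ≫ d.inj r ≫ wrap A' B' (delta i f') ≫ q' ≫
        delta h' f) ≫ q ≫ delta h c) * scal c' (p' ≫ wrap A' B' (delta e' c'' ≫ p'' ≫
          wrap A'' B'' (delta e'' f'') ≫ q'' ≫ delta h'' i) ≫ d.proj r ≫ delta (d.label r) c') =
      scal c (p ≫ wrap A B (delta e c' ≫ p' ≫ wrap A' B' (delta e' c'' ≫ p'' ≫
          wrap A'' B'' (delta e'' f'') ≫ q'' ≫ delta h'' i) ≫ wrap A' B' (delta i f') ≫ q' ≫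
          delta h' f) ≫ q ≫ delta h c) := by
    intro i d
    simpa using casimir_comp_proj d (fun k =>
      (LinearMap.mul ℂ ℂ).compl₁₂ (scal c ∘ₗ sandwich ℂ p (q ≫ delta h c) ∘ₗ
        Linear.leftComp ℂ _ (delta e k) ∘ₗ
          Linear.rightComp ℂ _ (wrap A' B' (delta i f') ≫ q' ≫ delta h' f))
        (scal c' ∘ₗ Linear.rightComp ℂ _ (delta k c')))
      (p' ≫ wrap A' B' (delta e' c'' ≫ p'' ≫ wrap A'' B'' (delta e'' f'') ≫ q'' ≫ delta h'' i))
  simp only [absorb_wall]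
  rw [Fintype.sum_eq_single f' fun i hi => by simp [delta_ne hi]]
  simp

protected theorem counit_mul_op (x y z : Tube D) : counit (mul (mul x y) z) =
    tensorEval (counit ∘ₗ mul x) (counit ∘ₗ mul.flip z)
      (TensorProduct.comm ℂ _ _ (comul y)) := by
  refine counit_mul_mul_eq_of_resolve
    (Δ := (TensorProduct.comm ℂ (Tube D) (Tube D)).toLinearMap ∘ₗ comul)
    (fun A B A' B' A'' B'' c e f h c' e' f' h' c'' e'' f'' h'' p q p' q' p'' q'' => ?_) x y z
  rw [counit_mul_mul_resolve, LinearMap.comp_apply,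
    comul_resolve A' B' c' e' f' h' p' q' fun i => decomp _]
  simp only [map_sum, comulTerm_apply, LinearEquiv.coe_coe, TensorProduct.comm_tmul,
    tensorEval_tmul, LinearMap.comp_apply, LinearMap.flip_apply, counit_mul_resolve]
  have absorb_wall : ∀ i (d : Decomp ((A' ⊗ obj i) ⊗ B')),
      ∑ r, scal c (p ≫ wrap A B (delta e c' ≫ p' ≫ wrap A' B' (delta e' i) ≫ d.proj r ≫
        delta (d.label r) f) ≫ q ≫ delta h c) * scal _ (d.inj r ≫ wrap A' B' (delta i c'' ≫ p'' ≫
          wrap A'' B'' (delta e'' f'') ≫ q'' ≫ delta h'' f') ≫ q' ≫ delta h' (d.label r)) =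
      scal c (p ≫ wrap A B (delta e c' ≫ p' ≫ wrap A' B' (delta e' i) ≫
        (wrap A' B' (delta i c'' ≫ p'' ≫ wrap A'' B'' (delta e'' f'') ≫ q'' ≫ delta h'' f') ≫
          q') ≫ delta h' f) ≫ q ≫ delta h c) := by
    intro i d
    refine (Finset.sum_congr rfl fun r _ => mul_comm _ _).trans ?_
    simpa using casimir_inj_comp d (fun k =>
      (LinearMap.mul ℂ ℂ).compl₁₂ (scal k ∘ₗ Linear.rightComp ℂ _ (delta h' k))
        (scal c ∘ₗ sandwich ℂ p (q ≫ delta h c) ∘ₗ Linear.leftComp ℂ _ (delta e c') ∘ₗ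
        Linear.leftComp ℂ _ p' ∘ₗ Linear.leftComp ℂ _ (wrap A' B' (delta e' i)) ∘ₗ
          Linear.rightComp ℂ _ (delta k f)))
      (wrap A' B' (delta i c'' ≫ p'' ≫ wrap A'' B'' (delta e'' f'') ≫ q'' ≫ delta h'' f') ≫ q')
  simp only [absorb_wall]
  rw [Fintype.sum_eq_single e' fun i hi => by simp [delta_ne hi.symm]]
  simp

theorem isWeakBialgebra : IsWeakBialgebra (mul (D := D)) one comul counit where
  mul_assoc := TubeAlg.mul_assoc
  one_mul := TubeAlg.one_mul
  mul_one := TubeAlg.mul_one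
  coassoc := TubeAlg.coassoc
  counit_comul := TubeAlg.counit_comul
  comul_counit := TubeAlg.comul_counit
  comul_mul := TubeAlg.comul_mul
  comul_one := by
    rw [comul_comul_one, middle_comul_one mul lines_mul_lines_self
      fun x y x' y' => lines_mul_lines_of_ne]
  comul_one_op := by
    rw [comul_comul_one, middle_comul_one mul.flip lines_mul_lines_self
      fun x y x' y' h => lines_mul_lines_of_ne fun h' => h ⟨h'.1.symm, h'.2.symm⟩]
  counit_mul := TubeAlg.counit_mul
  counit_mul_op := TubeAlg.counit_mul_op

end Bialgebra

/-! ### Partial traces and mates -/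

section Traces

variable {D : Type u} [Category.{v} D] [MonoidalCategory D]

/-- The partial trace over the left tensor factor. -/
def traceL {A A' X Y : D} (s : 𝟙_ D ⟶ A' ⊗ A) (t : A' ⊗ A ⟶ 𝟙_ D) (T : A ⊗ X ⟶ A ⊗ Y) : X ⟶ Y :=
  (λ_ X).inv ≫ s ▷ X ≫ (α_ _ _ _).hom ≫ A' ◁ T ≫ (α_ _ _ _).inv ≫ t ▷ Y ≫ (λ_ Y).hom

/-- The partial trace over the right tensor factor. -/
def traceR {B B' X Y : D} (s : 𝟙_ D ⟶ B ⊗ B') (t : B ⊗ B' ⟶ 𝟙_ D) (T : X ⊗ B ⟶ Y ⊗ B) : X ⟶ Y :=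
  (ρ_ X).inv ≫ X ◁ s ≫ (α_ _ _ _).inv ≫ T ▷ B' ≫ (α_ _ _ _).hom ≫ Y ◁ t ≫ (ρ_ Y).hom

theorem traceR_natural {B B' X Y X₁ Y₁ : D} (s : 𝟙_ D ⟶ B ⊗ B') (t : B ⊗ B' ⟶ 𝟙_ D)
    (T : X ⊗ B ⟶ Y ⊗ B) (f : X₁ ⟶ X) (g : Y ⟶ Y₁) :
    traceR s t (f ▷ B ≫ T ≫ g ▷ B) = f ≫ traceR s t T ≫ g := by
  simp only [traceR, comp_whiskerRight, Category.assoc]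
  rw [← associator_inv_naturality_left_assoc, whisker_exchange_assoc, whiskerRight_id,
    associator_naturality_left_assoc, ← whisker_exchange_assoc, whiskerRight_id]
  simp

theorem close_traceR_eq_close_traceL {A A' B B' : D} (s : 𝟙_ D ⟶ A' ⊗ A) (t : A' ⊗ A ⟶ 𝟙_ D)
    (s' : 𝟙_ D ⟶ B ⊗ B') (t' : B ⊗ B' ⟶ 𝟙_ D) (T : A ⊗ B ⟶ A ⊗ B) :
    s ≫ A' ◁ traceR s' t' T ≫ t = s' ≫ traceL s t T ▷ B' ≫ t' := by
  calc s ≫ A' ◁ traceR s' t' T ≫ t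
      = 𝟙 _ ⊗≫ (s ▷ 𝟙_ D ≫ (A' ⊗ A) ◁ s') ⊗≫ A' ◁ T ▷ B' ⊗≫
          ((A' ⊗ A) ◁ t' ≫ t ▷ 𝟙_ D) ⊗≫ 𝟙 _ := by
        simp only [traceR]; monoidal
    _ = 𝟙 _ ⊗≫ (𝟙_ D ◁ s' ≫ s ▷ (B ⊗ B')) ⊗≫ A' ◁ T ▷ B' ⊗≫
          (t ▷ (B ⊗ B') ≫ 𝟙_ D ◁ t') ⊗≫ 𝟙 _ := by
        rw [whisker_exchange, whisker_exchange]
    _ = s' ≫ traceL s t T ▷ B' ≫ t' := by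
        simp only [traceL]; monoidal

theorem arcUnit_wrap_arcCounit_eq_traceL_traceR {A A' B B' X : D} (s : 𝟙_ D ⟶ A' ⊗ A)
    (t : A' ⊗ A ⟶ 𝟙_ D) (s' : 𝟙_ D ⟶ B ⊗ B') (t' : B ⊗ B' ⟶ 𝟙_ D)
    (T : (A ⊗ X) ⊗ B ⟶ (A ⊗ X) ⊗ B) :
    arcUnit s s' X ≫ wrap A' B' T ≫ arcCounit t t' X = traceL s t (traceR s' t' T) := by
  simp only [arcUnit, arcCounit, arc, traceL, traceR, wrap, nest_hom, nest_inv, trivialArcs,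
    Iso.trans_hom, Iso.trans_inv]
  rw [MonoidalCategory.tensorHom_def (s ▷ X), MonoidalCategory.tensorHom_def' (t ▷ X)]
  monoidal

theorem close_tensor_eq_close_traceL {A A' B B' : D} [ExactPairing A A'] [ExactPairing B B']
    [ExactPairing A' A] [ExactPairing B' B] (T : A ⊗ B ⟶ A ⊗ B) :
    η_ (B' ⊗ A') (A ⊗ B) ≫ (B' ⊗ A') ◁ T ≫ ε_ (A ⊗ B) (B' ⊗ A') =
      η_ B' B ≫ B' ◁ traceL (η_ A' A) (ε_ A A') T ≫ ε_ B B' := by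
  rw [ExactPairing.tensor_coevaluation, ExactPairing.tensor_evaluation]
  simp only [traceL]
  monoidal

theorem close_tensor_eq_close_traceR {A A' B B' : D} [ExactPairing A A'] [ExactPairing B B']
    [ExactPairing A' A] [ExactPairing B' B] (T : A ⊗ B ⟶ A ⊗ B) :
    η_ (A ⊗ B) (B' ⊗ A') ≫ T ▷ (B' ⊗ A') ≫ ε_ (B' ⊗ A') (A ⊗ B) =
      η_ A A' ≫ traceR (η_ B B') (ε_ B' B) T ▷ A' ≫ ε_ A' A := by
  rw [ExactPairing.tensor_coevaluation, ExactPairing.tensor_evaluation]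
  simp only [traceR]
  monoidal

end Traces

section Mates

variable {D : Type u} [Category.{v} D] [MonoidalCategory D] {X X' Z Z' : D}

section Right

variable [ExactPairing X X'] [ExactPairing Z Z']

/-- The mate of `f` between right duals, for arbitrary choices of these duals. -/
def rightMate (f : Z ⟶ X) : X' ⟶ Z' :=
  @rightAdjointMate D _ _ Z X ⟨Z'⟩ ⟨X'⟩ f

theorem rightMate_evaluation (f : Z ⟶ X) :
    (rightMate f : X' ⟶ Z') ▷ Z ≫ ε_ Z Z' = X' ◁ f ≫ ε_ X X' :=
  @rightAdjointMate_comp_evaluation D _ _ Z X ⟨Z'⟩ ⟨X'⟩ f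

theorem coevaluation_rightMate (f : Z ⟶ X) :
    η_ X X' ≫ X ◁ (rightMate f : X' ⟶ Z') = η_ Z Z' ≫ f ▷ Z' :=
  @coevaluation_comp_rightAdjointMate D _ _ Z X ⟨Z'⟩ ⟨X'⟩ f

theorem rightMate_comp_rightMate (f : Z ⟶ X) (g : X ⟶ Z) :
    (rightMate g : Z' ⟶ X') ≫ (rightMate f : X' ⟶ Z') = rightMate (f ≫ g) :=
  (@comp_rightAdjointMate D _ _ Z X Z ⟨Z'⟩ ⟨X'⟩ ⟨Z'⟩ f g).symm

end Right

section Left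

variable [ExactPairing X' X] [ExactPairing Z' Z]

/-- The mate of `f` between left duals, for arbitrary choices of these duals. -/
def leftMate (f : Z ⟶ X) : X' ⟶ Z' :=
  @leftAdjointMate D _ _ Z X ⟨Z'⟩ ⟨X'⟩ f

theorem leftMate_evaluation (f : Z ⟶ X) :
    Z ◁ (leftMate f : X' ⟶ Z') ≫ ε_ Z' Z = f ▷ X' ≫ ε_ X' X :=
  @leftAdjointMate_comp_evaluation D _ _ Z X ⟨Z'⟩ ⟨X'⟩ f

theorem coevaluation_leftMate (f : Z ⟶ X) :
    η_ X' X ≫ (leftMate f : X' ⟶ Z') ▷ X = η_ Z' Z ≫ Z' ◁ f :=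
  @coevaluation_comp_leftAdjointMate D _ _ Z X ⟨Z'⟩ ⟨X'⟩ f

theorem leftMate_comp_leftMate (f : Z ⟶ X) (g : X ⟶ Z) :
    (leftMate g : Z' ⟶ X') ≫ (leftMate f : X' ⟶ Z') = leftMate (f ≫ g) :=
  (@comp_leftAdjointMate D _ _ Z X Z ⟨Z'⟩ ⟨X'⟩ ⟨Z'⟩ f g).symm

end Left

theorem rightMate_id [ExactPairing Z Z'] : (rightMate (𝟙 Z) : Z' ⟶ Z') = 𝟙 Z' :=
  @rightAdjointMate_id D _ _ Z ⟨Z'⟩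

theorem leftMate_id [ExactPairing Z' Z] : (leftMate (𝟙 Z) : Z' ⟶ Z') = 𝟙 Z' :=
  @leftAdjointMate_id D _ _ Z ⟨Z'⟩

/-- Isomorphic objects have isomorphic right duals. -/
@[simps]
def rightMateIso [ExactPairing X X'] [ExactPairing Z Z'] (i : Z ≅ X) : X' ≅ Z' where
  hom := rightMate i.hom
  inv := rightMate i.inv
  hom_inv_id := by rw [rightMate_comp_rightMate, i.inv_hom_id, rightMate_id]
  inv_hom_id := by rw [rightMate_comp_rightMate, i.hom_inv_id, rightMate_id]

/-- Isomorphic objects have isomorphic left duals. -/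
@[simps]
def leftMateIso [ExactPairing X' X] [ExactPairing Z' Z] (i : Z ≅ X) : X' ≅ Z' where
  hom := leftMate i.hom
  inv := leftMate i.inv
  hom_inv_id := by rw [leftMate_comp_leftMate, i.inv_hom_id, leftMate_id]
  inv_hom_id := by rw [leftMate_comp_leftMate, i.hom_inv_id, leftMate_id]

theorem eq_of_whiskerRight_evaluation [ExactPairing X X'] {Y : D} {m n : Y ⟶ X'}
    (h : m ▷ X ≫ ε_ X X' = n ▷ X ≫ ε_ X X') : m = n := by
  have bend : ∀ m : Y ⟶ X', m = (ρ_ Y).inv ≫ Y ◁ η_ X X' ≫ (α_ _ _ _).inv ≫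
      (m ▷ X ≫ ε_ X X') ▷ X' ≫ (λ_ X').hom := by
    intro m
    rw [comp_whiskerRight_assoc, ← associator_inv_naturality_left_assoc, whisker_exchange_assoc,
      ExactPairing.coevaluation_evaluation_assoc]
    simp
  rw [bend m, bend n, h]

theorem rightMate_surjective [ExactPairing X X'] [ExactPairing Z Z'] :
    Function.Surjective (rightMate : (Z ⟶ X) → (X' ⟶ Z')) := by
  intro m
  refine ⟨@leftAdjointMate D _ _ X' Z' ⟨X⟩ ⟨Z⟩ m, eq_of_whiskerRight_evaluation (X := Z) ?_⟩
  rw [rightMate_evaluation]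
  exact @leftAdjointMate_comp_evaluation D _ _ X' Z' ⟨X⟩ ⟨Z⟩ m

end Mates

section LinearMates

variable {D : Type u} [Category.{v} D] [Preadditive D] [MonoidalCategory D] [MonoidalPreadditive D]
variable {X X' Z Z' : D}

theorem traceL_sum {ι : Type*} (S : Finset ι) {A A' X Y : D} (s : 𝟙_ D ⟶ A' ⊗ A)
    (t : A' ⊗ A ⟶ 𝟙_ D) (T : ι → (A ⊗ X ⟶ A ⊗ Y)) :
    traceL s t (∑ i ∈ S, T i) = ∑ i ∈ S, traceL s t (T i) := by
  simp [traceL, Preadditive.comp_sum, Preadditive.sum_comp, whiskerLeft_sum]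

theorem id_eq_zero_of_evaluation_eq_zero [ExactPairing X X'] (h : ε_ X X' = 0) : 𝟙 X = 0 := by
  have zigzag := ExactPairing.evaluation_coevaluation X X'
  rw [h, MonoidalPreadditive.whiskerLeft_zero, comp_zero, comp_zero] at zigzag
  calc 𝟙 X = (λ_ X).inv ≫ ((λ_ X).hom ≫ (ρ_ X).inv) ≫ (ρ_ X).hom := by simp
    _ = 0 := by rw [← zigzag, zero_comp, comp_zero]

theorem id_eq_zero_of_coevaluation_eq_zero [ExactPairing X X'] (h : η_ X X' = 0) : 𝟙 X = 0 := by
  have zigzag := ExactPairing.evaluation_coevaluation X X'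
  rw [h, MonoidalPreadditive.zero_whiskerRight, zero_comp] at zigzag
  calc 𝟙 X = (λ_ X).inv ≫ ((λ_ X).hom ≫ (ρ_ X).inv) ≫ (ρ_ X).hom := by simp
    _ = 0 := by rw [← zigzag, zero_comp, comp_zero]

theorem rightMate_sub [ExactPairing X X'] [ExactPairing Z Z'] (f g : Z ⟶ X) :
    (rightMate (f - g) : X' ⟶ Z') = rightMate f - rightMate g := by
  refine eq_sub_of_add_eq ?_
  conv_rhs => rw [← sub_add_cancel f g]
  simp only [rightMate, rightAdjointMate, MonoidalPreadditive.add_whiskerRight,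
    MonoidalPreadditive.whiskerLeft_add, Preadditive.add_comp, Preadditive.comp_add]

theorem leftMate_sub [ExactPairing X' X] [ExactPairing Z' Z] (f g : Z ⟶ X) :
    (leftMate (f - g) : X' ⟶ Z') = leftMate f - leftMate g := by
  refine eq_sub_of_add_eq ?_
  conv_rhs => rw [← sub_add_cancel f g]
  simp only [leftMate, leftAdjointMate, MonoidalPreadditive.add_whiskerRight,
    MonoidalPreadditive.whiskerLeft_add, Preadditive.add_comp, Preadditive.comp_add]

variable {R : Type*} [Ring R] [Linear R D] [MonoidalLinear R D]

theorem rightMate_smul [ExactPairing X X'] [ExactPairing Z Z'] (r : R) (f : Z ⟶ X) :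
    (rightMate (r • f) : X' ⟶ Z') = r • rightMate f := by
  simp [rightMate, rightAdjointMate]

theorem leftMate_smul [ExactPairing X' X] [ExactPairing Z' Z] (r : R) (f : Z ⟶ X) :
    (leftMate (r • f) : X' ⟶ Z') = r • leftMate f := by
  simp [leftMate, leftAdjointMate]

end LinearMates

section SimpleMates

variable {D : Type u} [Category.{v} D] [Preadditive D] [Linear ℂ D] [MonoidalCategory D]
  [MonoidalPreadditive D] [MonoidalLinear ℂ D] {z : Irr D} {Z' : D}

theorem rightMate_end [ExactPairing (obj z) Z'] (f : obj z ⟶ obj z) :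
    (rightMate f : Z' ⟶ Z') = scal z f • 𝟙 Z' := by
  conv_lhs => rw [scal_spec z f]
  rw [rightMate_smul, rightMate_id]

theorem leftMate_end [ExactPairing Z' (obj z)] (f : obj z ⟶ obj z) :
    (leftMate f : Z' ⟶ Z') = scal z f • 𝟙 Z' := by
  conv_lhs => rw [scal_spec z f]
  rw [leftMate_smul, leftMate_id]

theorem isSimpleObj_of_exactPairing [ExactPairing (obj z) Z'] : IsSimpleObj Z' := by
  refine ⟨fun h => (obj_simple z).1 (id_eq_zero_of_evaluation_eq_zero (X' := Z') ?_), fun m => ?_⟩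
  · rw [← Category.id_comp (ε_ (obj z) Z'), ← id_whiskerRight, h,
      MonoidalPreadditive.zero_whiskerRight, zero_comp]
  · obtain ⟨f, rfl⟩ := rightMate_surjective (X := obj z) (Z := obj z) m
    exact ⟨scal z f, rightMate_end f⟩

end SimpleMates

/-! ### Endomorphisms of the unit object -/

section UnitAction

variable {D : Type u} [Category.{v} D] [Preadditive D] [Linear ℂ D] [MonoidalCategory D]

/-- The scalar by which an endomorphism of the unit acts on `x` from the right. -/
def actR (x : Irr D) (e : 𝟙_ D ⟶ 𝟙_ D) : ℂ :=
  scal x ((ρ_ (obj x)).inv ≫ obj x ◁ e ≫ (ρ_ (obj x)).hom)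

/-- The scalar by which an endomorphism of the unit acts on `x` from the left. -/
def actL (x : Irr D) (e : 𝟙_ D ⟶ 𝟙_ D) : ℂ :=
  scal x ((λ_ (obj x)).inv ≫ e ▷ obj x ≫ (λ_ (obj x)).hom)

theorem whiskerLeft_unit (x : Irr D) (e : 𝟙_ D ⟶ 𝟙_ D) : obj x ◁ e = actR x e • 𝟙 _ := by
  have h := scal_spec x ((ρ_ (obj x)).inv ≫ obj x ◁ e ≫ (ρ_ (obj x)).hom)
  rw [Iso.inv_comp_eq, Linear.comp_smul, Category.comp_id] at h
  rw [← cancel_mono (ρ_ (obj x)).hom, h, Linear.smul_comp, Category.id_comp, actR]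

theorem whiskerRight_unit (x : Irr D) (e : 𝟙_ D ⟶ 𝟙_ D) : e ▷ obj x = actL x e • 𝟙 _ := by
  have h := scal_spec x ((λ_ (obj x)).inv ≫ e ▷ obj x ≫ (λ_ (obj x)).hom)
  rw [Iso.inv_comp_eq, Linear.comp_smul, Category.comp_id] at h
  rw [← cancel_mono (λ_ (obj x)).hom, h, Linear.smul_comp, Category.id_comp, actL]

variable [MonoidalPreadditive D] [MonoidalLinear ℂ D]

theorem actR_smul (x : Irr D) (z : ℂ) (e : 𝟙_ D ⟶ 𝟙_ D) : actR x (z • e) = z * actR x e := by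
  simp [actR]

theorem actL_smul (x : Irr D) (z : ℂ) (e : 𝟙_ D ⟶ 𝟙_ D) : actL x (z • e) = z * actL x e := by
  simp [actL]

theorem actR_eq_actL_of_ne_zero {Z : D} {x y : Irr D} {f : Z ⟶ obj x ⊗ obj y} (hf : f ≠ 0)
    (e : 𝟙_ D ⟶ 𝟙_ D) : actR x e = actL y e := by
  have h : (obj x ◁ e) ▷ obj y ≫ (α_ _ _ _).hom = (α_ _ _ _).hom ≫ obj x ◁ (e ▷ obj y) := by simp
  rw [whiskerLeft_unit, whiskerRight_unit] at h
  simp only [MonoidalLinear.smul_whiskerRight, MonoidalLinear.whiskerLeft_smul, Linear.smul_comp,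
    Linear.comp_smul, id_whiskerRight, whiskerLeft_id, Category.id_comp, Category.comp_id] at h
  have hα : (α_ (obj x) (𝟙_ D) (obj y)).hom ≠ 0 := by
    intro hα
    refine hf ?_
    calc f = f ≫ (ρ_ (obj x)).inv ▷ obj y ≫ (α_ (obj x) (𝟙_ D) (obj y)).hom ≫
          obj x ◁ (λ_ (obj y)).hom := by simp
      _ = 0 := by rw [hα, zero_comp, comp_zero, comp_zero]
  exact smul_left_injective ℂ hα h

theorem actR_eq_actR_of_ne_zero {X : D} {y z : Irr D} {f : obj z ⟶ X ⊗ obj y} (hf : f ≠ 0)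
    (e : 𝟙_ D ⟶ 𝟙_ D) : actR z e = actR y e := by
  have h : f ▷ 𝟙_ D ≫ (X ⊗ obj y) ◁ e = obj z ◁ e ≫ f ▷ 𝟙_ D := (whisker_exchange f e).symm
  rw [tensor_whiskerLeft, whiskerLeft_unit, whiskerLeft_unit] at h
  simp only [MonoidalLinear.whiskerLeft_smul, Linear.smul_comp,
    Linear.comp_smul, whiskerLeft_id, Category.id_comp, Iso.hom_inv_id, Category.comp_id] at h
  have hf' : f ▷ 𝟙_ D ≠ 0 := by
    rw [whiskerRight_id]
    simpa
  exact (smul_left_injective ℂ hf' h).symm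

theorem actL_eq_actL_of_ne_zero {Y : D} {x z : Irr D} {f : obj z ⟶ obj x ⊗ Y} (hf : f ≠ 0)
    (e : 𝟙_ D ⟶ 𝟙_ D) : actL z e = actL x e := by
  have h : 𝟙_ D ◁ f ≫ e ▷ (obj x ⊗ Y) = e ▷ obj z ≫ 𝟙_ D ◁ f := whisker_exchange e f
  rw [whiskerRight_tensor, whiskerRight_unit, whiskerRight_unit] at h
  simp only [MonoidalLinear.smul_whiskerRight, Linear.smul_comp,
    Linear.comp_smul, id_whiskerRight, Category.id_comp, Iso.inv_hom_id, Category.comp_id] at h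
  have hf' : 𝟙_ D ◁ f ≠ 0 := by
    rw [id_whiskerLeft]
    simpa
  exact (smul_left_injective ℂ hf' h).symm

end UnitAction

/-! ### Positivity of the quantum dimensions -/

section Dagger

variable {D : Type u} [Category.{v} D] [Preadditive D] [Linear ℂ D]
variable [HasFiniteBiproducts D] [MonoidalCategory D] [MonoidalPreadditive D]
  [MonoidalLinear ℂ D] [RigidCategory D] [UMFC D]

open TubeAlg.UMFC (dag dag_dag dag_add dag_smul dag_id dag_comp dag_tensor)

theorem dag_whiskerLeft (A : D) {X Y : D} (f : X ⟶ Y) : dag (A ◁ f) = A ◁ dag f := by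
  rw [← id_tensorHom, dag_tensor, dag_id, id_tensorHom]

theorem dag_whiskerRight {X Y : D} (f : X ⟶ Y) (A : D) : dag (f ▷ A) = dag f ▷ A := by
  rw [← tensorHom_id, dag_tensor, dag_id, tensorHom_id]

theorem dag_zero {X Y : D} : dag (0 : X ⟶ Y) = 0 := by
  simpa using dag_smul (0 : ℂ) (0 : X ⟶ Y)

theorem dag_eq_zero_iff {X Y : D} {f : X ⟶ Y} : dag f = 0 ↔ f = 0 :=
  ⟨fun h => by rw [← dag_dag f, h, dag_zero], fun h => by rw [h, dag_zero]⟩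

theorem dag_associator_inv (X Y Z : D) : dag (α_ X Y Z).inv = (α_ X Y Z).hom := by
  rw [← UMFC.dag_associator, dag_dag]

theorem dag_leftUnitor_inv (X : D) : dag (λ_ X).inv = (λ_ X).hom := by
  rw [← UMFC.dag_leftUnitor, dag_dag]

theorem dag_rightUnitor_inv (X : D) : dag (ρ_ X).inv = (ρ_ X).hom := by
  rw [← UMFC.dag_rightUnitor, dag_dag]

theorem scal_dag (x : Irr D) (f : obj x ⟶ obj x) : scal x (dag f) = conj (scal x f) := by
  conv_lhs => rw [scal_spec x f]
  rw [dag_smul, dag_id, scal_smul_id]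

/-- The value at `f` of the hermitian form `f† ∘ g` on the morphisms out of a simple object. -/
def hermSq {x : Irr D} {Y : D} (f : obj x ⟶ Y) : ℝ := (scal x (f ≫ dag f)).re

theorem scal_comp_dag {x : Irr D} {Y : D} (f : obj x ⟶ Y) :
    scal x (f ≫ dag f) = (hermSq f : ℂ) := by
  have h : conj (scal x (f ≫ dag f)) = scal x (f ≫ dag f) := by
    rw [← scal_dag, dag_comp, dag_dag]
  exact (Complex.conj_eq_iff_re.mp h).symm

theorem comp_dag_eq_smul {x : Irr D} {Y : D} (f : obj x ⟶ Y) :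
    f ≫ dag f = (hermSq f : ℂ) • 𝟙 (obj x) := by
  rw [← scal_comp_dag, ← scal_spec]

theorem eq_zero_of_hermSq_eq_zero {x : Irr D} {Y : D} {f : obj x ⟶ Y} (h : hermSq f = 0) :
    f = 0 :=
  UMFC.eq_zero_of_comp_dag f (by rw [comp_dag_eq_smul, h, Complex.ofReal_zero, zero_smul])

theorem hermSq_real_smul {x : Irr D} {Y : D} (t : ℝ) (f : obj x ⟶ Y) :
    hermSq ((t : ℂ) • f) = t ^ 2 * hermSq f := by
  rw [hermSq, dag_smul, Linear.smul_comp, Linear.comp_smul, map_smul, map_smul, scal_comp_dag]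
  simp
  ring

theorem hermSq_add_real_smul {x : Irr D} {Y : D} (t : ℝ) (f g : obj x ⟶ Y) :
    hermSq (f + (t : ℂ) • g) =
      hermSq f + 2 * t * (scal x (f ≫ dag g)).re + t ^ 2 * hermSq g := by
  have h : scal x (g ≫ dag f) = conj (scal x (f ≫ dag g)) := by
    rw [← scal_dag, dag_comp, dag_dag]
  rw [hermSq, dag_add, dag_smul]
  simp only [Preadditive.add_comp, Preadditive.comp_add, Linear.smul_comp, Linear.comp_smul,
    map_add, map_smul, scal_comp_dag, h]
  simp
  ring

/-- Otherwise the real quadratic polynomial `t ↦ hermSq (f + t • g)` has a root, which makes `f` a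
multiple of `g` by anisotropy. -/
theorem hermSq_mul_nonneg {x : Irr D} {Y : D} (f g : obj x ⟶ Y) : 0 ≤ hermSq f * hermSq g := by
  by_contra! hneg
  set c := (scal x (f ≫ dag g)).re
  have hg : hermSq g ≠ 0 := right_ne_zero_of_mul hneg.ne
  have hdiscrim : discrim (hermSq g) (2 * c) (hermSq f) =
      √(discrim (hermSq g) (2 * c) (hermSq f)) * √(discrim (hermSq g) (2 * c) (hermSq f)) :=
    (Real.mul_self_sqrt (by rw [discrim]; nlinarith [sq_nonneg c])).symm
  obtain ⟨t, ht⟩ := exists_quadratic_eq_zero hg ⟨_, hdiscrim⟩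
  have hzero : f + (t : ℂ) • g = 0 := by
    refine eq_zero_of_hermSq_eq_zero ?_
    rw [hermSq_add_real_smul]
    linear_combination ht
  have hf : hermSq f = t ^ 2 * hermSq g := by
    have : f = ((-t : ℝ) : ℂ) • g := by rw [eq_neg_of_add_eq_zero_left hzero]; simp
    rw [this, hermSq_real_smul, neg_sq]
  rw [hf] at hneg
  nlinarith [mul_nonneg (sq_nonneg t) (sq_nonneg (hermSq g))]

theorem hermSq_comp_whiskerLeft {y z : Irr D} {A Y : D} (w : obj y ⟶ A ⊗ obj z)
    (f : obj z ⟶ Y) : hermSq (w ≫ A ◁ f) = hermSq f * hermSq w := by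
  have h : (w ≫ A ◁ f) ≫ dag (w ≫ A ◁ f) = (hermSq f : ℂ) • (w ≫ dag w) := by
    rw [dag_comp, dag_whiskerLeft, Category.assoc, ← MonoidalCategory.whiskerLeft_comp_assoc,
      comp_dag_eq_smul, MonoidalLinear.whiskerLeft_smul, whiskerLeft_id, Linear.smul_comp,
      Category.id_comp, Linear.comp_smul]
  rw [hermSq, h, map_smul, scal_comp_dag, smul_eq_mul, ← Complex.ofReal_mul, Complex.ofReal_re]

theorem loopL_eq_actR (x : Irr D) : loopL x = actR x (dag (ev (obj x)) ≫ ev (obj x)) := rfl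

theorem loopR_eq_actL (x : Irr D) : loopR x = actL x (coev (obj x) ≫ dag (coev (obj x))) := rfl

/-- Creation of a dual pair to the left of `x`. -/
def cupLeft (x : Irr D) : obj x ⟶ (obj x ⊗ (obj x)ᘁ) ⊗ obj x :=
  (λ_ (obj x)).inv ≫ coev (obj x) ▷ obj x

/-- Creation of a dual pair to the right of `x`. -/
def cupRight (x : Irr D) : obj x ⟶ (obj x ⊗ (obj x)ᘁ) ⊗ obj x :=
  (ρ_ (obj x)).inv ≫ obj x ◁ dag (ev (obj x)) ≫ (α_ _ _ _).inv

theorem hermSq_cupLeft (x : Irr D) : ((hermSq (cupLeft x) : ℝ) : ℂ) = loopR x := by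
  rw [← scal_comp_dag, loopR_eq_actL, actL, cupLeft]
  simp only [dag_comp, dag_leftUnitor_inv, dag_whiskerRight, Category.assoc, comp_whiskerRight]

theorem hermSq_cupRight (x : Irr D) : ((hermSq (cupRight x) : ℝ) : ℂ) = loopL x := by
  rw [← scal_comp_dag, loopL_eq_actR, actR, cupRight]
  simp only [dag_comp, dag_rightUnitor_inv, dag_whiskerLeft, dag_associator_inv, Category.assoc,
    Iso.inv_hom_id_assoc, MonoidalCategory.whiskerLeft_comp, dag_dag]

theorem cupLeft_comp_dag_cupRight (x : Irr D) : cupLeft x ≫ dag (cupRight x) = 𝟙 _ := by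
  rw [cupLeft, cupRight]
  simp only [dag_comp, dag_rightUnitor_inv, dag_whiskerLeft, dag_associator_inv, Category.assoc,
    dag_dag, coev, ev]
  rw [ExactPairing.evaluation_coevaluation_assoc]
  simp

theorem hermSq_cupLeft_ne_zero (x : Irr D) : hermSq (cupLeft x) ≠ 0 := by
  intro h
  have zigzag := cupLeft_comp_dag_cupRight x
  rw [eq_zero_of_hermSq_eq_zero h, zero_comp] at zigzag
  exact (obj_simple x).1 zigzag.symm

theorem hermSq_cupRight_ne_zero (x : Irr D) : hermSq (cupRight x) ≠ 0 := by
  intro h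
  have zigzag := cupLeft_comp_dag_cupRight x
  rw [eq_zero_of_hermSq_eq_zero h, dag_zero, comp_zero] at zigzag
  exact (obj_simple x).1 zigzag.symm

theorem loopL_ne_zero (x : Irr D) : loopL x ≠ 0 := by
  rw [← hermSq_cupRight]
  exact_mod_cast hermSq_cupRight_ne_zero x

theorem loopR_ne_zero (x : Irr D) : loopR x ≠ 0 := by
  rw [← hermSq_cupLeft]
  exact_mod_cast hermSq_cupLeft_ne_zero x

theorem hermSq_cupRight_mul_hermSq_cupLeft_pos (x : Irr D) :
    0 < hermSq (cupRight x) * hermSq (cupLeft x) :=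
  lt_of_le_of_ne (hermSq_mul_nonneg _ _)
    (mul_ne_zero (hermSq_cupRight_ne_zero x) (hermSq_cupLeft_ne_zero x)).symm

theorem qdim_eq_sqrt_hermSq (x : Irr D) :
    qdim x = √(hermSq (cupRight x) * hermSq (cupLeft x)) := by
  rw [qdim, ← hermSq_cupLeft, ← hermSq_cupRight, ← Complex.ofReal_mul, Complex.ofReal_re]

theorem qdim_pos (x : Irr D) : 0 < qdim x := by
  rw [qdim_eq_sqrt_hermSq]
  exact Real.sqrt_pos.mpr (hermSq_cupRight_mul_hermSq_cupLeft_pos x)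

theorem qdim_ne_zero (x : Irr D) : (qdim x : ℂ) ≠ 0 := by
  exact_mod_cast (qdim_pos x).ne'

theorem qdim_mul_self (x : Irr D) : (qdim x : ℂ) * qdim x = loopL x * loopR x := by
  rw [← Complex.ofReal_mul, qdim_eq_sqrt_hermSq,
    Real.mul_self_sqrt (hermSq_cupRight_mul_hermSq_cupLeft_pos x).le, Complex.ofReal_mul,
    hermSq_cupLeft, hermSq_cupRight]

theorem actR_cup_ev (x : Irr D) : actR x (cup x ≫ ev (obj x)) = qdim x := by
  rw [cup, Linear.smul_comp, actR_smul, ← loopL_eq_actR, div_mul_cancel₀ _ (loopL_ne_zero x)]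

theorem actL_coev_cap (x : Irr D) : actL x (coev (obj x) ≫ cap x) = qdim x := by
  rw [cap, Linear.comp_smul, actL_smul, ← loopR_eq_actL, div_mul_cancel₀ _ (loopR_ne_zero x)]

theorem qdim_div_loopL_mul_qdim_div_loopR (x : Irr D) :
    (qdim x : ℂ) / loopL x * ((qdim x : ℂ) / loopR x) = 1 := by
  rw [div_mul_div_comm, qdim_mul_self, div_self (mul_ne_zero (loopL_ne_zero x) (loopR_ne_zero x))]

/-- The simple object `x` as a right dual of its right dual. -/
abbrev cupPairing (x : Irr D) : ExactPairing (obj x)ᘁ (obj x) where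
  coevaluation' := cup x
  evaluation' := cap x
  coevaluation_evaluation' := by
    have h := congrArg dag (ExactPairing.evaluation_coevaluation (obj x) (obj x)ᘁ)
    simp only [dag_comp, dag_whiskerLeft, dag_whiskerRight, UMFC.dag_associator,
      UMFC.dag_leftUnitor, dag_rightUnitor_inv, Category.assoc] at h
    rw [cup, cap, MonoidalLinear.whiskerLeft_smul, MonoidalLinear.smul_whiskerRight,
      Linear.smul_comp, Linear.comp_smul, Linear.comp_smul, smul_smul,
      qdim_div_loopL_mul_qdim_div_loopR, one_smul]
    exact h
  evaluation_coevaluation' := by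
    have h := congrArg dag (ExactPairing.coevaluation_evaluation (obj x) (obj x)ᘁ)
    simp only [dag_comp, dag_whiskerLeft, dag_whiskerRight, dag_associator_inv,
      UMFC.dag_rightUnitor, dag_leftUnitor_inv, Category.assoc] at h
    rw [cup, cap, MonoidalLinear.whiskerLeft_smul, MonoidalLinear.smul_whiskerRight,
      Linear.smul_comp, Linear.comp_smul, Linear.comp_smul, smul_smul,
      qdim_div_loopL_mul_qdim_div_loopR, one_smul]
    exact h

end Dagger

/-! ### Sphericality -/

section Spherical

variable {D : Type u} [Category.{v} D] [Preadditive D] [Linear ℂ D]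
variable [HasFiniteBiproducts D] [MonoidalCategory D] [MonoidalPreadditive D]
  [MonoidalLinear ℂ D] [RigidCategory D] [UMFC D]

open TubeAlg.UMFC (dag dag_dag dag_add dag_smul dag_id dag_comp dag_tensor)

attribute [local instance] cupPairing

/-- The label of the dual of a simple object. -/
def bar (x : Irr D) : Irr D :=
  Quotient.mk (simpleSetoid D) ⟨(obj x)ᘁ, isSimpleObj_of_exactPairing (z := x)⟩

/-- The dual of a simple object is isomorphic to the chosen representative. -/
def barIso (x : Irr D) : obj (bar x) ≅ (obj x)ᘁ :=
  (Quotient.mk_out (s := simpleSetoid D) ⟨(obj x)ᘁ, isSimpleObj_of_exactPairing (z := x)⟩).some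

/-- The left partial trace over a simple object. -/
abbrev ptrL (a : Irr D) {X Y : D} (T : obj a ⊗ X ⟶ obj a ⊗ Y) : X ⟶ Y :=
  traceL (cup a) (ev (obj a)) T

/-- The right partial trace over a simple object. -/
abbrev ptrR (b : Irr D) {X Y : D} (T : X ⊗ obj b ⟶ Y ⊗ obj b) : X ⟶ Y :=
  traceR (coev (obj b)) (cap b) T

section Vertices

variable {a y z : Irr D}

theorem qdim_mul_scal_ptrR_eq_ptrL {Z : D} {f : Z ⟶ obj a ⊗ obj y} (hf : f ≠ 0)
    (T : obj a ⊗ obj y ⟶ obj a ⊗ obj y) :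
    qdim a * scal a (ptrR y T) = qdim y * scal y (ptrL a T) := by
  have closed := close_traceR_eq_close_traceL (cup a) (ev (obj a)) (coev (obj y)) (cap y) T
  have hR : traceR (coev (obj y)) (cap y) T = _ := scal_spec a (ptrR y T)
  have hL : traceL (cup a) (ev (obj a)) T = _ := scal_spec y (ptrL a T)
  rw [hR, hL] at closed
  simp only [MonoidalLinear.whiskerLeft_smul, MonoidalLinear.smul_whiskerRight, Linear.smul_comp,
    Linear.comp_smul, whiskerLeft_id, id_whiskerRight, Category.id_comp] at closed
  have acts := congrArg (actR a) closed
  rw [actR_smul, actR_smul, actR_cup_ev, actR_eq_actL_of_ne_zero hf (coev (obj y) ≫ cap y),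
    actL_coev_cap] at acts
  linear_combination acts

/-- The mate of a splitting vertex between right duals. -/
abbrev splitMateR (f : obj z ⟶ obj a ⊗ obj y) : (obj y)ᘁ ⊗ (obj a)ᘁ ⟶ (obj z)ᘁ := rightMate f

/-- The mate of a splitting vertex between left duals: right duals, too, are left duals, by means
of `cup` and `cap`. -/
abbrev splitMateL (f : obj z ⟶ obj a ⊗ obj y) : (obj y)ᘁ ⊗ (obj a)ᘁ ⟶ (obj z)ᘁ := leftMate f

/-- The mate of a fusion vertex between right duals. -/
abbrev fuseMateR (g : obj a ⊗ obj y ⟶ obj z) : (obj z)ᘁ ⟶ (obj y)ᘁ ⊗ (obj a)ᘁ := rightMate g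

/-- The mate of a fusion vertex between left duals, as in `splitMateL`. -/
abbrev fuseMateL (g : obj a ⊗ obj y ⟶ obj z) : (obj z)ᘁ ⟶ (obj y)ᘁ ⊗ (obj a)ᘁ := leftMate g

variable (f : obj z ⟶ obj a ⊗ obj y) (g : obj a ⊗ obj y ⟶ obj z)

theorem close_fuseMateL_comp_splitMateR :
    cup z ≫ (fuseMateL g ≫ splitMateR f) ▷ obj z ≫ ev (obj z) =
      scal y (ptrL a (g ≫ f)) • (cup y ≫ ev (obj y)) := by
  have bend_g : cup z ≫ fuseMateL g ▷ obj z = _ :=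
    coevaluation_leftMate (X' := (obj z)ᘁ) (Z' := (obj y)ᘁ ⊗ (obj a)ᘁ) g
  have bend_f : splitMateR f ▷ obj z ≫ ev (obj z) = _ :=
    rightMate_evaluation (X' := (obj y)ᘁ ⊗ (obj a)ᘁ) (Z' := (obj z)ᘁ) f
  have closed := close_tensor_eq_close_traceL (A' := (obj a)ᘁ) (B' := (obj y)ᘁ) (g ≫ f)
  rw [MonoidalCategory.whiskerLeft_comp, Category.assoc] at closed
  rw [comp_whiskerRight, Category.assoc, reassoc_of% bend_g, bend_f]
  refine closed.trans ?_
  change cup y ≫ (obj y)ᘁ ◁ ptrL a (g ≫ f) ≫ ev (obj y) = _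
  conv_lhs => rw [scal_spec y (ptrL a (g ≫ f))]
  simp

theorem close_fuseMateR_comp_splitMateL :
    coev (obj z) ≫ obj z ◁ (fuseMateR g ≫ splitMateL f) ≫ cap z =
      scal a (ptrR y (g ≫ f)) • (coev (obj a) ≫ cap a) := by
  have bend_g : coev (obj z) ≫ obj z ◁ fuseMateR g = _ :=
    coevaluation_rightMate (X' := (obj z)ᘁ) (Z' := (obj y)ᘁ ⊗ (obj a)ᘁ) g
  have bend_f : obj z ◁ splitMateL f ≫ cap z = _ :=
    leftMate_evaluation (X' := (obj y)ᘁ ⊗ (obj a)ᘁ) (Z' := (obj z)ᘁ) f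
  have closed := close_tensor_eq_close_traceR (A' := (obj a)ᘁ) (B' := (obj y)ᘁ) (g ≫ f)
  rw [comp_whiskerRight, Category.assoc] at closed
  rw [MonoidalCategory.whiskerLeft_comp, Category.assoc, reassoc_of% bend_g, bend_f]
  refine closed.trans ?_
  change coev (obj a) ≫ ptrR y (g ≫ f) ▷ (obj a)ᘁ ≫ cap a = _
  conv_lhs => rw [scal_spec a (ptrR y (g ≫ f))]
  simp

variable {f} in
theorem qdim_smul_fuseMateL_comp_splitMateR (hf : f ≠ 0) :
    (qdim z : ℂ) • (fuseMateL g ≫ splitMateR f) =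
      ((qdim y : ℂ) * scal y (ptrL a (g ≫ f))) • 𝟙 (obj z)ᘁ := by
  obtain ⟨w, hw⟩ := (isSimpleObj_of_exactPairing (z := z)).2 (fuseMateL g ≫ splitMateR f)
  have closed := close_fuseMateL_comp_splitMateR f g
  rw [hw] at closed ⊢
  simp only [MonoidalLinear.smul_whiskerRight, Linear.smul_comp,
    Linear.comp_smul, id_whiskerRight, Category.id_comp] at closed
  have acts := congrArg (actR z) closed
  rw [actR_smul, actR_smul, actR_cup_ev, actR_eq_actR_of_ne_zero hf, actR_cup_ev] at acts
  rw [smul_smul]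
  congr 1
  linear_combination acts

variable {f} in
theorem qdim_smul_fuseMateR_comp_splitMateL (hf : f ≠ 0) :
    (qdim z : ℂ) • (fuseMateR g ≫ splitMateL f) =
      ((qdim a : ℂ) * scal a (ptrR y (g ≫ f))) • 𝟙 (obj z)ᘁ := by
  obtain ⟨w, hw⟩ := (isSimpleObj_of_exactPairing (z := z)).2 (fuseMateR g ≫ splitMateL f)
  have closed := close_fuseMateR_comp_splitMateL f g
  rw [hw] at closed ⊢
  simp only [MonoidalLinear.whiskerLeft_smul, Linear.smul_comp,
    Linear.comp_smul, whiskerLeft_id, Category.id_comp] at closed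
  have acts := congrArg (actL z) closed
  rw [actL_smul, actL_smul, actL_coev_cap, actL_eq_actL_of_ne_zero hf, actL_coev_cap] at acts
  rw [smul_smul]
  congr 1
  linear_combination acts

theorem fuseMateL_comp_splitMateR_eq : fuseMateL g ≫ splitMateR f = fuseMateR g ≫ splitMateL f := by
  by_cases hf : f = 0
  · subst hf
    simp [rightMate, leftMate, rightAdjointMate, leftAdjointMate]
  · refine smul_right_injective _ (qdim_ne_zero z) ?_
    simp only [qdim_smul_fuseMateL_comp_splitMateR g hf, qdim_smul_fuseMateR_comp_splitMateL g hf,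
      qdim_mul_scal_ptrR_eq_ptrL hf]

/-- Creation of a dual pair, the two halves of which enclose nothing and stand left of `X`. -/
def openLoop (a : Irr D) (X : D) : X ⟶ (obj a)ᘁ ⊗ (obj a ⊗ X) :=
  (λ_ X).inv ≫ dag (ev (obj a)) ▷ X ≫ (α_ _ _ _).hom

theorem dag_openLoop (X : D) :
    dag (openLoop a X) = (α_ _ _ _).inv ≫ ev (obj a) ▷ X ≫ (λ_ X).hom := by
  simp only [openLoop, dag_comp, dag_leftUnitor_inv, dag_whiskerRight, UMFC.dag_associator,
    dag_dag, Category.assoc]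

variable {f} in
theorem hermSq_openLoop (hf : f ≠ 0) : ((hermSq (openLoop a (obj y)) : ℝ) : ℂ) = loopL a := by
  rw [← scal_comp_dag, dag_openLoop, openLoop, loopL_eq_actR, actR_eq_actL_of_ne_zero hf, actL]
  simp

theorem ptrL_dag_comp_self : ptrL a (dag f ≫ f) = ((qdim a : ℂ) / loopL a) •
    ((openLoop a (obj y) ≫ (obj a)ᘁ ◁ dag f) ≫ dag (openLoop a (obj y) ≫ (obj a)ᘁ ◁ dag f)) := by
  rw [dag_comp, dag_whiskerLeft, dag_dag, dag_openLoop, openLoop, ptrL, traceL, cup]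
  simp

theorem scal_ptrL_dag_comp_self_mul_hermSq_nonneg (hf : f ≠ 0) :
    ∃ t : ℝ, scal y (ptrL a (dag f ≫ f)) = t ∧ 0 ≤ t * hermSq f := by
  set v := openLoop a (obj y)
  set w := v ≫ (obj a)ᘁ ◁ dag f
  have hv : ((hermSq v : ℝ) : ℂ) = loopL a := hermSq_openLoop hf
  have hv0 : hermSq v ≠ 0 := fun h => loopL_ne_zero a (by rw [← hv, h, Complex.ofReal_zero])
  refine ⟨qdim a / hermSq v * hermSq w, ?_, ?_⟩
  · rw [ptrL_dag_comp_self, map_smul, scal_comp_dag, smul_eq_mul, ← hv]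
    push_cast
    rfl
  · have hpos : 0 ≤ hermSq v * (hermSq f * hermSq w) := by
      rw [← hermSq_comp_whiskerLeft]
      exact hermSq_mul_nonneg v (w ≫ (obj a)ᘁ ◁ f)
    calc (0 : ℝ) ≤ qdim a / hermSq v ^ 2 * (hermSq v * (hermSq f * hermSq w)) :=
          mul_nonneg (div_nonneg (qdim_pos a).le (sq_nonneg _)) hpos
      _ = qdim a / hermSq v * hermSq w * hermSq f := by field_simp

theorem exists_splitMateR_eq_splitMateL :
    ∃ f₂ : obj z ⟶ obj a ⊗ obj y, splitMateR f₂ = splitMateL f ∧ splitMateL f₂ = splitMateR f := by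
  obtain ⟨f₂, hf₂⟩ := rightMate_surjective (X := obj a ⊗ obj y) (Z := obj z) (splitMateL f)
  refine ⟨f₂, hf₂, sub_eq_zero.mp (dag_eq_zero_iff.mp (UMFC.eq_zero_of_comp_dag _ ?_))⟩
  obtain ⟨g, hg⟩ := rightMate_surjective (X := obj z) (Z := obj a ⊗ obj y)
    (dag (splitMateL f₂ - splitMateR f))
  rw [dag_dag, ← hg, Preadditive.comp_sub, sub_eq_zero]
  calc fuseMateR g ≫ splitMateL f₂ = fuseMateL g ≫ splitMateR f₂ :=
        (fuseMateL_comp_splitMateR_eq f₂ g).symm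
    _ = fuseMateL g ≫ splitMateL f :=
        congrArg (fuseMateL g ≫ ·) hf₂
    _ = fuseMateR g ≫ splitMateR f := by
        rw [leftMate_comp_leftMate, leftMate_end, rightMate_comp_rightMate, rightMate_end]

/-- Otherwise the partial trace of `f† f` would have the sign opposite to that of `f† ∘ f`. -/
theorem eq_zero_of_splitMateL_eq_neg (h : splitMateL f = -splitMateR f) : f = 0 := by
  by_contra hf
  have traces := qdim_smul_fuseMateL_comp_splitMateR (dag f) hf
  rw [fuseMateL_comp_splitMateR_eq, h, Preadditive.comp_neg, rightMate_comp_rightMate,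
    rightMate_end, scal_comp_dag, ← neg_smul, smul_smul] at traces
  obtain ⟨t, ht, hpos⟩ := scal_ptrL_dag_comp_self_mul_hermSq_nonneg f hf
  have traces' := smul_left_injective ℂ (isSimpleObj_of_exactPairing (z := z)).1 traces
  rw [ht] at traces'
  have hreal : qdim z * - hermSq f = qdim y * t := by exact_mod_cast traces'
  have hsq : 0 < hermSq f ^ 2 :=
    sq_pos_of_ne_zero fun h0 => hf (eq_zero_of_hermSq_eq_zero h0)
  have : -(qdim z * hermSq f ^ 2) = qdim y * (t * hermSq f) := by
    linear_combination hermSq f * hreal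
  linarith [mul_nonneg (qdim_pos y).le hpos, mul_pos (qdim_pos z) hsq]

theorem splitMateL_eq_splitMateR : splitMateL f = splitMateR f := by
  obtain ⟨f₂, hR, hL⟩ := exists_splitMateR_eq_splitMateL f
  have hzero : f - f₂ = 0 := by
    refine eq_zero_of_splitMateL_eq_neg _ ?_
    calc splitMateL (f - f₂) = splitMateL f - splitMateL f₂ := leftMate_sub f f₂
      _ = -(splitMateR f - splitMateR f₂) := by rw [hR, hL, neg_sub]
      _ = -splitMateR (f - f₂) := congrArg Neg.neg (rightMate_sub f f₂).symm
  rw [← hR, ← sub_eq_zero.mp hzero]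

theorem qdim_mul_scal_ptrL :
    (qdim y : ℂ) * scal y (ptrL a (g ≫ f)) = qdim z * scal z (f ≫ g) := by
  by_cases hf : f = 0
  · subst hf
    simp [traceL]
  · have h := qdim_smul_fuseMateL_comp_splitMateR g hf
    rw [← splitMateL_eq_splitMateR, leftMate_comp_leftMate, leftMate_end, smul_smul] at h
    exact (smul_left_injective ℂ (isSimpleObj_of_exactPairing (z := z)).1 h).symm

theorem qdim_mul_scal_ptrR :
    (qdim a : ℂ) * scal a (ptrR y (g ≫ f)) = qdim z * scal z (f ≫ g) := by
  by_cases hf : f = 0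
  · subst hf
    simp [traceR]
  · rw [← qdim_mul_scal_ptrL, qdim_mul_scal_ptrR_eq_ptrL hf]

end Vertices

theorem Decomp.sum_qdim_label {x y : Irr D} (h : ¬ IsZero (obj x ⊗ obj y))
    (d : Decomp (obj x ⊗ obj y)) : ∑ r, (qdim (d.label r) : ℂ) = qdim x * qdim y := by
  have hid : 𝟙 (obj x ⊗ obj y) ≠ 0 := fun h0 => h ((IsZero.iff_id_eq_zero _).mpr h0)
  have hloop : ptrL x (𝟙 (obj x ⊗ obj y)) =
      (λ_ (obj y)).inv ≫ (cup x ≫ ev (obj x)) ▷ obj y ≫ (λ_ (obj y)).hom := by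
    simp [traceL]
  calc ∑ r, (qdim (d.label r) : ℂ)
      = ∑ r, qdim y * scal y (ptrL x (d.proj r ≫ d.inj r)) := by
        refine Finset.sum_congr rfl fun r _ => ?_
        rw [qdim_mul_scal_ptrL, d.inj_proj_self, scal_id, mul_one]
    _ = qdim y * scal y (ptrL x (𝟙 (obj x ⊗ obj y))) := by
        rw [← Finset.mul_sum, ← map_sum, ← traceL_sum, d.total]
    _ = qdim x * qdim y := by
        rw [hloop, ← actL, ← actR_eq_actL_of_ne_zero hid, actR_cup_ev, mul_comm]

open Classical in
/-- Coordinates of the morphisms out of a simple object with respect to a decomposition. -/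
def Decomp.homEquiv {X : D} (d : Decomp X) (z : Irr D) :
    (obj z ⟶ X) ≃ₗ[ℂ] ({r // d.label r = z} → ℂ) where
  toFun f r := scal z (f ≫ d.proj r ≫ delta (d.label r) z)
  map_add' f g := by ext; simp
  map_smul' w f := by ext; simp
  invFun c := ∑ r, if h : d.label r = z then c ⟨r, h⟩ • (delta z (d.label r) ≫ d.inj r) else 0
  left_inv f := by
    conv_rhs => rw [← d.sum_comp_proj_inj f]
    refine Finset.sum_congr rfl fun r _ => ?_
    split_ifs with h
    · subst h
      simp only [delta_self, Category.comp_id, Category.id_comp]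
      rw [← end_comp_eq_smul]
    · rw [hom_eq_zero_of_ne (Ne.symm h) (f ≫ d.proj r), zero_comp]
  right_inv c := by
    funext ⟨r, hr⟩
    subst hr
    simp only [Preadditive.sum_comp]
    rw [Fintype.sum_eq_single r]
    · simp [d.inj_proj_self]
    · intro s hs
      split_ifs with h
      · rw [Linear.smul_comp, Category.assoc, reassoc_of% d.inj_proj_ne s r hs, zero_comp,
          comp_zero, smul_zero]
      · exact zero_comp

open Classical in
theorem mult_eq_card_label {x y : Irr D} (d : Decomp (obj x ⊗ obj y)) (z : Irr D) :
    mult x y z = Fintype.card {r // d.label r = z} := by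
  rw [mult, (d.homEquiv z).finrank_eq, Module.finrank_fintype_fun_eq_card]

theorem fusion_rule (x y : Irr D) (h : ¬ IsZero (obj x ⊗ obj y)) :
    ∑ z, (mult x y z : ℝ) * qdim z = qdim x * qdim y := by
  classical
  have hsum := (decomp (obj x ⊗ obj y)).sum_qdim_label h
  have hreal : ∑ r, qdim ((decomp (obj x ⊗ obj y)).label r) = qdim x * qdim y := by
    exact_mod_cast hsum
  rw [← hreal, ← Finset.sum_fiberwise' Finset.univ (decomp (obj x ⊗ obj y)).label qdim]
  refine Finset.sum_congr rfl fun z _ => ?_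
  rw [Finset.sum_const, mult_eq_card_label (decomp _), Fintype.card_subtype, nsmul_eq_mul]

end Spherical

/-! ### Bending -/

section Bending

variable {D : Type u} [Category.{v} D] [Preadditive D] [Linear ℂ D]
variable [HasFiniteBiproducts D] [MonoidalCategory D] [MonoidalPreadditive D]
  [MonoidalLinear ℂ D] [RigidCategory D] [UMFC D]

theorem bendUpper_eq (a b f h : Irr D) (q : Upper (obj a) (obj b) f h) :
    bendUpper a b f h q =
      arcUnit (cup a) (coev (obj b)) (obj f) ≫ wrap (obj a)ᘁ (obj b)ᘁ q := by
  simp only [arcUnit, trivialArcs, Iso.trans_inv, Category.assoc]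
  rfl

theorem bendLower_eq (a b c e : Irr D) (p : Lower (obj a) (obj b) c e) :
    bendLower a b c e p =
      wrap (obj a)ᘁ (obj b)ᘁ p ≫ arcCounit (ev (obj a)) (cap b) (obj e) :=
  rfl

/-- The inverse of `bendLower`. -/
def unbend (a b c e : Irr D) (w : Upper (obj a)ᘁ (obj b)ᘁ c e) : Lower (obj a) (obj b) c e :=
  arcUnit (coev (obj a)) (cup b) (obj c) ≫ wrap (obj a) (obj b) w

theorem unbend_bendLower (a b c e : Irr D) (p : Lower (obj a) (obj b) c e) :
    unbend a b c e (bendLower a b c e p) = p := by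
  rw [unbend, bendLower_eq, wrap_comp, reassoc_of% @arcUnit_natural, arcUnit_wrap_arcCounit,
    Category.comp_id]
  · exact ExactPairing.evaluation_coevaluation (obj a) (obj a)ᘁ
  · exact (cupPairing b).coevaluation_evaluation'

theorem bendLower_unbend (a b c e : Irr D) (w : Upper (obj a)ᘁ (obj b)ᘁ c e) :
    bendLower a b c e (unbend a b c e w) = w := by
  rw [unbend, bendLower_eq, wrap_comp, Category.assoc, arcCounit_natural,
    reassoc_of% @wrap_arcUnit_arcCounit]
  · exact ExactPairing.coevaluation_evaluation (obj a) (obj a)ᘁ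
  · exact (cupPairing b).evaluation_coevaluation'

theorem wrap_bendUpper_arcCounit (a b f h : Irr D) (q : Upper (obj a) (obj b) f h) :
    wrap (obj a) (obj b) (bendUpper a b f h q) ≫ arcCounit (cap a) (ev (obj b)) (obj h) = q := by
  rw [bendUpper_eq, wrap_comp, Category.assoc, arcCounit_natural,
    reassoc_of% @wrap_arcUnit_arcCounit]
  · exact (cupPairing a).coevaluation_evaluation'
  · exact ExactPairing.evaluation_coevaluation (obj b) (obj b)ᘁ

theorem arc_nest_inv_wrap_bendLower (a b c e : Irr D) (p : Lower (obj a) (obj b) c e) :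
    arc (coev (obj a)) (cup b) (obj c) ≫ (nest (obj a) (obj a)ᘁ (obj c) (obj b)ᘁ (obj b)).inv ≫
      wrap (obj a) (obj b) (bendLower a b c e p) = (trivialArcs (obj c)).hom ≫ p := by
  conv_rhs => rw [← unbend_bendLower a b c e p]
  simp [unbend, arcUnit]

theorem wrap_nest_arc_eq_bendLower (a b c e : Irr D) (p : Lower (obj a) (obj b) c e) :
    wrap (obj a)ᘁ (obj b)ᘁ p ≫ (nest (obj a)ᘁ (obj a) (obj e) (obj b) (obj b)ᘁ).hom ≫
      arc (ev (obj a)) (cap b) (obj e) = bendLower a b c e p ≫ (trivialArcs (obj e)).inv := by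
  simp [bendLower_eq, arcCounit]

theorem bendUpper_comp_bendLower (a b i k : Irr D) (f : Lower (obj a) (obj b) k i)
    (g : Upper (obj a) (obj b) i k) :
    bendUpper a b i k g ≫ bendLower a b k i f = ptrL a (ptrR b (g ≫ f)) := by
  rw [bendUpper_eq, bendLower_eq]
  refine Eq.trans ?_ (arcUnit_wrap_arcCounit_eq_traceL_traceR ..)
  simp only [wrap_comp, Category.assoc]

/-- Cutting along a decomposition of `a ⊗ i` reduces the closed diagram with two arcs to the
sphericality of each arc. -/
theorem qdim_mul_scal_bendUpper_comp_bendLower (a b i k : Irr D) (f : Lower (obj a) (obj b) k i)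
    (g : Upper (obj a) (obj b) i k) :
    (qdim i : ℂ) * scal i (bendUpper a b i k g ≫ bendLower a b k i f) =
      qdim k * scal k (f ≫ g) := by
  rw [bendUpper_comp_bendLower]
  set T := ptrR b (g ≫ f) with hT
  set d := decomp (obj a ⊗ obj i)
  have cut : ∀ r, (qdim i : ℂ) * scal i (ptrL a ((T ≫ d.proj r) ≫ d.inj r)) =
      qdim k * scal k (f ≫ (d.proj r ≫ d.inj r) ▷ obj b ≫ g) := by
    intro r
    have spherical := qdim_mul_scal_ptrR (f ≫ d.proj r ▷ obj b) (d.inj r ▷ obj b ≫ g)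
    simp only [Category.assoc] at spherical
    rw [qdim_mul_scal_ptrL, hT, ← traceR_natural, Category.assoc, spherical, comp_whiskerRight,
      Category.assoc]
  calc (qdim i : ℂ) * scal i (ptrL a T)
      = ∑ r, (qdim i : ℂ) * scal i (ptrL a ((T ≫ d.proj r) ≫ d.inj r)) := by
        rw [← Finset.mul_sum, ← map_sum, ← traceL_sum, d.sum_comp_proj_inj]
    _ = qdim k * scal k (f ≫ g) := by
        simp only [cut]
        rw [← Finset.mul_sum, ← map_sum, ← Preadditive.comp_sum, ← Preadditive.sum_comp,
          ← sum_whiskerRight, d.total, id_whiskerRight, Category.id_comp]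

theorem unbend_comp_eq_smul (a b i k : Irr D) (w : Upper (obj a)ᘁ (obj b)ᘁ k i)
    (g : Upper (obj a) (obj b) i k) : unbend a b k i w ≫ g =
      ((qdim i : ℂ) / qdim k * scal i (bendUpper a b i k g ≫ w)) • 𝟙 (obj k) := by
  have spherical := qdim_mul_scal_bendUpper_comp_bendLower a b i k (unbend a b k i w) g
  rw [bendLower_unbend] at spherical
  rw [div_mul_eq_mul_div, spherical, mul_div_cancel_left₀ _ (qdim_ne_zero k), ← scal_spec]

end Bending

section Slide

variable {D : Type u} [Category.{v} D] [Preadditive D] [Linear ℂ D]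

theorem sum_delta_comp_delta [Fintype (Irr D)] (x : Irr D) :
    ∑ i, delta x i ≫ delta i x = 𝟙 (obj x) := by
  rw [Fintype.sum_eq_single x fun i hi => by rw [delta_ne hi, comp_zero], delta_self,
    Category.comp_id]

variable [HasFiniteBiproducts D] [MonoidalCategory D] [MonoidalPreadditive D]
  [MonoidalLinear ℂ D] [RigidCategory D] [UMFC D]

theorem comp_delta_comp_delta {i x : Irr D} (f : obj i ⟶ obj x) :
    (f ≫ delta x i) ≫ delta i x = f := by
  by_cases h : i = x
  · subst h
    simp only [delta_self, Category.comp_id]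
  · rw [hom_eq_zero_of_ne h f, zero_comp, zero_comp]

variable {M : Type*} [AddCommMonoid M] [Module ℂ M] {A B A' B' : D}

theorem end_slide (Y : ∀ k : Irr D, (obj k ⟶ (A ⊗ ((A' ⊗ obj k) ⊗ B')) ⊗ B) →ₗ[ℂ] M)
    {k k' : Irr D} (θ : obj k ⟶ obj k') (w : obj k' ⟶ (A ⊗ ((A' ⊗ obj k) ⊗ B')) ⊗ B) :
    Y k (θ ≫ w) = Y k' (w ≫ wrap A B (wrap A' B' θ)) := by
  by_cases h : k = k'
  · subst h
    rw [end_comp_eq_smul, scal_spec k θ]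
    simp [wrap_smul]
  · simp [hom_eq_zero_of_ne h θ]

theorem slide_eq_sum (Y : ∀ k : Irr D, (obj k ⟶ (A ⊗ ((A' ⊗ obj k) ⊗ B')) ⊗ B) →ₗ[ℂ] M)
    {k : Irr D} {I : D} (u : obj k ⟶ (A ⊗ I) ⊗ B) (v : I ⟶ (A' ⊗ obj k) ⊗ B')
    (d : Decomp ((A ⊗ I) ⊗ B)) : Y k (u ≫ wrap A B v) =
      ∑ r, Y (d.label r) (d.inj r ≫ wrap A B (v ≫ wrap A' B' (u ≫ d.proj r))) := by
  conv_lhs => rw [← d.sum_comp_proj_inj u]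
  rw [Preadditive.sum_comp, map_sum]
  refine Finset.sum_congr rfl fun r _ => ?_
  rw [Category.assoc, end_slide Y, wrap_comp A B v, wrap_comp A' B' u]
  simp only [wrap_comp, Category.assoc]

end Slide

section SumBend

variable {D : Type u} [Category.{v} D] [Preadditive D] [Linear ℂ D]
variable [HasFiniteBiproducts D] [MonoidalCategory D] [MonoidalPreadditive D]
  [MonoidalLinear ℂ D] [RigidCategory D] [UMFC D]

theorem sum_unbend_proj_comp_wrap_inj (a b k : Irr D)
    (d : Decomp (((obj a)ᘁ ⊗ obj k) ⊗ (obj b)ᘁ)) :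
    ∑ i, ∑ s, unbend a b k i (d.proj s ≫ delta (d.label s) i) ≫
        wrap (obj a) (obj b) (delta i (d.label s) ≫ d.inj s) =
      arcUnit (coev (obj a)) (cup b) (obj k) := by
  have collapse : ∀ s, ∑ i, d.proj s ≫ delta (d.label s) i ≫ delta i (d.label s) ≫ d.inj s =
      d.proj s ≫ d.inj s := by
    intro s
    simp only [← Category.assoc (delta _ _) (delta _ _)]
    rw [← Preadditive.comp_sum, ← Preadditive.sum_comp, sum_delta_comp_delta, Category.id_comp]
  simp only [unbend, Category.assoc, ← wrap_comp, ← Preadditive.comp_sum, ← wrap_sum]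
  rw [Finset.sum_comm]
  simp only [collapse, d.total, wrap_id, Category.comp_id]

theorem sum_inj_comp_wrap_unbend_proj (a b i k : Irr D) (g : Upper (obj a) (obj b) i k)
    (d : ∀ k : Irr D, Decomp (((obj a)ᘁ ⊗ obj k) ⊗ (obj b)ᘁ)) :
    ∑ k', ∑ s, (delta i ((d k').label s) ≫ (d k').inj s) ≫ wrap (obj a)ᘁ (obj b)ᘁ
        (unbend a b k' i ((d k').proj s ≫ delta ((d k').label s) i) ≫ g) =
      ((qdim i : ℂ) / qdim k) • bendUpper a b i k g := by
  have summand : ∀ s, (delta i ((d k).label s) ≫ (d k).inj s) ≫ wrap (obj a)ᘁ (obj b)ᘁ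
      (unbend a b k i ((d k).proj s ≫ delta ((d k).label s) i) ≫ g) =
      ((qdim i : ℂ) / qdim k) • ((bendUpper a b i k g ≫ (d k).proj s) ≫ (d k).inj s) := by
    intro s
    rw [unbend_comp_eq_smul, wrap_smul, wrap_id, Linear.comp_smul, Category.comp_id, mul_smul,
      ← end_comp_eq_smul, ← Category.assoc _ _ (delta _ i),
      ← Category.assoc (_ ≫ delta _ i) (delta i _), comp_delta_comp_delta]
  rw [Fintype.sum_eq_single k fun k' hk' => ?_]
  · simp only [summand]
    rw [← Finset.smul_sum, (d k).sum_comp_proj_inj]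
  · refine Finset.sum_eq_zero fun s _ => ?_
    rw [hom_eq_zero_of_ne hk' (_ ≫ g), wrap_zero, comp_zero]

theorem sum_bendUpper_proj {M : Type*} [AddCommMonoid M] [Module ℂ M] (a b : Irr D)
    (Y : ∀ k : Irr D, (obj k ⟶ (obj a ⊗ (((obj a)ᘁ ⊗ obj k) ⊗ (obj b)ᘁ)) ⊗ obj b) →ₗ[ℂ] M)
    (d : ∀ i : Irr D, Decomp ((obj a ⊗ obj i) ⊗ obj b)) :
    ∑ i, ∑ r, ((qdim i : ℂ) / qdim ((d i).label r)) • Y ((d i).label r)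
        ((d i).inj r ≫ wrap (obj a) (obj b) (bendUpper a b i _ ((d i).proj r))) =
      ∑ k, Y k (arcUnit (coev (obj a)) (cup b) (obj k)) := by
  let d' : ∀ k : Irr D, Decomp (((obj a)ᘁ ⊗ obj k) ⊗ (obj b)ᘁ) := fun k => decomp _
  have slide : ∀ k i s, Y k (unbend a b k i ((d' k).proj s ≫ delta ((d' k).label s) i) ≫
      wrap (obj a) (obj b) (delta i ((d' k).label s) ≫ (d' k).inj s)) =
      ∑ r, Y ((d i).label r) ((d i).inj r ≫ wrap (obj a) (obj b)
        ((delta i ((d' k).label s) ≫ (d' k).inj s) ≫ wrap (obj a)ᘁ (obj b)ᘁ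
          (unbend a b k i ((d' k).proj s ≫ delta ((d' k).label s) i) ≫ (d i).proj r))) :=
    fun k i s => slide_eq_sum Y _ _ (d i)
  symm
  simp only [← sum_unbend_proj_comp_wrap_inj a b _ (d' _), map_sum, slide]
  rw [Finset.sum_comm]
  refine Finset.sum_congr rfl fun i _ => ?_
  rw [Finset.sum_congr rfl fun k _ => Finset.sum_comm, Finset.sum_comm]
  refine Finset.sum_congr rfl fun r _ => ?_
  rw [← map_smul, ← Linear.comp_smul, ← wrap_smul, ← sum_inj_comp_wrap_unbend_proj a b i _ _ d']
  simp only [← map_sum, ← Preadditive.comp_sum, ← wrap_sum]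

theorem sum_wrap_proj_bendLower_inj (a b i : Irr D) (d : Decomp ((obj a ⊗ obj i) ⊗ obj b)) :
    ∑ r, (nest (obj a)ᘁ (obj a) (obj i) (obj b) (obj b)ᘁ).inv ≫
        wrap (obj a)ᘁ (obj b)ᘁ (d.proj r) ≫ bendLower a b _ i (d.inj r) =
      arc (ev (obj a)) (cap b) (obj i) ≫ (trivialArcs (obj i)).hom := by
  simp only [bendLower_eq, ← reassoc_of% @wrap_comp, ← Preadditive.comp_sum,
    ← Preadditive.sum_comp, ← wrap_sum, d.total, wrap_id, Category.id_comp]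
  simp [arcCounit]

end SumBend

/-! ### The antipode -/

section Antipode

variable {D : Type u} [Category.{v} D] [Preadditive D] [Linear ℂ D]
variable [HasFiniteBiproducts D] [MonoidalCategory D] [MonoidalPreadditive D]
  [MonoidalLinear ℂ D] [RigidCategory D] [UMFC D]

theorem tube_induction_simple {P : Tube D → Prop} (zero : P 0)
    (add : ∀ x y, P x → P y → P (x + y))
    (resolve : ∀ (a b c e f h : Irr D) (p : Lower (obj a) (obj b) c e)
      (q : Upper (obj a) (obj b) f h), P (resolve (obj a) (obj b) c e f h p q))
    (x : Tube D) : P x := by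
  induction x using tube_induction with
  | zero => exact zero
  | add x y hx hy => exact add x y hx hy
  | resolve A B c e f h p q =>
    rw [resolve_apply]
    refine Finset.sum_induction _ P add zero fun r _ => ?_
    rw [← resolve_obj]
    exact resolve ..

theorem antipode_resolve (a b c e f h : Irr D)
    (p : Lower (obj a) (obj b) c e) (q : Upper (obj a) (obj b) f h) :
    antipode (resolve (obj a) (obj b) c e f h p q) = ((qdim f : ℂ) / (qdim h : ℂ)) •
      resolve (obj a)ᘁ (obj b)ᘁ f h c e (bendUpper a b f h q) (bendLower a b c e p) := by
  rw [resolve_obj, antipode_dbl]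

theorem counitalL_resolve (A B : D) (c e f h : Irr D) (p : Lower A B c e) (q : Upper A B f h) :
    counitalL mul one comul counit (resolve A B c e f h p q) =
      counit (resolve A B c e f h p q) • ∑ y, lines c y := by
  rw [counitalL, comul_one_eq_sum]
  simp only [map_sum, TensorProduct.map_tmul, TensorProduct.lid_tmul, LinearMap.id_apply,
    LinearMap.comp_apply, LinearMap.flip_apply]
  rw [Fintype.sum_eq_single h fun x hx => ?_, Finset.smul_sum]
  · refine Finset.sum_congr rfl fun y _ => ?_
    rw [Fintype.sum_eq_single c fun i hi => ?_, lines_mul_resolve]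
    rw [lines_mul_resolve_of_ne fun h => hi h.2, map_zero, zero_smul]
  · refine Finset.sum_eq_zero fun y _ => Finset.sum_eq_zero fun i _ => ?_
    rw [lines_mul_resolve_of_ne fun h => hx h.1, map_zero, zero_smul]

theorem counitalR_resolve (A B : D) (c e f h : Irr D) (p : Lower A B c e) (q : Upper A B f h) :
    counitalR mul one comul counit (resolve A B c e f h p q) =
      counit (resolve A B c e f h p q) • ∑ x, lines x f := by
  rw [counitalR, comul_one_eq_sum]
  simp only [map_sum, TensorProduct.map_tmul, TensorProduct.rid_tmul, LinearMap.id_apply,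
    LinearMap.comp_apply]
  rw [Finset.smul_sum]
  refine Finset.sum_congr rfl fun x _ => ?_
  rw [Fintype.sum_eq_single e fun y hy => ?_]
  · rw [Fintype.sum_eq_single f fun i hi => ?_, resolve_mul_lines]
    rw [resolve_mul_lines_of_ne fun h => hi h.1, map_zero, zero_smul]
  · refine Finset.sum_eq_zero fun i _ => ?_
    rw [resolve_mul_lines_of_ne fun h => hy h.2, map_zero, zero_smul]

theorem resolve_trivialArcs_comp_upper (k c h : Irr D) (m : obj c ⟶ obj h) :
    resolve (𝟙_ D) (𝟙_ D) k k c h (trivialArcs (obj k)).inv ((trivialArcs (obj c)).hom ≫ m) =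
      scal c (m ≫ delta h c) • lines c k := by
  by_cases hc : c = h
  · subst hc
    rw [delta_self, Category.comp_id, comp_end_eq_smul c m, map_smul, lines_eq_resolve]
  · rw [hom_eq_zero_of_ne hc m, comp_zero, map_zero, zero_comp, map_zero, zero_smul]

theorem resolve_trivialArcs_comp_lower (k f e : Irr D) (m : obj f ⟶ obj e) :
    resolve (𝟙_ D) (𝟙_ D) f e k k (m ≫ (trivialArcs (obj e)).inv) (trivialArcs (obj k)).hom =
      scal f (m ≫ delta e f) • lines k f := by
  by_cases hf : f = e
  · subst hf
    rw [delta_self, Category.comp_id, end_comp_eq_smul f m, map_smul, LinearMap.smul_apply,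
      lines_eq_resolve]
  · rw [hom_eq_zero_of_ne hf m, zero_comp, map_zero, LinearMap.zero_apply, zero_comp, map_zero,
      zero_smul]

theorem qdim_div_mul_scal_bend_eq_counit (a b c e f h : Irr D)
    (p : Lower (obj a) (obj b) c e) (q : Upper (obj a) (obj b) f h) :
    (qdim f : ℂ) / qdim h *
        scal f ((bendUpper a b f h q ≫ bendLower a b h e (delta h c ≫ p)) ≫ delta e f) =
      counit (resolve (obj a) (obj b) c e f h p q) := by
  rw [counit_resolve]
  by_cases hf : f = e
  · subst hf
    by_cases hc : h = c
    · subst hc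
      simp only [delta_self, Category.id_comp, wrap_id, Category.comp_id]
      rw [div_mul_eq_mul_div, qdim_mul_scal_bendUpper_comp_bendLower,
        mul_div_cancel_left₀ _ (qdim_ne_zero h)]
    · simp [delta_ne hc]
  · simp [delta_ne (Ne.symm hf)]

protected theorem mul_antipode (x : Tube D) :
    TensorProduct.lift mul (TensorProduct.map LinearMap.id antipode (comul x)) =
      counitalL mul one comul counit x := by
  induction x using tube_induction_simple with
  | zero => simp [counitalL]
  | add x y hx hy =>
    rw [map_add, map_add, map_add, hx, hy]
    simp [counitalL, TensorProduct.map_add_left, LinearMap.comp_add]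
  | resolve a b c e f h p q =>
    rw [counitalL_resolve, comul_resolve _ _ _ _ _ _ _ _ fun i => decomp _, Finset.smul_sum]
    simp only [map_sum, comulTerm_apply, TensorProduct.map_tmul, LinearMap.id_apply,
      TensorProduct.lift.tmul, antipode_resolve, map_smul, mul_resolve, stackLower_apply,
      stackUpper_apply, delta_self, Category.id_comp]
    set Q := (nest (obj a) (obj a)ᘁ (obj c) (obj b)ᘁ (obj b)).inv ≫
      wrap (obj a) (obj b) (bendLower a b c e p ≫ delta e f) ≫ q with hQ
    have slide := sum_bendUpper_proj a b (fun k => (resolve _ _ k k c h).flip Q ∘ₗ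
      Linear.rightComp ℂ (obj k) (nest (obj a) (obj a)ᘁ (obj k) (obj b)ᘁ (obj b)).hom)
      (fun i => decomp _)
    simp only [LinearMap.comp_apply, LinearMap.flip_apply, Linear.rightComp_apply,
      Category.assoc] at slide
    refine slide.trans (Finset.sum_congr rfl fun k _ => ?_)
    have lower : arcUnit (coev (obj a)) (cup b) (obj k) ≫
        (nest (obj a) (obj a)ᘁ (obj k) (obj b)ᘁ (obj b)).hom =
        (trivialArcs (obj k)).inv ≫ arc (coev (obj a)) (cup b) _ := by
      simp [arcUnit]
    have upper : arc (coev (obj a)) (cup b) _ ≫ Q =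
        (trivialArcs (obj c)).hom ≫ p ≫ wrap (obj a) (obj b) (delta e f) ≫ q := by
      rw [hQ, wrap_comp, Category.assoc, reassoc_of% arc_nest_inv_wrap_bendLower a b c e p]
    rw [lower, resolve_arc_slide, upper, resolve_trivialArcs_comp_upper, counit_resolve]
    simp only [Category.assoc]

protected theorem antipode_mul (x : Tube D) :
    TensorProduct.lift mul (TensorProduct.map antipode LinearMap.id (comul x)) =
      counitalR mul one comul counit x := by
  induction x using tube_induction_simple with
  | zero => simp [counitalR, TensorProduct.map_zero_right]
  | add x y hx hy =>
    rw [map_add, map_add, map_add, hx, hy]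
    simp [counitalR, TensorProduct.map_add_right, LinearMap.comp_add]
  | resolve a b c e f h p q =>
    rw [counitalR_resolve, comul_resolve _ _ _ _ _ _ _ _ fun i => decomp _, Finset.smul_sum]
    simp only [map_sum, comulTerm_apply, TensorProduct.map_tmul, LinearMap.id_apply,
      TensorProduct.lift.tmul, antipode_resolve, map_smul, LinearMap.smul_apply, mul_resolve,
      stackLower_apply, stackUpper_apply, delta_self, Category.comp_id]
    refine Finset.sum_congr rfl fun i _ => ?_
    rw [← Finset.smul_sum, ← map_sum, sum_wrap_proj_bendLower_inj, ← resolve_arc_slide]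
    simp only [Category.assoc]
    rw [wrap_nest_arc_eq_bendLower, ← Category.assoc, resolve_trivialArcs_comp_lower, smul_smul,
      qdim_div_mul_scal_bend_eq_counit]

protected theorem antipode_mul_antipode (x : Tube D) :
    TensorProduct.lift mul (TensorProduct.map (TensorProduct.lift mul) LinearMap.id
      (TensorProduct.map (TensorProduct.map antipode LinearMap.id) antipode
        (TensorProduct.map comul LinearMap.id (comul x)))) = antipode x := by
  induction x using tube_induction_simple with
  | zero => simp only [map_zero]
  | add x y hx hy => simp only [map_add, hx, hy]
  | resolve a b c e f h p q =>
    conv_rhs => rw [← TubeAlg.counit_comul (resolve (obj a) (obj b) c e f h p q)]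
    rw [comul_resolve _ _ _ _ _ _ _ _ fun i => decomp _]
    simp only [map_sum, comulTerm_apply, TensorProduct.map_tmul, LinearMap.id_apply,
      TensorProduct.lift.tmul, TensorProduct.lid_tmul, map_smul, TubeAlg.antipode_mul,
      counitalR_resolve, LinearMap.sum_apply, LinearMap.smul_apply]
    refine Finset.sum_congr rfl fun i _ => Finset.sum_congr rfl fun r _ => ?_
    by_cases hi : i = f
    · subst hi
      rw [antipode_resolve]
      simp only [map_smul, ← Finset.smul_sum]
      rw [Fintype.sum_eq_single e fun x hx => lines_mul_resolve_of_ne (fun h => hx h.1) ..,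
        lines_mul_resolve]
    · rw [counit_resolve, delta_ne hi]
      simp

theorem isWeakHopfAlgebra : IsWeakHopfAlgebra (mul (D := D)) one comul counit antipode where
  toIsWeakBialgebra := isWeakBialgebra
  mul_antipode := TubeAlg.mul_antipode
  antipode_mul := TubeAlg.antipode_mul
  antipode_mul_antipode := TubeAlg.antipode_mul_antipode

end Antipode

/-! ### The square of the antipode -/

section ArcUnitArc

variable {D : Type u} [Category.{v} D] [MonoidalCategory D]

theorem arcUnit_wrap_arc {A A₁ A' B B₁ B' : D} (s : 𝟙_ D ⟶ A' ⊗ A) (t : 𝟙_ D ⟶ B ⊗ B')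
    (u : A ⟶ A₁) (w : B ⟶ B₁) (X : D) :
    arcUnit s t X ≫ wrap A' B' (arc u w X) = arcUnit (s ≫ A' ◁ u) (t ≫ w ▷ B') X := by
  simp only [arcUnit, Category.assoc, nest_inv_wrap_arc, arc_comp]

theorem arcUnit_arc {A A' A₁ B B' B₁ : D} (s : 𝟙_ D ⟶ A' ⊗ A) (t : 𝟙_ D ⟶ B ⊗ B')
    (u : A' ⟶ A₁) (w : B' ⟶ B₁) (X : D) :
    arcUnit s t X ≫ arc u w _ = arcUnit (s ≫ u ▷ A) (t ≫ B ◁ w) X := by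
  simp only [arcUnit, Category.assoc, nest_inv_arc, arc_comp]

theorem wrap_arc_arcCounit {A A₁ A' B B₁ B' : D} (s : A' ⊗ A ⟶ 𝟙_ D) (t : B ⊗ B' ⟶ 𝟙_ D)
    (u : A₁ ⟶ A) (w : B₁ ⟶ B) (X : D) :
    wrap A' B' (arc u w X) ≫ arcCounit s t X = arcCounit (A' ◁ u ≫ s) (w ▷ B' ≫ t) X := by
  simp only [arcCounit, reassoc_of% @wrap_arc_nest, arc_comp, Category.assoc]

theorem arc_arcCounit {A A' A₁ B B' B₁ : D} (s : A' ⊗ A ⟶ 𝟙_ D) (t : B ⊗ B' ⟶ 𝟙_ D)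
    (u : A₁ ⟶ A') (w : B₁ ⟶ B') (X : D) :
    arc u w _ ≫ arcCounit s t X = arcCounit (u ▷ A ≫ s) (B ◁ w ≫ t) X := by
  simp only [arcCounit, reassoc_of% @arc_nest, arc_comp, Category.assoc]

end ArcUnitArc

section Bidual

variable {D : Type u} [Category.{v} D] [Preadditive D] [Linear ℂ D]
variable [MonoidalCategory D] [MonoidalPreadditive D] [MonoidalLinear ℂ D] [RigidCategory D]

theorem actL_bar (x : Irr D) (e : 𝟙_ D ⟶ 𝟙_ D) : actL (bar x) e = actR x e := by
  refine (actR_eq_actL_of_ne_zero (f := coev (obj x) ≫ obj x ◁ (barIso x).inv) (fun h => ?_) e).symm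
  have coev_zero : coev (obj x) = 0 := by
    rw [← cancel_mono (obj x ◁ (barIso x).inv), h, zero_comp]
  exact (obj_simple x).1 (id_eq_zero_of_coevaluation_eq_zero coev_zero)

variable [HasFiniteBiproducts D] [UMFC D]

attribute [local instance] cupPairing

theorem actR_bar (x : Irr D) (e : 𝟙_ D ⟶ 𝟙_ D) : actR (bar x) e = actL x e := by
  refine actR_eq_actL_of_ne_zero (f := cup x ≫ (barIso x).inv ▷ obj x) (fun h => ?_) e
  have cup_zero : cup x = 0 := by rw [← cancel_mono ((barIso x).inv ▷ obj x), h, zero_comp]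
  exact (isSimpleObj_of_exactPairing (z := x) (Z' := (obj x)ᘁ)).1
    (@id_eq_zero_of_coevaluation_eq_zero _ _ _ _ _ _ _ (cupPairing x) cup_zero)

/-- The isomorphism of `x` with its bidual that treats both duals as right duals. -/
abbrev bidualR (x : Irr D) : obj x ≅ (obj (bar x))ᘁ := rightMateIso (barIso x)

/-- The isomorphism of `x` with its bidual that treats both duals as left duals. -/
abbrev bidualL (x : Irr D) : obj x ≅ (obj (bar x))ᘁ := leftMateIso (barIso x)

theorem coev_bar_comp_barIso (x : Irr D) :
    coev (obj (bar x)) ≫ (barIso x).hom ▷ (obj (bar x))ᘁ = cup x ≫ (obj x)ᘁ ◁ (bidualR x).hom :=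
  (coevaluation_rightMate (X := (obj x)ᘁ) (X' := obj x) (Z' := (obj (bar x))ᘁ) (barIso x).hom).symm

theorem cup_bar_comp_barIso (x : Irr D) :
    cup (bar x) ≫ (obj (bar x))ᘁ ◁ (barIso x).hom = coev (obj x) ≫ (bidualL x).hom ▷ (obj x)ᘁ :=
  (coevaluation_leftMate (X := (obj x)ᘁ) (X' := obj x) (Z' := (obj (bar x))ᘁ) (barIso x).hom).symm

theorem barIso_inv_comp_ev_bar (x : Irr D) :
    (obj (bar x))ᘁ ◁ (barIso x).inv ≫ ev (obj (bar x)) = (bidualR x).inv ▷ (obj x)ᘁ ≫ cap x :=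
  (rightMate_evaluation (barIso x).inv).symm

theorem barIso_inv_comp_cap_bar (x : Irr D) :
    (barIso x).inv ▷ (obj (bar x))ᘁ ≫ cap (bar x) = (obj x)ᘁ ◁ (bidualL x).inv ≫ ev (obj x) :=
  (leftMate_evaluation (barIso x).inv).symm

theorem scal_bidualL_bidualR_mul_qdim (x : Irr D) :
    scal x ((bidualL x).hom ≫ (bidualR x).inv) * qdim x = qdim (bar x) := by
  rw [← actR_cup_ev (bar x), actR_bar, ← actL_coev_cap x, ← actL_smul]
  congr 1
  calc scal x ((bidualL x).hom ≫ (bidualR x).inv) • (coev (obj x) ≫ cap x)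
      = coev (obj x) ≫ ((bidualL x).hom ≫ (bidualR x).inv) ▷ (obj x)ᘁ ≫ cap x := by
        conv_rhs => rw [scal_spec x (_ ≫ _)]
        simp
    _ = cup (bar x) ≫ ev (obj (bar x)) := by
        rw [comp_whiskerRight, Category.assoc, ← reassoc_of% cup_bar_comp_barIso x,
          ← barIso_inv_comp_ev_bar]
        simp

theorem scal_bidualR_bidualL_mul_qdim (x : Irr D) :
    scal x ((bidualR x).hom ≫ (bidualL x).inv) * qdim x = qdim (bar x) := by
  rw [← actL_coev_cap (bar x), actL_bar, ← actR_cup_ev x, ← actR_smul]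
  congr 1
  calc scal x ((bidualR x).hom ≫ (bidualL x).inv) • (cup x ≫ ev (obj x))
      = cup x ≫ (obj x)ᘁ ◁ ((bidualR x).hom ≫ (bidualL x).inv) ≫ ev (obj x) := by
        conv_rhs => rw [scal_spec x (_ ≫ _)]
        simp
    _ = coev (obj (bar x)) ≫ cap (bar x) := by
        rw [MonoidalCategory.whiskerLeft_comp, Category.assoc,
          ← reassoc_of% coev_bar_comp_barIso x, ← barIso_inv_comp_cap_bar]
        simp

theorem qdim_bar (x : Irr D) : qdim (bar x) = qdim x := by
  have inverse : scal x ((bidualL x).hom ≫ (bidualR x).inv) *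
      scal x ((bidualR x).hom ≫ (bidualL x).inv) = 1 := by
    rw [← scal_comp, Category.assoc, Iso.inv_hom_id_assoc, Iso.hom_inv_id, scal_id]
  have squares : (qdim (bar x) : ℂ) * qdim (bar x) = qdim x * qdim x := by
    linear_combination (qdim x : ℂ) * qdim x * inverse -
      (qdim (bar x) : ℂ) * scal_bidualL_bidualR_mul_qdim x -
      scal x ((bidualL x).hom ≫ (bidualR x).inv) * qdim x * scal_bidualR_bidualL_mul_qdim x
  exact (mul_self_inj (qdim_pos _).le (qdim_pos _).le).mp (by exact_mod_cast squares)

theorem bidualL_eq_bidualR (x : Irr D) : bidualL x = bidualR x := by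
  have scal_one : scal x ((bidualL x).hom ≫ (bidualR x).inv) = 1 := by
    refine mul_right_cancel₀ (qdim_ne_zero x) ?_
    rw [scal_bidualL_bidualR_mul_qdim, qdim_bar, _root_.one_mul]
  have spec := scal_spec x ((bidualL x).hom ≫ (bidualR x).inv)
  rw [scal_one, one_smul, Iso.comp_inv_eq, Category.id_comp] at spec
  exact Iso.ext spec

end Bidual

section SquareAntipode

variable {D : Type u} [Category.{v} D] [Preadditive D] [Linear ℂ D]
variable [HasFiniteBiproducts D] [MonoidalCategory D] [MonoidalPreadditive D]
  [MonoidalLinear ℂ D] [RigidCategory D] [UMFC D]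

theorem bendUpper_bar_bendLower (a b c e : Irr D) (p : Lower (obj a) (obj b) c e) :
    bendUpper (bar a) (bar b) c e
        (arc (barIso a).hom (barIso b).hom _ ≫ bendLower a b c e p) =
      p ≫ arc (bidualR a).hom (bidualR b).hom _ := by
  conv_rhs => rw [← unbend_bendLower a b c e p]
  rw [bendUpper_eq, unbend, wrap_comp, ← Category.assoc, arcUnit_wrap_arc, cup_bar_comp_barIso,
    coev_bar_comp_barIso, bidualL_eq_bidualR, ← arcUnit_arc, Category.assoc, Category.assoc,
    arc_wrap]

theorem bendLower_bar_bendUpper (a b f h : Irr D) (q : Upper (obj a) (obj b) f h) :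
    bendLower (bar a) (bar b) f h
        (bendUpper a b f h q ≫ arc (barIso a).inv (barIso b).inv _) =
      arc (bidualR a).inv (bidualR b).inv _ ≫ q := by
  conv_rhs => rw [← wrap_bendUpper_arcCounit a b f h q]
  rw [bendLower_eq, wrap_comp, Category.assoc, wrap_arc_arcCounit, barIso_inv_comp_ev_bar,
    barIso_inv_comp_cap_bar, bidualL_eq_bidualR, ← arc_arcCounit, arc_wrap_assoc]

theorem antipode_antipode_dbl (a b c e f h : Irr D) (p : Lower (obj a) (obj b) c e)
    (q : Upper (obj a) (obj b) f h) :
    antipode (antipode (dbl a b c e f h p q)) =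
      ((qdim f * qdim c / (qdim h * qdim e) : ℝ) : ℂ) • dbl a b c e f h p q := by
  have transport : bendUpper a b f h q =
      (bendUpper a b f h q ≫ arc (barIso a).inv (barIso b).inv _) ≫
        arc (barIso a).hom (barIso b).hom _ := by
    simp [← arc_comp]
  rw [antipode_dbl, map_smul, transport, resolve_arc_slide, antipode_resolve,
    bendUpper_bar_bendLower, bendLower_bar_bendUpper, resolve_arc_slide, ← arc_comp_assoc,
    smul_smul]
  simp only [Iso.hom_inv_id, arc_id, Category.id_comp, resolve_obj]
  congr 1
  push_cast
  rw [div_mul_div_comm]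

theorem xi_eq_lineSum : (xi : Tube D) = lineSum fun x y => (qdim y : ℂ) / qdim x := rfl

theorem xiInv_eq_lineSum : (xiInv : Tube D) = lineSum fun x y => (qdim x : ℂ) / qdim y := rfl

theorem antipode_antipode (X : Tube D) : antipode (antipode X) = mul (mul xi X) xiInv := by
  induction X using tube_induction_simple with
  | zero => simp
  | add x y hx hy => simp only [map_add, LinearMap.add_apply, hx, hy]
  | resolve a b c e f h p q =>
    rw [xi_eq_lineSum, xiInv_eq_lineSum, lineSum_mul_resolve, map_smul, LinearMap.smul_apply,
      resolve_mul_lineSum, resolve_obj, antipode_antipode_dbl, smul_smul]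
    congr 1
    push_cast
    rw [div_mul_div_comm, mul_comm (qdim f : ℂ)]

theorem lineSum_mul_lineSum (w w' : Irr D → Irr D → ℂ) :
    mul (lineSum w) (lineSum w' : Tube D) = lineSum fun x y => w x y * w' x y := by
  rw [lineSum, lineSum, map_sum]
  refine Finset.sum_congr rfl fun x _ => ?_
  rw [map_sum]
  refine Finset.sum_congr rfl fun y _ => ?_
  rw [map_smul, lines_eq_resolve x y, ← lineSum, lineSum_mul_resolve, smul_smul, mul_comm]

theorem comul_lineSum (w : Irr D → Irr D → ℂ) :
    comul (lineSum w : Tube D) = ∑ x, ∑ y, ∑ i, w x y • (lines x i ⊗ₜ[ℂ] lines i y) := by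
  simp only [lineSum, map_sum, map_smul, comul_lines, Finset.smul_sum]

theorem isGrouplike_lineSum {w w' : Irr D → Irr D → ℂ} (mul_inv : ∀ x y, w x y * w' x y = 1)
    (cocycle : ∀ x y z, w x y * w y z = w x z) :
    IsGrouplike (mul (D := D)) one comul (lineSum w) (lineSum w') where
  mul_inv := by simp only [lineSum_mul_lineSum, mul_inv, one_eq_lineSum]
  inv_mul := by simp only [lineSum_mul_lineSum, mul_comm (w' _ _), mul_inv, one_eq_lineSum]
  comul_left := by
    rw [comul_one_eq_sum, comul_lineSum]
    simp only [map_sum, tensorMul, TensorProduct.map₂_apply_tmul]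
    refine Finset.sum_congr rfl fun x _ => Finset.sum_congr rfl fun y _ =>
      Finset.sum_congr rfl fun i _ => ?_
    rw [lines_eq_resolve x i, lines_eq_resolve i y, TensorProduct.map_tmul, lineSum_mul_resolve,
      lineSum_mul_resolve, TensorProduct.smul_tmul_smul, cocycle]
  comul_right := by
    rw [comul_one_eq_sum, comul_lineSum]
    simp only [map_sum, tensorMul, TensorProduct.map₂_apply_tmul, LinearMap.sum_apply]
    refine Finset.sum_congr rfl fun x _ => Finset.sum_congr rfl fun y _ =>
      Finset.sum_congr rfl fun i _ => ?_
    rw [lines_eq_resolve x i, lines_eq_resolve i y, TensorProduct.map_tmul, resolve_mul_lineSum,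
      resolve_mul_lineSum, TensorProduct.smul_tmul_smul, cocycle]

theorem isGrouplike_xi : IsGrouplike (mul (D := D)) one comul xi xiInv :=
  isGrouplike_lineSum
    (fun x y => by
      rw [div_mul_div_comm, mul_comm, div_self (mul_ne_zero (qdim_ne_zero x) (qdim_ne_zero y))])
    fun _ y _ => div_mul_div_cancel₀' (qdim_ne_zero y) _ _

end SquareAntipode

/-! ### Bases of vertices -/

section Trees

variable {C : Type u} [Category.{v} C] [MonoidalCategory C]

/-! Stacking the tree `(a' e') b'` in the middle leg of `(a e) b` gives a tree on the five legs
`a`, `a'`, `e'`, `b'`, `b`; three F-moves on each side bring together first `a d'`, then the left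
arcs `a a'` and the right arcs `b' b`. -/

theorem splitTree_wrap_splitTree_nest {A A' B B' E E' X X' Y : C} (m : Y ⟶ X ⊗ B) (n : X ⟶ A ⊗ E)
    (m' : E ⟶ X' ⊗ B') (n' : X' ⟶ A' ⊗ E') :
    (m ≫ n ▷ B) ≫ wrap A B (m' ≫ n' ▷ B') ≫ (nest A A' E' B' B).hom =
      m ≫ (n ≫ A ◁ m' ≫ (α_ A X' B').inv) ▷ B ≫
        ((A ◁ n' ≫ (α_ A A' E').inv) ▷ B') ▷ B ≫ (α_ _ _ _).hom := by
  simp only [wrap, nest_hom]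
  monoidal

theorem split_split_split_associator {A A' B B' E' J X X' Y : C} (m : Y ⟶ X ⊗ B) (t : X ⟶ J ⊗ B')
    (w : J ⟶ A ⊗ X') (n' : X' ⟶ A' ⊗ E') :
    m ≫ (t ≫ w ▷ B') ▷ B ≫ ((A ◁ n' ≫ (α_ A A' E').inv) ▷ B') ▷ B ≫ (α_ _ _ _).hom =
      (m ≫ t ▷ B ≫ (α_ _ _ _).hom) ≫ (w ≫ A ◁ n' ≫ (α_ A A' E').inv) ▷ (B' ⊗ B) := by
  monoidal

theorem split_split_arc {A A' B B' E' J K S : C} (x : S ⟶ B' ⊗ B)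
    (y : J ⟶ K ⊗ E') (s : K ⟶ A ⊗ A') :
    J ◁ x ≫ (y ≫ s ▷ E') ▷ (B' ⊗ B) =
      y ▷ S ≫ arc (𝟙 K) x E' ≫ arc s (𝟙 (B' ⊗ B)) E' := by
  simp only [arc, id_whiskerRight, id_tensorHom, tensorHom_id,
    comp_whiskerRight, whisker_exchange_assoc]

theorem nest_wrap_fuseTree_fuseTree {A A' B B' F F' X X' Y : C} (z : A ⊗ F ⟶ X) (g : X ⊗ B ⟶ Y)
    (z' : A' ⊗ F' ⟶ X') (g' : X' ⊗ B' ⟶ F) :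
    (nest A A' F' B' B).inv ≫ wrap A B (z' ▷ B' ≫ g') ≫ z ▷ B ≫ g =
      (α_ _ _ _).inv ≫ (((α_ A A' F').hom ≫ A ◁ z') ▷ B') ▷ B ≫
        ((α_ A X' B').hom ≫ A ◁ g' ≫ z) ▷ B ≫ g := by
  simp only [wrap, nest_inv]
  monoidal

theorem associator_fuse_fuse_fuse {A A' B B' F' J X X' Y : C} (z' : A' ⊗ F' ⟶ X')
    (r : A ⊗ X' ⟶ J) (s : J ⊗ B' ⟶ X) (g : X ⊗ B ⟶ Y) :
    (α_ _ _ _).inv ≫ (((α_ A A' F').hom ≫ A ◁ z') ▷ B') ▷ B ≫ (r ▷ B' ≫ s) ▷ B ≫ g =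
      ((α_ A A' F').hom ≫ A ◁ z' ≫ r) ▷ (B' ⊗ B) ≫ (α_ _ _ _).inv ≫ s ▷ B ≫ g := by
  monoidal

theorem arc_fuse_fuse {A A' B B' F' J K S Y : C} (s : A ⊗ A' ⟶ K) (y : K ⊗ F' ⟶ J)
    (x : B' ⊗ B ⟶ S) (l : J ⊗ S ⟶ Y) :
    (s ▷ F' ≫ y) ▷ (B' ⊗ B) ≫ J ◁ x ≫ l =
      arc s (𝟙 (B' ⊗ B)) F' ≫ arc (𝟙 K) x F' ≫ y ▷ S ≫ l := by
  simp only [arc, id_whiskerRight, id_tensorHom, tensorHom_id, Category.assoc,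
    comp_whiskerRight, whisker_exchange_assoc]

end Trees

section Vertices

variable {D : Type u} [Category.{v} D] [Preadditive D] [Linear ℂ D]
variable [HasFiniteBiproducts D] [MonoidalCategory D] [MonoidalPreadditive D]
  [MonoidalLinear ℂ D] [RigidCategory D] [UMFC D]

theorem vnorm_ne_zero (a b c : Irr D) : vnorm a b c ≠ 0 := by
  have ha := qdim_pos a
  have hb := qdim_pos b
  have hc := qdim_pos c
  rw [vnorm, Complex.ofReal_ne_zero]
  positivity

theorem inv_vnorm (a b c : Irr D) :
    (vnorm a b c)⁻¹ = ((Real.sqrt (qdim c / (qdim a * qdim b)) : ℝ) : ℂ) := by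
  rw [vnorm, ← Complex.ofReal_inv, ← Real.sqrt_inv, inv_div]

theorem vnorm_comm (a b c : Irr D) : vnorm a b c = vnorm b a c := by
  rw [vnorm, vnorm, mul_comm (qdim a)]

/-- The labels of the trees with root `c` and leaves `(a e) b`: the label of the inner edge, the
outer vertex and the inner vertex. -/
abbrev TreeIndex (a b c e : Irr D) := Σ d, Fin (mult d b c) × Fin (mult a e d)

/-- The product of the normalizations of the two vertices of a tree. -/
def treeNorm {a b c e : Irr D} (i : TreeIndex a b c e) : ℂ :=
  vnorm a e i.1 * vnorm i.1 b c

theorem treeNorm_ne_zero {a b c e : Irr D} (i : TreeIndex a b c e) : treeNorm i ≠ 0 :=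
  mul_ne_zero (vnorm_ne_zero _ _ _) (vnorm_ne_zero _ _ _)

theorem treeNorm_eq_sqrt {a b c e : Irr D} (i : TreeIndex a b c e) :
    treeNorm i = ((Real.sqrt (qdim a * qdim e * qdim b / qdim c) : ℝ) : ℂ) := by
  have ha := qdim_pos a
  have he := qdim_pos e
  have hd := qdim_pos i.1
  rw [treeNorm, vnorm, vnorm, ← Complex.ofReal_mul, ← Real.sqrt_mul (by positivity)]
  congr 2
  field_simp

variable (V : VertexBasis D)

theorem split_fuse {a b c : Irr D} (μ : Fin (mult a b c)) :
    V.split μ ≫ V.fuse μ = vnorm a b c • 𝟙 _ := by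
  rw [V.loop, if_pos rfl, delta_self]

theorem split_fuse_of_ne {a b : Irr D} {i j : Σ c, Fin (mult a b c)} (h : i ≠ j) :
    V.split i.2 ≫ V.fuse j.2 = 0 := by
  obtain ⟨c, μ⟩ := i
  obtain ⟨c', ν⟩ := j
  rw [V.loop]
  split_ifs with hμ
  · rw [delta_ne, smul_zero]
    rintro (rfl : c = c')
    exact h (congrArg (Sigma.mk c) (Fin.ext hμ))
  · rfl

/-- The tree `c → (a e) b` made of two splitting vertices. -/
def splitTree {a b c e : Irr D} (i : TreeIndex a b c e) : Lower (obj a) (obj b) c e :=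
  V.split i.2.1 ≫ V.split i.2.2 ▷ obj b

/-- The tree `(a f) b → h` made of two fusion vertices. -/
def fuseTree {a b f h : Irr D} (i : TreeIndex a b h f) : Upper (obj a) (obj b) f h :=
  V.fuse i.2.2 ▷ obj b ≫ V.fuse i.2.1

theorem diagram_eq {a b c d e f g h : Irr D} (μ : Fin (mult d b c)) (ν : Fin (mult a e d))
    (ζ : Fin (mult a f g)) (γ : Fin (mult g b h)) :
    diagram V μ ν ζ γ = dbl a b c e f h (splitTree V ⟨d, μ, ν⟩) (fuseTree V ⟨g, γ, ζ⟩) :=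
  rfl

theorem splitTree_fuseTree {a b c e h : Irr D} (i : TreeIndex a b c e) (j : TreeIndex a b h e) :
    splitTree V i ≫ fuseTree V j =
      open Classical in
      if i.1 = j.1 ∧ i.2.2.val = j.2.2.val ∧ i.2.1.val = j.2.1.val then treeNorm i • delta c h
      else 0 := by
  obtain ⟨d, μ, ν⟩ := i
  obtain ⟨g, γ, ζ⟩ := j
  rw [splitTree, fuseTree, Category.assoc, ← comp_whiskerRight_assoc, V.loop]
  by_cases hν : ν.val = ζ.val
  · by_cases hd : d = g
    · subst hd
      rw [if_pos hν, delta_self, MonoidalLinear.smul_whiskerRight, id_whiskerRight,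
        Linear.smul_comp, Category.id_comp, Linear.comp_smul, V.loop]
      by_cases hμ : μ.val = γ.val
      · simp [hν, hμ, smul_smul, treeNorm]
      · simp [hμ]
    · simp [delta_ne hd, hd]
  · simp [hν]

theorem splitTree_fuseTree_self {a b c e : Irr D} (i : TreeIndex a b c e) :
    splitTree V i ≫ fuseTree V i = treeNorm i • 𝟙 _ := by
  rw [splitTree_fuseTree, if_pos ⟨rfl, rfl, rfl⟩, delta_self]

theorem splitTree_fuseTree_of_ne {a b c e : Irr D} {i j : TreeIndex a b c e} (h : i ≠ j) :
    splitTree V i ≫ fuseTree V j = 0 := by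
  obtain ⟨d, μ, ν⟩ := i
  obtain ⟨d', μ', ν'⟩ := j
  rw [splitTree_fuseTree, if_neg]
  rintro ⟨(rfl : d = d'), hν, hμ⟩
  exact h (congrArg (Sigma.mk d) (Prod.ext (Fin.ext hμ) (Fin.ext hν)))

theorem sum_fuseTree_splitTree (a b e : Irr D) :
    ∑ c, ∑ i : TreeIndex a b c e, (treeNorm i)⁻¹ • (fuseTree V i ≫ splitTree V i) =
      𝟙 ((obj a ⊗ obj e) ⊗ obj b) := by
  have insert_outer : ∀ d (ν : Fin (mult a e d)), (V.fuse ν ≫ V.split ν) ▷ obj b =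
      ∑ c, ∑ μ : Fin (mult d b c), (vnorm d b c)⁻¹ •
        (fuseTree V ⟨d, μ, ν⟩ ≫ splitTree V ⟨d, μ, ν⟩) := by
    intro d ν
    rw [comp_whiskerRight, ← Category.id_comp (V.split ν ▷ obj b), ← V.parallel d b]
    simp only [Preadditive.sum_comp, Preadditive.comp_sum, Linear.smul_comp, Linear.comp_smul,
      splitTree, fuseTree, Category.assoc]
  simp only [Fintype.sum_sigma, Fintype.sum_prod_type]
  rw [← id_whiskerRight, ← V.parallel a e, sum_whiskerRight, Finset.sum_comm]
  refine Fintype.sum_congr _ _ fun d => ?_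
  simp only [sum_whiskerRight, MonoidalLinear.smul_whiskerRight, insert_outer, Finset.smul_sum,
    smul_smul, treeNorm, mul_inv]
  rw [Fintype.sum_congr _ _ fun c => Finset.sum_comm, Finset.sum_comm]

theorem eq_sum_splitTree {a b c e : Irr D} (p : Lower (obj a) (obj b) c e) :
    p = ∑ i, ((treeNorm i)⁻¹ * scal c (p ≫ fuseTree V i)) • splitTree V i := by
  conv_lhs => rw [← Category.comp_id p, ← sum_fuseTree_splitTree V, Preadditive.comp_sum]
  rw [Fintype.sum_eq_single c]
  · simp only [Preadditive.comp_sum, Linear.comp_smul, ← Category.assoc, end_comp_eq_smul,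
      smul_smul]
  · intro c' hc'
    simp only [Preadditive.comp_sum, Linear.comp_smul, ← Category.assoc,
      hom_eq_zero_of_ne hc'.symm, zero_comp, smul_zero, Finset.sum_const_zero]

theorem eq_sum_fuseTree {a b f h : Irr D} (q : Upper (obj a) (obj b) f h) :
    q = ∑ i, ((treeNorm i)⁻¹ * scal h (splitTree V i ≫ q)) • fuseTree V i := by
  conv_lhs => rw [← Category.id_comp q, ← sum_fuseTree_splitTree V, Preadditive.sum_comp]
  rw [Fintype.sum_eq_single h]
  · simp only [Preadditive.sum_comp, Linear.smul_comp, Category.assoc, comp_end_eq_smul, smul_smul]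
  · intro h' hh'
    simp only [Preadditive.sum_comp, Linear.smul_comp, Category.assoc,
      hom_eq_zero_of_ne hh', comp_zero, smul_zero, Finset.sum_const_zero]

theorem dualBases_splitTree (a b c e : Irr D) :
    Module.DualBases (R := ℂ) (splitTree V (a := a) (b := b) (c := c) (e := e))
      (fun i => (treeNorm i)⁻¹ • (scal c ∘ₗ Linear.rightComp ℂ (obj c) (fuseTree V i))) where
  eval_same i := by
    simp only [LinearMap.smul_apply, LinearMap.comp_apply, Linear.rightComp_apply,
      splitTree_fuseTree_self, scal_smul_id, smul_eq_mul, inv_mul_cancel₀ (treeNorm_ne_zero i)]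
  eval_of_ne i j h := by
    simp only [LinearMap.smul_apply, LinearMap.comp_apply, Linear.rightComp_apply,
      splitTree_fuseTree_of_ne V h.symm, map_zero, smul_zero]
  total {p p'} h := by
    rw [eq_sum_splitTree V p, eq_sum_splitTree V p']
    exact Fintype.sum_congr _ _ fun i => congrArg (· • splitTree V i) (h i)

theorem dualBases_fuseTree (a b f h : Irr D) :
    Module.DualBases (R := ℂ) (fuseTree V (a := a) (b := b) (f := f) (h := h))
      (fun i => (treeNorm i)⁻¹ • (scal h ∘ₗ Linear.leftComp ℂ (obj h) (splitTree V i))) where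
  eval_same i := by
    simp only [LinearMap.smul_apply, LinearMap.comp_apply, Linear.leftComp_apply,
      splitTree_fuseTree_self, scal_smul_id, smul_eq_mul, inv_mul_cancel₀ (treeNorm_ne_zero i)]
  eval_of_ne i j h := by
    simp only [LinearMap.smul_apply, LinearMap.comp_apply, Linear.leftComp_apply,
      splitTree_fuseTree_of_ne V h, map_zero, smul_zero]
  total {q q'} h := by
    rw [eq_sum_fuseTree V q, eq_sum_fuseTree V q']
    exact Fintype.sum_congr _ _ fun i => congrArg (· • fuseTree V i) (h i)

/-- The basis of a summand of the tube algebra made of pairs of trees. -/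
def tubeCompBasis (L : TubeLabel D) :
    Module.Basis (TreeIndex L.a L.b L.c L.e × TreeIndex L.a L.b L.h L.f) ℂ (TubeComp L) :=
  (dualBases_splitTree V L.a L.b L.c L.e).basis.tensorProduct
    (dualBases_fuseTree V L.a L.b L.f L.h).basis

theorem tubeCompBasis_apply (L : TubeLabel D)
    (i : TreeIndex L.a L.b L.c L.e × TreeIndex L.a L.b L.h L.f) :
    tubeCompBasis V L i = splitTree V i.1 ⊗ₜ[ℂ] fuseTree V i.2 := by
  rw [tubeCompBasis, Module.Basis.tensorProduct_apply', Module.DualBases.coe_basis,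
    Module.DualBases.coe_basis]

open Classical in
/-- The basis of the tube algebra made of pairs of trees. -/
def tubeBasis : Module.Basis
    (Σ L : TubeLabel D, TreeIndex L.a L.b L.c L.e × TreeIndex L.a L.b L.h L.f) ℂ (Tube D) :=
  DFinsupp.basis fun L => tubeCompBasis V L

theorem tubeBasis_apply (L : TubeLabel D)
    (i : TreeIndex L.a L.b L.c L.e × TreeIndex L.a L.b L.h L.f) :
    tubeBasis V ⟨L, i⟩ =
      dbl L.a L.b L.c L.e L.f L.h (splitTree V i.1) (fuseTree V i.2) := by
  classical
  rw [dbl, ← tubeCompBasis_apply, Module.Basis.apply_eq_iff]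
  change sigmaFinsuppEquivDFinsupp.symm (DFinsupp.mapRange
    (fun i => (tubeCompBasis V i).repr) (fun _ => map_zero _) (inc L _)) = _
  rw [Equiv.symm_apply_eq, sigmaFinsuppEquivDFinsupp_single]
  refine (DFinsupp.mapRange_single ..).trans ?_
  exact congrArg _ (Module.Basis.repr_self ..)

/-- The labels of basis diagrams, grouped by outer labels. -/
def diagramIndexEquiv : (Σ L : TubeLabel D,
    TreeIndex L.a L.b L.c L.e × TreeIndex L.a L.b L.h L.f) ≃ DiagramIndex D where
  toFun i := ⟨i.1.a, i.1.b, i.1.c, i.2.1.1, i.1.e, i.1.f, i.2.2.1, i.1.h, i.2.1.2.1, i.2.1.2.2,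
    i.2.2.2.2, i.2.2.2.1⟩
  invFun x := ⟨⟨x.a, x.b, x.c, x.e, x.f, x.h⟩, ⟨x.d, x.μ, x.ν⟩, ⟨x.g, x.γ, x.ζ⟩⟩
  left_inv _ := rfl
  right_inv _ := rfl

/-- The basis of the tube algebra made of the diagrams `[a;b]^{f,g,h;ζ,γ}_{c,d,e;μ,ν}`. -/
def diagramBasis : Module.Basis (DiagramIndex D) ℂ (Tube D) :=
  (tubeBasis V).reindex diagramIndexEquiv

theorem coe_diagramBasis :
    ⇑(diagramBasis V) = fun x : DiagramIndex D => diagram V x.μ x.ν x.ζ x.γ := by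
  ext1 x
  rw [diagramBasis, Module.Basis.reindex_apply]
  exact tubeBasis_apply V ..

theorem finite_tubeLabel : Finite (TubeLabel D) :=
  Finite.of_injective
    (fun L : TubeLabel D => (L.a, L.b, L.c, L.e, L.f, L.h)) fun L L' h => by
      cases L; cases L'; simpa using h

theorem finiteDimensional_tube : FiniteDimensional ℂ (Tube D) := by
  have := finite_tubeLabel (D := D)
  have : ∀ X Y : D, FiniteDimensional ℂ (X ⟶ Y) := UMFC.finiteDimensional_hom
  have := Fintype.ofFinite (TubeLabel D)
  exact inferInstance

/-! ### The structure maps on basis diagrams -/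

theorem mul_diagram_eq_zero (x y : DiagramIndex D) (h : ¬ (x.f = y.h ∧ x.e = y.c)) :
    mul (diagram V x.μ x.ν x.ζ x.γ) (diagram V y.μ y.ν y.ζ y.γ) = 0 := by
  rw [diagram_eq, diagram_eq, mul_dbl]
  by_cases hf : x.f = y.h
  · rw [delta_ne fun he => h ⟨hf, he⟩]
    simp
  · rw [delta_ne (Ne.symm hf)]
    simp

theorem counit_diagram (x : DiagramIndex D) : counit (diagram V x.μ x.ν x.ζ x.γ) =
    open Classical in
    if x.e = x.f ∧ x.c = x.h ∧ x.d = x.g ∧ x.ν.val = x.ζ.val ∧ x.μ.val = x.γ.val then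
      ((Real.sqrt (qdim x.a * qdim x.f * qdim x.b / qdim x.h) : ℝ) : ℂ) else 0 := by
  obtain ⟨a, b, c, d, e, f, g, h, μ, ν, ζ, γ⟩ := x
  dsimp only
  rw [diagram_eq, counit_dbl]
  by_cases he : e = f
  · subst he
    rw [delta_self, wrap_id, Category.id_comp, ← Category.assoc, splitTree_fuseTree]
    by_cases hc : c = h
    · subst hc
      by_cases hd : d = g ∧ ν.val = ζ.val ∧ μ.val = γ.val
      · rw [if_pos hd, if_pos ⟨rfl, rfl, hd⟩, treeNorm_eq_sqrt]
        simp
      · rw [if_neg hd, if_neg fun h => hd h.2.2]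
        simp
    · rw [delta_ne (Ne.symm hc), comp_zero, map_zero, if_neg fun h => hc h.2.1]
  · rw [delta_ne he, if_neg fun h => he h.1]
    simp

theorem comul_dbl_eq_sum_tree (a b c e f h : Irr D) (p : Lower (obj a) (obj b) c e)
    (q : Upper (obj a) (obj b) f h) :
    comul (dbl a b c e f h p q) = ∑ i, ∑ k, ∑ t : TreeIndex a b k i, (treeNorm t)⁻¹ •
      (dbl a b k i f h (splitTree V t) q ⊗ₜ[ℂ] dbl a b c e i k p (fuseTree V t)) := by
  rw [comul_dbl]
  refine Fintype.sum_congr _ _ fun i => ?_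
  set δ := decomp ((obj a ⊗ obj i) ⊗ obj b)
  set G := comulTerm (obj a) (obj b) c e f h p q i
  have insert_trees : ∀ r, G _ (δ.inj r) (δ.proj r) = ∑ k, ∑ t : TreeIndex a b k i,
      (treeNorm t)⁻¹ • G _ (δ.inj r) (fuseTree V t ≫ splitTree V t ≫ δ.proj r) := by
    intro r
    conv_lhs => rw [← Category.id_comp (δ.proj r), ← sum_fuseTree_splitTree V]
    simp only [Preadditive.sum_comp, map_sum, Linear.smul_comp, map_smul, Category.assoc]
  rw [Fintype.sum_congr _ _ insert_trees, Finset.sum_comm]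
  refine Fintype.sum_congr _ _ fun k => ?_
  rw [Finset.sum_comm]
  refine Fintype.sum_congr _ _ fun t => ?_
  rw [← Finset.smul_sum, casimir_comp_comp_proj, comulTerm_apply, resolve_obj, resolve_obj]

theorem comul_diagram (a b c d e f g h : Irr D) (μ : Fin (mult d b c)) (ν : Fin (mult a e d))
    (ζ : Fin (mult a f g)) (γ : Fin (mult g b h)) :
    comul (diagram V μ ν ζ γ) =
      ∑ i, ∑ j, ∑ k, ∑ ρ : Fin (mult j b k), ∑ σ : Fin (mult a i j),
        ((Real.sqrt (qdim j / (qdim a * qdim i)) *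
          Real.sqrt (qdim k / (qdim j * qdim b)) : ℝ) : ℂ) •
          (diagram V ρ σ ζ γ ⊗ₜ[ℂ] diagram V μ ν σ ρ) := by
  rw [diagram_eq, comul_dbl_eq_sum_tree V]
  refine Fintype.sum_congr _ _ fun i => ?_
  simp only [Fintype.sum_sigma, Fintype.sum_prod_type]
  rw [Finset.sum_comm]
  simp only [treeNorm, mul_inv, inv_vnorm, Complex.ofReal_mul, diagram_eq]

theorem resolve_sum_split_fuse_left {ι κ : Irr D → Type*} [∀ k, Fintype (ι k)]
    [∀ k, Fintype (κ k)] (a a' : Irr D) (B : D) (c e f h : Irr D)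
    (x : ∀ k, Fin (mult a a' k) → ι k → ℂ) (P : ∀ k, ι k → Lower (obj k) B c e)
    (y : ∀ k, Fin (mult a a' k) → κ k → ℂ) (Q : ∀ k, κ k → Upper (obj k) B f h) :
    resolve (obj a ⊗ obj a') B c e f h
      (∑ k, ∑ α, (∑ i, x k α i • P k i) ≫ arc (V.split α) (𝟙 B) _)
      (∑ k, ∑ α, arc (V.fuse α) (𝟙 B) _ ≫ ∑ j, y k α j • Q k j) =
      ∑ k, ∑ α, ∑ j, ∑ i, (vnorm a a' k * y k α j * x k α i) •
        resolve (obj k) B c e f h (P k i) (Q k j) := by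
  rw [← Fintype.sum_sigma', ← Fintype.sum_sigma', ← Fintype.sum_sigma', map_sum]
  refine Fintype.sum_congr _ _ fun s => ?_
  rw [map_sum, LinearMap.sum_apply, Fintype.sum_eq_single s]
  · rw [resolve_arc_slide, ← arc_comp_assoc, split_fuse, arc_smul_left, Category.comp_id, arc_id,
      Linear.smul_comp, Category.id_comp, map_smul, map_sum, Finset.smul_sum]
    refine Fintype.sum_congr _ _ fun j => ?_
    simp only [map_sum, map_smul, LinearMap.sum_apply, LinearMap.smul_apply, Finset.smul_sum,
      smul_smul, mul_assoc]
  · intro s' hs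
    rw [resolve_arc_slide, ← arc_comp_assoc, split_fuse_of_ne V hs, arc_zero_left, zero_comp,
      map_zero]

theorem resolve_sum_split_fuse_right {ι κ : Irr D → Type*} [∀ k, Fintype (ι k)]
    [∀ k, Fintype (κ k)] (A : D) (b' b : Irr D) (c e f h : Irr D)
    (x : ∀ k, Fin (mult b' b k) → ι k → ℂ) (P : ∀ k, ι k → Lower A (obj k) c e)
    (y : ∀ k, Fin (mult b' b k) → κ k → ℂ) (Q : ∀ k, κ k → Upper A (obj k) f h) :
    resolve A (obj b' ⊗ obj b) c e f h
      (∑ k, ∑ α, (∑ i, x k α i • P k i) ≫ arc (𝟙 A) (V.split α) _)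
      (∑ k, ∑ α, arc (𝟙 A) (V.fuse α) _ ≫ ∑ j, y k α j • Q k j) =
      ∑ k, ∑ α, ∑ j, ∑ i, (vnorm b' b k * y k α j * x k α i) •
        resolve A (obj k) c e f h (P k i) (Q k j) := by
  rw [← Fintype.sum_sigma', ← Fintype.sum_sigma', ← Fintype.sum_sigma', map_sum]
  refine Fintype.sum_congr _ _ fun s => ?_
  rw [map_sum, LinearMap.sum_apply, Fintype.sum_eq_single s]
  · rw [resolve_arc_slide, ← arc_comp_assoc, split_fuse, arc_smul_right, Category.comp_id, arc_id,
      Linear.smul_comp, Category.id_comp, map_smul, map_sum, Finset.smul_sum]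
    refine Fintype.sum_congr _ _ fun j => ?_
    simp only [map_sum, map_smul, LinearMap.sum_apply, LinearMap.smul_apply, Finset.smul_sum,
      smul_smul, mul_assoc]
  · intro s' hs
    rw [resolve_arc_slide, ← arc_comp_assoc, split_fuse_of_ne V hs, arc_zero_right, zero_comp,
      map_zero]

theorem stackLower_splitTree (F : FSymbols V) {a b c d e a' b' d' e' : Irr D}
    (μ : Fin (mult d b c)) (ν : Fin (mult a e d))
    (μ' : Fin (mult d' b' e)) (ν' : Fin (mult a' e' d')) :
    stackLower _ _ _ _ c e e e' (splitTree V ⟨d, μ, ν⟩) (splitTree V ⟨d', μ', ν'⟩) =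
      ∑ j, ∑ ω : Fin (mult a d' j), ∑ τ : Fin (mult j b' d), F.splitInv a d' b' d j e ω τ μ' ν •
        ∑ k, ∑ α : Fin (mult a a' k), (∑ β' : Fin (mult k e' j),
          F.splitInv a a' e' j k d' α β' ν' ω •
          ∑ s, ∑ ξ : Fin (mult b' b s), (∑ lam' : Fin (mult j s c),
            F.split j b' b c d s τ μ ξ lam' • splitTree V ⟨j, lam', β'⟩) ≫
              arc (𝟙 (obj k)) (V.split ξ) _) ≫ arc (V.split α) (𝟙 _) _ := by
  rw [stackLower_apply, delta_self, Category.id_comp]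
  refine (splitTree_wrap_splitTree_nest ..).trans ?_
  rw [F.splitInv_move]
  simp only [sum_whiskerRight, Preadditive.sum_comp, Preadditive.comp_sum,
    MonoidalLinear.smul_whiskerRight, Linear.smul_comp, Linear.comp_smul,
    split_split_split_associator, F.splitInv_move, F.split_move, split_split_arc, Category.assoc,
    splitTree]

theorem stackUpper_fuseTree (F : FSymbols V) {a b f g h a' b' f' g' : Irr D}
    (ζ : Fin (mult a f g)) (γ : Fin (mult g b h))
    (ζ' : Fin (mult a' f' g')) (γ' : Fin (mult g' b' f)) :
    stackUpper _ _ _ _ f h f' f (fuseTree V ⟨g, γ, ζ⟩) (fuseTree V ⟨g', γ', ζ'⟩) =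
      ∑ i, ∑ ρ : Fin (mult a g' i), ∑ σ : Fin (mult i b' g), F.fuseInv a g' b' g i f ρ σ γ' ζ •
        ∑ k, ∑ α : Fin (mult a a' k), arc (V.fuse α) (𝟙 _) _ ≫ (∑ β : Fin (mult k f' i),
          F.fuseInv a a' f' i k g' α β ζ' ρ •
          ∑ s, ∑ ξ : Fin (mult b' b s), arc (𝟙 (obj k)) (V.fuse ξ) _ ≫
            (∑ lam : Fin (mult i s h),
              F.fuse i b' b h g s σ γ ξ lam • fuseTree V ⟨i, lam, β⟩)) := by
  rw [stackUpper_apply, delta_self, Category.comp_id]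
  refine (nest_wrap_fuseTree_fuseTree ..).trans ?_
  rw [F.fuseInv_move]
  simp only [sum_whiskerRight, Preadditive.sum_comp, Preadditive.comp_sum,
    MonoidalLinear.smul_whiskerRight, Linear.smul_comp, Linear.comp_smul,
    associator_fuse_fuse_fuse, F.fuseInv_move]
  simp only [F.fuse_move, Preadditive.comp_sum, Linear.comp_smul, arc_fuse_fuse, fuseTree]

theorem mul_diagram (F : FSymbols V) (a b c d e f g h a' b' d' e' f' g' : Irr D)
    (μ : Fin (mult d b c)) (ν : Fin (mult a e d))
    (ζ : Fin (mult a f g)) (γ : Fin (mult g b h))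
    (μ' : Fin (mult d' b' e)) (ν' : Fin (mult a' e' d'))
    (ζ' : Fin (mult a' f' g')) (γ' : Fin (mult g' b' f)) :
    mul (diagram V μ ν ζ γ) (diagram V μ' ν' ζ' γ') =
      ∑ i, ∑ ρ : Fin (mult a g' i), ∑ σ : Fin (mult i b' g),
      ∑ j, ∑ ω : Fin (mult a d' j), ∑ τ : Fin (mult j b' d),
      ∑ k, ∑ α : Fin (mult a a' k), ∑ β : Fin (mult k f' i), ∑ β' : Fin (mult k e' j),
      ∑ s, ∑ ξ : Fin (mult b' b s), ∑ lam : Fin (mult i s h), ∑ lam' : Fin (mult j s c),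
        (F.fuseInv a g' b' g i f ρ σ γ' ζ * F.splitInv a d' b' d j e ω τ μ' ν *
          F.fuseInv a a' f' i k g' α β ζ' ρ * F.splitInv a a' e' j k d' α β' ν' ω *
          F.fuse i b' b h g s σ γ ξ lam * F.split j b' b c d s τ μ ξ lam' *
          ((Real.sqrt (qdim a * qdim a' / qdim k) *
            Real.sqrt (qdim b * qdim b' / qdim s) : ℝ) : ℂ)) •
          diagram V lam' β' β lam := by
  have expand : ∀ (x : ∀ j, Fin (mult a d' j) → Fin (mult j b' d) → ℂ)
      (P : ∀ j, Fin (mult a d' j) → Fin (mult j b' d) →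
        Lower (obj a ⊗ obj a') (obj b' ⊗ obj b) c e')
      (y : ∀ i, Fin (mult a g' i) → Fin (mult i b' g) → ℂ)
      (Q : ∀ i, Fin (mult a g' i) → Fin (mult i b' g) →
        Upper (obj a ⊗ obj a') (obj b' ⊗ obj b) f' h),
      resolve (obj a ⊗ obj a') (obj b' ⊗ obj b) c e' f' h
        (∑ j, ∑ ω, ∑ τ, x j ω τ • P j ω τ) (∑ i, ∑ ρ, ∑ σ, y i ρ σ • Q i ρ σ) =
      ∑ i, ∑ ρ, ∑ σ, ∑ j, ∑ ω, ∑ τ, (y i ρ σ * x j ω τ) • resolve _ _ c e' f' h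
        (P j ω τ) (Q i ρ σ) := by
    intro x P y Q
    simp only [map_sum (resolve (obj a ⊗ obj a') (obj b' ⊗ obj b) c e' f' h _), map_smul]
    simp only [map_sum, map_smul, LinearMap.sum_apply, LinearMap.smul_apply, Finset.smul_sum,
      smul_smul]
  rw [diagram_eq, diagram_eq, mul_dbl_eq_resolve_stack, stackLower_splitTree V F,
    stackUpper_fuseTree V F, expand]
  iterate 6 refine Fintype.sum_congr _ _ fun _ => ?_
  rw [resolve_sum_split_fuse_left]
  simp only [Finset.smul_sum, smul_smul]
  iterate 4 refine Fintype.sum_congr _ _ fun _ => ?_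
  rw [resolve_sum_split_fuse_right]
  simp only [Finset.smul_sum, smul_smul]
  iterate 4 refine Fintype.sum_congr _ _ fun _ => ?_
  rw [resolve_obj, ← diagram_eq, vnorm_comm b' b, vnorm, vnorm]
  congr 1
  push_cast
  ring

end Vertices

end

end TubeAlg

theorem mainTheorem1 (D : Type u) [Category.{v} D] [Preadditive D] [Linear ℂ D]
    [HasFiniteBiproducts D] [MonoidalCategory D] [MonoidalPreadditive D] [MonoidalLinear ℂ D]
    [RigidCategory D] [UMFC D] :
    -- weak Hopf algebra
    FiniteDimensional ℂ (Tube D) ∧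
    IsWeakHopfAlgebra (mul (D := D)) one comul counit antipode ∧
    -- the grouplike element implementing the square of the antipode
    IsGrouplike (mul (D := D)) one comul xi xiInv ∧
    (∀ X : Tube D, antipode (antipode X) = mul (mul xi X) xiInv) ∧
    (∀ (a b c e f h : Irr D) (p : Lower (obj a) (obj b) c e) (q : Upper (obj a) (obj b) f h),
      antipode (antipode (dbl a b c e f h p q)) =
        ((qdim f * qdim c / (qdim h * qdim e) : ℝ) : ℂ) • dbl a b c e f h p q) ∧
    -- the numbers `d_x` are the positive dimensions determined by the fusion rule
    (∀ x : Irr D, 0 < qdim x) ∧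
    (∀ x y : Irr D, ¬ IsZero (obj x ⊗ obj y) →
      ∑ z, (mult x y z : ℝ) * qdim z = qdim x * qdim y) ∧
    -- for each choice of vertices: the double-arc diagrams form a basis, and the structure maps
    -- take the following form on them
    ∀ V : VertexBasis D,
      LinearIndependent ℂ (fun x : DiagramIndex D => diagram V x.μ x.ν x.ζ x.γ) ∧
      Submodule.span ℂ (Set.range fun x : DiagramIndex D => diagram V x.μ x.ν x.ζ x.γ) = ⊤ ∧
      (∀ x y : DiagramIndex D, ¬ (x.f = y.h ∧ x.e = y.c) →
        mul (diagram V x.μ x.ν x.ζ x.γ) (diagram V y.μ y.ν y.ζ y.γ) = 0) ∧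
      (∀ (F : FSymbols V) (a b c d e f g h a' b' d' e' f' g' : Irr D)
        (μ : Fin (mult d b c)) (ν : Fin (mult a e d))
        (ζ : Fin (mult a f g)) (γ : Fin (mult g b h))
        (μ' : Fin (mult d' b' e)) (ν' : Fin (mult a' e' d'))
        (ζ' : Fin (mult a' f' g')) (γ' : Fin (mult g' b' f)),
        mul (diagram V μ ν ζ γ) (diagram V μ' ν' ζ' γ') =
          ∑ i, ∑ ρ : Fin (mult a g' i), ∑ σ : Fin (mult i b' g),
          ∑ j, ∑ ω : Fin (mult a d' j), ∑ τ : Fin (mult j b' d),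
          ∑ k, ∑ α : Fin (mult a a' k), ∑ β : Fin (mult k f' i), ∑ β' : Fin (mult k e' j),
          ∑ s, ∑ ξ : Fin (mult b' b s), ∑ lam : Fin (mult i s h), ∑ lam' : Fin (mult j s c),
            (F.fuseInv a g' b' g i f ρ σ γ' ζ * F.splitInv a d' b' d j e ω τ μ' ν *
              F.fuseInv a a' f' i k g' α β ζ' ρ * F.splitInv a a' e' j k d' α β' ν' ω *
              F.fuse i b' b h g s σ γ ξ lam * F.split j b' b c d s τ μ ξ lam' *
              ((Real.sqrt (qdim a * qdim a' / qdim k) *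
                Real.sqrt (qdim b * qdim b' / qdim s) : ℝ) : ℂ)) •
              diagram V lam' β' β lam) ∧
      (∀ x : DiagramIndex D, counit (diagram V x.μ x.ν x.ζ x.γ) =
        open Classical in
        if x.e = x.f ∧ x.c = x.h ∧ x.d = x.g ∧ x.ν.val = x.ζ.val ∧ x.μ.val = x.γ.val then
          ((Real.sqrt (qdim x.a * qdim x.f * qdim x.b / qdim x.h) : ℝ) : ℂ) else 0) ∧
      (∀ (a b c d e f g h : Irr D) (μ : Fin (mult d b c)) (ν : Fin (mult a e d))
        (ζ : Fin (mult a f g)) (γ : Fin (mult g b h)),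
        comul (diagram V μ ν ζ γ) =
          ∑ i, ∑ j, ∑ k, ∑ ρ : Fin (mult j b k), ∑ σ : Fin (mult a i j),
            ((Real.sqrt (qdim j / (qdim a * qdim i)) *
              Real.sqrt (qdim k / (qdim j * qdim b)) : ℝ) : ℂ) •
              (diagram V ρ σ ζ γ ⊗ₜ[ℂ] diagram V μ ν σ ρ)) :=
  ⟨finiteDimensional_tube, isWeakHopfAlgebra, isGrouplike_xi, antipode_antipode,
    antipode_antipode_dbl, qdim_pos, fusion_rule, fun V =>
      ⟨coe_diagramBasis V ▸ (diagramBasis V).linearIndependent,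
        coe_diagramBasis V ▸ (diagramBasis V).span_eq, mul_diagram_eq_zero V, mul_diagram V,
        counit_diagram V, comul_diagram V⟩⟩
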